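/- Let $m\ge 2$ and $n\ge 1$ be integers and let $t_0<t_1<\dots<t_n$ be an arbitrary partition of $I=[t_0,t_n]$, extended by $t_j=t_0$ for $j<0$ and $t_j=t_n$ for $j>n$. For $0\le i\le n+m-1$ let $B_i$ be the B-spline of degree $m$ with knots $t_{i-m},\dots,t_{i+1}$ (normalized so that $\sum_i B_i=1$ on $I$). For $1\le i\le n+m-2$ let $$\tilde\mu_i(f)=\int_I \tilde M_{i-1}(t)f(t)\,dt,$$ where $\tilde M_{i-1}$ is the B-spline of degree $m-2$ with knots $t_{i-m+1},\dots,t_i$, normalized by $\int_I\tilde M_{i-1}=1$; put $\tilde\mu_0(f)=f(t_0)$ and $\tilde\mu_{n+m-1}(f)=f(t_n)$. For real weights $a_i,b_i,c_i$ $(1\le i\le n+m-2)$ consider the Goodman–Sharma type integral quasi-interpolant $$G_2f=f(t_0)B_0+\sum_{i=1}^{n+m-2}\bigl[a_i\tilde\mu_{i-1}(f)+b_i\tilde\mu_i(f)+c_i\tilde\mu_{i+1}(f)\bigr]B_i+f(t_n)B_{n+m-1}.$$ Then there is exactly one choice of the weights for which $G_2$ is exact on $\mathbb P_2$, i.e.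 $G_2p=p$ on $I$ for every polynomial $p$ of degree at most $2$. For this choice, $G_2$ is a bounded linear operator on $C(I)$ (with the uniform norm), and $$\|G_2\|_\infty\le 5 ,$$ for every degree $m\ge2$ and every partition of $I$. -/

import Mathlib

open Set

noncomputable section

/-- The extended knot sequence of a partition `t 0 < t 1 < ⋯ < t n` of `I = [t 0, t n]`: the two
end points are repeated, i.e. `t_j = t_0` for `j ≤ 0` and `t_j = t_n` for `j ≥ n`. -/
def knot {n : ℕ} (t : Fin (n + 1) → ℝ) (j : ℤ) : ℝ :=
  t ⟨min j.toNat n, Nat.lt_succ_of_le (min_le_right _ _)⟩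

open Classical in
/-- Cox–de Boor recursion: `bspline T d j` is the B-spline of degree `d` with the knots
`T j, …, T (j + d + 1)`, normalized so that the B-splines of degree `d` form a partition of unity.
Quotients with denominator `0` are `0`, which is the usual convention of the recursion.
In degree `0` the intervals are half-open on the right, except for the last nondegenerate one, which
contains its right end point when that is the largest knot. -/
def bspline (T : ℤ → ℝ) : ℕ → ℤ → ℝ → ℝ
  | 0, j, x =>
      if (T j ≤ x ∧ x < T (j + 1)) ∨ (T j < x ∧ x = T (j + 1) ∧ ∀ k, T k ≤ x) then 1 else 0
  | d + 1, j, x =>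
      (x - T j) / (T (j + d + 1) - T j) * bspline T d j x +
        (T (j + d + 2) - x) / (T (j + d + 2) - T (j + 1)) * bspline T d (j + 1) x

/-- `B_i`, the B-spline of degree `m` with support `[t_{i-m}, t_{i+1}]`. -/
def B {n : ℕ} (m : ℕ) (t : Fin (n + 1) → ℝ) (i : ℕ) : ℝ → ℝ :=
  bspline (knot t) m ((i : ℤ) - m)

/-- The B-spline of degree `m - 2` with support `[t_{i-m+1}, t_i]`. -/
def Bred {n : ℕ} (m : ℕ) (t : Fin (n + 1) → ℝ) (i : ℕ) : ℝ → ℝ :=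
  bspline (knot t) (m - 2) ((i : ℤ) - m + 1)

/-- The normalized B-spline moment `μ̃_i(f)`: the integral of `f` against the B-spline of degree
`m - 2` with support `[t_{i-m+1}, t_i]`, scaled to have integral `1`. For the two indices for which
this support is a single point (`i = 0` and `i = n + m - 1`, when the partition is strictly
increasing), the normalized B-spline is the unit mass at that point. -/
def mu {n : ℕ} (m : ℕ) (t : Fin (n + 1) → ℝ) (i : ℕ) (f : ℝ → ℝ) : ℝ :=
  open Classical in
  if knot t ((i : ℤ) - m + 1) = knot t i then f (knot t i)
  else ∫ x in (t 0)..(t (Fin.last n)), Bred m t i x / (∫ y in (t 0)..(t (Fin.last n)), Bred m t i y) * f x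

/-- The Goodman–Sharma type integral quasi-interpolant with weights `a_i, b_i, c_i`,
`1 ≤ i ≤ n + m - 2`. -/
def G2 {n : ℕ} (m : ℕ) (t : Fin (n + 1) → ℝ) (a b c : ℕ → ℝ) (f : ℝ → ℝ) (x : ℝ) : ℝ :=
  f (t 0) * B m t 0 x
    + ∑ i ∈ Finset.Icc 1 (n + m - 2),
        (a i * mu m t (i - 1) f + b i * mu m t i f + c i * mu m t (i + 1) f) * B m t i x
    + f (t (Fin.last n)) * B m t (n + m - 1) x

/-- The weights make the quasi-interpolant exact on polynomials of degree at most `2`. -/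
def ExactOnP2 {n : ℕ} (m : ℕ) (t : Fin (n + 1) → ℝ) (a b c : ℕ → ℝ) : Prop :=
  ∀ p : Polynomial ℝ, p.natDegree ≤ 2 →
    ∀ x ∈ Icc (t 0) (t (Fin.last n)), G2 m t a b c (fun y => p.eval y) x = p.eval x

end

/-! Write `m = d + 2`, and for an interior index `i` let `L` be the span, `S` the sum and `Z` the
sum of squares of the `m` knots `t_{i-m+1}, …, t_i`. Put `Q = m Z - S ^ 2`, which is `m ^ 2` times
their variance.

Exactness. B-splines are linearly independent, so `G2 p = p` is an identity between B-spline
coefficients. Those of `1, x, x ^ 2` are normalized elementary symmetric functions of the knots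
(`sum_knotSqSum_mul_bspline`), and the moments of the functionals follow from integration by parts
(`splineMoment_eq`). For each `i` this leaves three linear equations in `a_i, b_i, c_i` with one
solution (`weights_iff`); the outer weights are nonpositive multiples of `Q`.

Norm. B-splines are nonnegative and sum to `1`, so it is enough that every coefficient functional
has norm at most `5`. If `Q ≤ (m - 1) L ^ 2`, the sum of the absolute weights is already at most `5`
(`abs_weights_le`). Otherwise that sum is too crude and cancellation is needed: the functional
equals `μ̃_i(f)` minus `Q / (m (m - 1))` times the integral of `M'' f`, where `M` is `B_i` divided
by the length of its support. Hence its norm is at most `1 + Q / (m (m - 1)) * Var M'`.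

The variation is controlled in two moves. First, `M''` has the sign pattern `+, -, +` and `M'`
vanishes at both ends, so `Var M'` is at most twice the oscillation of `M'`
(`integral_abs_psplineDeriv₂_le`). Secondly, this oscillation is at most `2 m (m - 1) / Q`
(`IsKnotSeq.psplineDeriv_sub_le`), which gives `1 + 4 = 5`.

For the oscillation, `M'` is written as an integral along a vertical line in the complex plane
(`psplineDeriv_eq_integral`). The modulus of the integrand is governed by the product of `(x - t_k)
^ 2 + y ^ 2` over the knots. If this product is at least `y ^ (2 (m - 1)) * (y ^ 2 + A) ^ 3`, then
`|M'| ≤ m / (π A)`. A suitable `A` is found by Bernoulli's inequality when no squared distance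
exceeds a third of their sum, and otherwise by keeping the two largest apart; what remains is
elementary numerics in the normalized variance `N = Q / ((m - 1) L ^ 2)`. -/

/-! ### Knot sequences -/

/-- A knot sequence with strictly increasing knots `T 0 < ⋯ < T n`, constant outside `[0, n]`. -/
structure IsKnotSeq (T : ℤ → ℝ) (n : ℕ) : Prop where
  one_le : 1 ≤ n
  left : ∀ j, j ≤ 0 → T j = T 0
  right : ∀ j, (n : ℤ) ≤ j → T j = T n
  lt_succ : ∀ j : ℤ, 0 ≤ j → j < n → T j < T (j + 1)

theorem knot_isKnotSeq {n : ℕ} (hn : 1 ≤ n) {t : Fin (n + 1) → ℝ} (ht : StrictMono t) :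
    IsKnotSeq (knot t) n where
  one_le := hn
  left j hj := by
    unfold knot
    congr 2
    simp [Int.toNat_of_nonpos hj]
  right j hj := by
    unfold knot
    congr 2
    have : n ≤ j.toNat := by omega
    simp [this]
  lt_succ j h0 h1 := by
    unfold knot
    apply ht
    rw [Fin.lt_def]
    simp only
    omega

theorem knot_zero {n : ℕ} (t : Fin (n + 1) → ℝ) : knot t 0 = t 0 := by
  unfold knot; congr 1

theorem knot_last {n : ℕ} (t : Fin (n + 1) → ℝ) : knot t n = t (Fin.last n) := by
  unfold knot; congr 1; ext; simp

namespace IsKnotSeq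

variable {T : ℤ → ℝ} {n : ℕ}

theorem mono (h : IsKnotSeq T n) : Monotone T := by
  apply monotone_int_of_le_succ
  intro j
  rcases lt_or_ge j 0 with hj | hj
  · rw [h.left j hj.le, h.left (j + 1) (by omega)]
  rcases lt_or_ge j n with hj' | hj'
  · exact (h.lt_succ j hj hj').le
  · rw [h.right j hj', h.right (j + 1) (by omega)]

theorem lt (h : IsKnotSeq T n) {j k : ℤ} (hj : j < n) (hk : 0 < k) (hjk : j < k) : T j < T k := by
  have h1 : T j ≤ T (max j 0) := h.mono (le_max_left _ _)
  have h2 := h.lt_succ (max j 0) (le_max_right _ _)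
    (max_lt hj (by have := h.one_le; omega))
  exact (h1.trans_lt h2).trans_le (h.mono (by omega))

theorem zero_le (h : IsKnotSeq T n) (j : ℤ) : T 0 ≤ T j := by
  rcases le_total j 0 with hj | hj
  · exact (h.left j hj).ge
  · exact h.mono hj

theorem le_last (h : IsKnotSeq T n) (j : ℤ) : T j ≤ T n := by
  rcases le_total j n with hj | hj
  · exact h.mono hj
  · exact (h.right j hj).le

theorem zero_lt_last (h : IsKnotSeq T n) : T 0 < T n := by
  have := h.one_le
  exact h.lt (by omega) (by omega) (by omega)

theorem finite_range (h : IsKnotSeq T n) : (range T).Finite := by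
  apply ((finite_Icc (0 : ℤ) n).image T).subset
  rintro _ ⟨j, rfl⟩
  rcases lt_or_ge j 0 with hj | hj
  · exact ⟨0, by simp, (h.left j hj.le).symm⟩
  rcases lt_or_ge j n with hj' | hj'
  · exact ⟨j, ⟨hj, hj'.le⟩, rfl⟩
  · exact ⟨n, by simp, (h.right j hj').symm⟩

end IsKnotSeq

/-! ### B-splines: recursion, support, sign, derivative -/

/-- The B-spline of degree `d` divided by the length of its support. -/
noncomputable def pspline (T : ℤ → ℝ) (d : ℕ) (j : ℤ) (x : ℝ) : ℝ :=
  bspline T d j x / (T (j + d + 1) - T j)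

section Basic

variable {T : ℤ → ℝ}

theorem bspline_succ (T : ℤ → ℝ) (d : ℕ) (j : ℤ) (x : ℝ) :
    bspline T (d + 1) j x =
      (x - T j) * pspline T d j x + (T (j + d + 2) - x) * pspline T d (j + 1) x := by
  unfold pspline
  rw [bspline, show j + 1 + (d : ℤ) + 1 = j + d + 2 by ring]
  ring

theorem bspline_zero_of_not {j : ℤ} {x : ℝ} (h1 : ¬ (T j ≤ x ∧ x ≤ T (j + 1))) :
    bspline T 0 j x = 0 := by
  rw [bspline, if_neg]
  rintro (⟨h, h'⟩ | ⟨h, h', -⟩)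
  · exact h1 ⟨h, h'.le⟩
  · exact h1 ⟨h.le, h'.le⟩

theorem bspline_eq_zero_of_degenerate (hT : Monotone T) {d : ℕ} {j : ℤ} (x : ℝ)
    (h : T (j + d + 1) = T j) : bspline T d j x = 0 := by
  cases d with
  | zero =>
    rw [bspline, if_neg]
    simp only [Nat.cast_zero, add_zero] at h
    rw [h]
    rintro (⟨h, h'⟩ | ⟨h, h', -⟩)
    · exact absurd h' (not_lt.2 h)
    · exact absurd h (by simp [h'])
  | succ d =>
    push_cast at h
    have h1 : T (j + d + 1) = T j :=
      le_antisymm ((hT (by omega)).trans h.le) (hT (by omega))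
    have h2 : T (j + d + 2) = T (j + 1) :=
      le_antisymm ((hT (by omega)).trans (h.le.trans (hT (by omega)))) (hT (by omega))
    rw [bspline, h1, h2]
    simp

/-- No condition on the length of the support is needed: if it is `0`, both sides vanish by the
convention for quotients. -/
theorem bspline_eq_mul_pspline (hT : Monotone T) (d : ℕ) (j : ℤ) (x : ℝ) :
    bspline T d j x = (T (j + d + 1) - T j) * pspline T d j x := by
  unfold pspline
  by_cases h : T (j + d + 1) = T j
  · rw [bspline_eq_zero_of_degenerate hT x h]; simp
  · rw [mul_div_cancel₀ _ (sub_ne_zero.2 h)]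

theorem pspline_eq_zero_of_degenerate {d : ℕ} {j : ℤ} (x : ℝ)
    (h : T (j + d + 1) = T j) : pspline T d j x = 0 := by
  simp [pspline, h]

/-- The two-term recursion for the B-splines divided by the length of their support. -/
theorem pspline_succ (hT : Monotone T) (d : ℕ) (j : ℤ) (x : ℝ) :
    (T (j + d + 2) - T j) * pspline T (d + 1) j x =
      (x - T j) * pspline T d j x + (T (j + d + 2) - x) * pspline T d (j + 1) x := by
  rw [← bspline_succ, bspline_eq_mul_pspline hT]
  push_cast
  rw [show j + ((d : ℤ) + 1) + 1 = j + d + 2 by ring]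

theorem pspline_eq_zero_of_notMem (hT : Monotone T) (d : ℕ) (j : ℤ) {x : ℝ}
    (hx : ¬ (T j ≤ x ∧ x ≤ T (j + d + 1))) : pspline T d j x = 0 := by
  induction d generalizing j with
  | zero =>
    unfold pspline
    rw [bspline_zero_of_not (by simpa using hx), zero_div]
  | succ d ih =>
    push_cast at hx
    by_cases hS : T (j + d + 2) = T j
    · apply pspline_eq_zero_of_degenerate
      push_cast
      rw [← hS]; congr 1; ring
    · have h1 := pspline_succ hT d j x
      rw [ih j, ih (j + 1)] at h1
      · simpa [sub_ne_zero.2 hS] using h1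
      · rintro ⟨h2, h3⟩
        exact hx ⟨(hT (by omega)).trans h2, h3.trans (hT (by omega))⟩
      · rintro ⟨h2, h3⟩
        exact hx ⟨h2, h3.trans (hT (by omega))⟩

theorem pspline_nonneg (hT : Monotone T) (d : ℕ) (j : ℤ) (x : ℝ) : 0 ≤ pspline T d j x := by
  induction d generalizing j with
  | zero =>
    unfold pspline
    apply div_nonneg
    · rw [bspline]; split_ifs <;> simp
    · exact sub_nonneg.2 (hT (by omega))
  | succ d ih =>
    by_cases hx : T j ≤ x ∧ x ≤ T (j + d + 2)
    · by_cases hS : T (j + d + 2) = T j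
      · apply (pspline_eq_zero_of_degenerate x _).ge
        push_cast
        rw [← hS]; congr 1; ring
      · have h1 := pspline_succ hT d j x
        have hS' : 0 < T (j + d + 2) - T j :=
          sub_pos.2 (lt_of_le_of_ne (hT (by omega)) (Ne.symm hS))
        have h2 := mul_nonneg (sub_nonneg.2 hx.1) (ih j)
        have h3 := mul_nonneg (sub_nonneg.2 hx.2) (ih (j + 1))
        exact nonneg_of_mul_nonneg_right (by rw [h1]; positivity) hS'
    · apply (pspline_eq_zero_of_notMem hT _ _ _).ge
      push_cast
      rwa [show j + ((d : ℤ) + 1) + 1 = j + d + 2 by ring]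

theorem bspline_nonneg (hT : Monotone T) (d : ℕ) (j : ℤ) (x : ℝ) : 0 ≤ bspline T d j x := by
  rw [bspline_eq_mul_pspline hT]
  exact mul_nonneg (sub_nonneg.2 (hT (by omega))) (pspline_nonneg hT d j x)

/-- The derivative of `pspline T d j` away from the knots. -/
noncomputable def psplineDeriv (T : ℤ → ℝ) : ℕ → ℤ → ℝ → ℝ
  | 0, _, _ => 0
  | d + 1, j, x =>
      (d + 1) * (pspline T d j x - pspline T d (j + 1) x) / (T (j + d + 2) - T j)

theorem pspline_degenerate_left (hT : Monotone T) {d : ℕ} {j : ℤ} (x : ℝ)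
    (h : T (j + d + 2) = T j) : pspline T d j x = 0 :=
  pspline_eq_zero_of_degenerate x
    (le_antisymm ((hT (by omega)).trans h.le) (hT (by omega)))

theorem pspline_degenerate_right (hT : Monotone T) {d : ℕ} {j : ℤ} (x : ℝ)
    (h : T (j + d + 2) = T j) : pspline T d (j + 1) x = 0 :=
  pspline_eq_zero_of_degenerate x
    (le_antisymm ((hT (by omega)).trans (h.le.trans (hT (by omega)))) (hT (by omega)))

theorem pspline_degenerate_succ {d : ℕ} {j : ℤ} (x : ℝ)
    (h : T (j + d + 2) = T j) : pspline T (d + 1) j x = 0 := by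
  apply pspline_eq_zero_of_degenerate
  push_cast
  rw [← h]; congr 1; ring

/-- Eliminates one of the two splines of lower degree between the derivative formula and the
recursion. This identity and its mirror image drive the induction for the derivative and later give
one-sided bounds. -/
theorem sub_left_mul_psplineDeriv (hT : Monotone T) (d : ℕ) (j : ℤ) (x : ℝ) :
    (x - T j) * psplineDeriv T (d + 1) j x =
      (d + 1) * (pspline T (d + 1) j x - pspline T d (j + 1) x) := by
  by_cases hS : T (j + d + 2) = T j
  · simp [psplineDeriv, hS, pspline_degenerate_succ x hS, pspline_degenerate_right hT x hS]
  · have h := pspline_succ hT d j x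
    have hS' := sub_ne_zero.2 hS
    rw [psplineDeriv]
    field_simp
    linear_combination -h

theorem sub_right_mul_psplineDeriv (hT : Monotone T) (d : ℕ) (j : ℤ) (x : ℝ) :
    (T (j + d + 2) - x) * psplineDeriv T (d + 1) j x =
      (d + 1) * (pspline T d j x - pspline T (d + 1) j x) := by
  by_cases hS : T (j + d + 2) = T j
  · simp [psplineDeriv, hS, pspline_degenerate_succ x hS, pspline_degenerate_left hT x hS]
  · have h := pspline_succ hT d j x
    have hS' := sub_ne_zero.2 hS
    rw [psplineDeriv]
    field_simp
    linear_combination h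

theorem bspline_zero_eventuallyEq {j : ℤ} {x : ℝ} (hx : x ∉ range T) :
    ∀ᶠ y in nhds x, bspline T 0 j y = bspline T 0 j x := by
  have h1 : x ≠ T j := fun h => hx ⟨j, h.symm⟩
  have h2 : x ≠ T (j + 1) := fun h => hx ⟨j + 1, h.symm⟩
  have key : ∀ y, y ≠ T j → y ≠ T (j + 1) → (bspline T 0 j y = if T j < y ∧ y < T (j + 1) then 1 else 0) := by
    intro y h1 h2
    rw [bspline]
    congr 1
    simp only [h2, false_and, and_false, or_false, le_iff_lt_or_eq, Ne.symm h1]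
  rcases lt_or_gt_of_ne h1 with h1' | h1' <;> rcases lt_or_gt_of_ne h2 with h2' | h2'
  · filter_upwards [eventually_lt_nhds h1', eventually_lt_nhds h2'] with y hy1 hy2
    rw [key y hy1.ne hy2.ne, key x h1 h2]
    simp [not_lt.2 hy1.le, not_lt.2 h1'.le]
  · filter_upwards [eventually_lt_nhds h1', eventually_gt_nhds h2'] with y hy1 hy2
    rw [key y hy1.ne hy2.ne', key x h1 h2]
    simp [not_lt.2 hy1.le, not_lt.2 h1'.le]
  · filter_upwards [eventually_gt_nhds h1', eventually_lt_nhds h2'] with y hy1 hy2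
    rw [key y hy1.ne' hy2.ne, key x h1 h2]
    simp [hy1, hy2, h1', h2']
  · filter_upwards [eventually_gt_nhds h1', eventually_gt_nhds h2'] with y hy1 hy2
    rw [key y hy1.ne' hy2.ne', key x h1 h2]
    simp [not_lt.2 hy2.le, not_lt.2 h2'.le]

theorem hasDerivAt_pspline (hT : Monotone T) (d : ℕ) (j : ℤ) {x : ℝ} (hx : x ∉ range T) :
    HasDerivAt (pspline T d j) (psplineDeriv T d j x) x := by
  induction d generalizing j with
  | zero =>
    apply (hasDerivAt_const x (pspline T 0 j x)).congr_of_eventuallyEq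
    filter_upwards [bspline_zero_eventuallyEq (j := j) hx] with y hy
    simp [pspline, hy]
  | succ d ih =>
    by_cases hS : T (j + d + 2) = T j
    · have h0 : pspline T (d + 1) j = fun _ => 0 := by
        ext y; exact pspline_degenerate_succ y hS
      rw [h0, psplineDeriv, hS]
      simpa using hasDerivAt_const x (0 : ℝ)
    · have hS' := sub_ne_zero.2 hS
      have h0 : pspline T (d + 1) j = fun y =>
          ((y - T j) * pspline T d j y + (T (j + d + 2) - y) * pspline T d (j + 1) y) /
            (T (j + d + 2) - T j) := by
        ext y
        rw [← pspline_succ hT]; field_simp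
      rw [h0]
      have h1 := ((((hasDerivAt_id x).sub_const (T j)).mul (ih j)).add
        (((hasDerivAt_id x).const_sub (T (j + d + 2))).mul (ih (j + 1)))).div_const
          (T (j + d + 2) - T j)
      refine h1.congr_deriv ?_
      rw [psplineDeriv]
      congr 1
      simp only [id]
      cases d with
      | zero => simp [psplineDeriv]; ring
      | succ d =>
        -- The product rule yields the difference of the two splines plus these two terms. In their
        -- sum `pspline T d (j + 1) x` cancels and `d + 1` further copies of that difference remain.
        have e1 := sub_left_mul_psplineDeriv hT d j x
        have e2 := sub_right_mul_psplineDeriv hT d (j + 1) x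
        rw [show j + 1 + (d : ℤ) + 2 = j + ((d + 1 : ℕ) : ℤ) + 2 by push_cast; ring] at e2
        push_cast at e1 e2 ⊢
        linear_combination e1 + e2

end Basic

/-! ### Splines as B-spline sums: the coefficients of `1`, `x` and `x ^ 2` -/

/-- The sum of the `d` knots `T i, T (i - 1), …, T (i - d + 1)`. -/
noncomputable def knotSum (T : ℤ → ℝ) (d : ℕ) (i : ℤ) : ℝ := ∑ k ∈ Finset.range d, T (i - k)

/-- The sum of the squares of the `d` knots `T i, T (i - 1), …, T (i - d + 1)`. -/
noncomputable def knotSqSum (T : ℤ → ℝ) (d : ℕ) (i : ℤ) : ℝ :=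
  ∑ k ∈ Finset.range d, T (i - k) ^ 2

theorem knotSum_succ (T : ℤ → ℝ) (d : ℕ) (i : ℤ) :
    knotSum T (d + 1) i = knotSum T d i + T (i - d) := by
  simp [knotSum, Finset.sum_range_succ]

theorem knotSum_succ_add_one (T : ℤ → ℝ) (d : ℕ) (i : ℤ) :
    knotSum T (d + 1) (i + 1) = knotSum T d i + T (i + 1) := by
  simp [knotSum, Finset.sum_range_succ']

theorem knotSqSum_succ (T : ℤ → ℝ) (d : ℕ) (i : ℤ) :
    knotSqSum T (d + 1) i = knotSqSum T d i + T (i - d) ^ 2 := by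
  simp [knotSqSum, Finset.sum_range_succ]

theorem knotSqSum_succ_add_one (T : ℤ → ℝ) (d : ℕ) (i : ℤ) :
    knotSqSum T (d + 1) (i + 1) = knotSqSum T d i + T (i + 1) ^ 2 := by
  simp [knotSqSum, Finset.sum_range_succ']

theorem psplineDeriv_succ_mul (T : ℤ → ℝ) (hT : Monotone T) (d : ℕ) (j : ℤ) (x : ℝ) :
    (T (j + d + 2) - T j) * psplineDeriv T (d + 1) j x =
      (d + 1) * (pspline T d j x - pspline T d (j + 1) x) := by
  by_cases hS : T (j + d + 2) = T j
  · simp [hS, pspline_degenerate_left hT x hS, pspline_degenerate_right hT x hS]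
  · have hS' := sub_ne_zero.2 hS
    rw [psplineDeriv]
    field_simp

theorem hasDerivAt_bspline_succ {T : ℤ → ℝ} (hT : Monotone T) (d : ℕ) (j : ℤ) {x : ℝ}
    (hx : x ∉ range T) :
    HasDerivAt (bspline T (d + 1) j)
      ((d + 1) * (pspline T d j x - pspline T d (j + 1) x)) x := by
  rw [← psplineDeriv_succ_mul T hT]
  have h0 : bspline T (d + 1) j = fun y => (T (j + d + 2) - T j) * pspline T (d + 1) j y := by
    ext y
    rw [bspline_eq_mul_pspline hT]
    push_cast
    rw [show j + ((d : ℤ) + 1) + 1 = j + d + 2 by ring]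
  rw [h0]
  exact (hasDerivAt_pspline hT (d + 1) j hx).const_mul _

theorem Finset.sum_Ico_sub_succ (f : ℕ → ℝ) {a b : ℕ} (hab : a ≤ b) :
    ∑ k ∈ Finset.Ico a b, (f k - f (k + 1)) = f a - f b := by
  induction b, hab using Nat.le_induction with
  | base => simp
  | succ b hb ih => rw [Finset.sum_Ico_succ_top hb, ih]; ring

namespace IsKnotSeq

variable {T : ℤ → ℝ} {n : ℕ}

theorem pspline_left_eq_zero (h : IsKnotSeq T n) (d : ℕ) {j : ℤ} (hj : j + d + 1 ≤ 0) (x : ℝ) :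
    pspline T d j x = 0 :=
  pspline_eq_zero_of_degenerate x (by rw [h.left _ hj, h.left j (by omega)])

theorem pspline_right_eq_zero (h : IsKnotSeq T n) (d : ℕ) {j : ℤ} (hj : (n : ℤ) ≤ j) (x : ℝ) :
    pspline T d j x = 0 :=
  pspline_eq_zero_of_degenerate x (by rw [h.right _ hj, h.right (j + d + 1) (by omega)])

theorem length_pos (h : IsKnotSeq T n) {d i : ℕ} (hi : i < n + d) :
    T ((i : ℤ) - d) < T (i + 1) :=
  h.lt (by omega) (by omega) (by omega)

theorem bspline_eq (h : IsKnotSeq T n) (d i : ℕ) (x : ℝ) :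
    bspline T d ((i : ℤ) - d) x = (T (i + 1) - T ((i : ℤ) - d)) * pspline T d ((i : ℤ) - d) x := by
  rw [bspline_eq_mul_pspline h.mono]
  congr 3; ring

/-- A spline of degree `d + 1` in terms of the B-splines of degree `d`. -/
theorem sum_bspline_succ (h : IsKnotSeq T n) (d : ℕ) (c : ℕ → ℝ) (x : ℝ) :
    ∑ i ∈ Finset.range (n + (d + 1)), c i * bspline T (d + 1) ((i : ℤ) - (d + 1 : ℕ)) x =
      ∑ i ∈ Finset.range (n + d),
        (c (i + 1) * (x - T ((i : ℤ) - d)) + c i * (T (i + 1) - x)) *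
          pspline T d ((i : ℤ) - d) x := by
  have e : ∀ i : ℕ, c i * bspline T (d + 1) ((i : ℤ) - (d + 1 : ℕ)) x =
      c i * (x - T ((i : ℤ) - d - 1)) * pspline T d ((i : ℤ) - d - 1) x +
      c i * (T (i + 1) - x) * pspline T d ((i : ℤ) - d) x := by
    intro i
    rw [bspline_succ]
    push_cast
    rw [show (i : ℤ) - (d + 1) + d + 2 = i + 1 by ring,
      show (i : ℤ) - (d + 1) + 1 = i - d by ring, show (i : ℤ) - (d + 1) = i - d - 1 by ring]
    ring
  rw [Finset.sum_congr rfl (fun i _ => e i), Finset.sum_add_distrib,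
    show n + (d + 1) = n + d + 1 by ring, Finset.sum_range_succ', Finset.sum_range_succ]
  -- After the index shift one spline is left over at each end; all its knots coincide with an end
  -- point, so it is zero.
  rw [h.pspline_left_eq_zero d (j := ((0 : ℕ) : ℤ) - d - 1) (by push_cast; omega),
    h.pspline_right_eq_zero d (j := ((n + d : ℕ) : ℤ) - d) (by push_cast; omega)]
  rw [mul_zero, mul_zero, add_zero, add_zero, ← Finset.sum_add_distrib]
  apply Finset.sum_congr rfl
  intro i _
  push_cast
  rw [show (i : ℤ) + 1 - d - 1 = i - d by ring]
  ring

theorem bspline_zero_sum (h : IsKnotSeq T n) {x : ℝ} (hx : x ∈ Icc (T 0) (T n)) :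
    ∑ i ∈ Finset.range n, bspline T 0 i x = 1 := by
  have key : ∃ i < n, bspline T 0 (i : ℤ) x = 1 ∧ ∀ k < n, k ≠ i → bspline T 0 (k : ℤ) x = 0 := by
    rcases lt_or_eq_of_le hx.2 with h1 | h1
    · obtain ⟨i, hi, hi'⟩ : ∃ i < n, T i ≤ x ∧ x < T ((i : ℕ) + 1 : ℤ) := by
        have hex : ∃ k : ℕ, x < T k := ⟨n, h1⟩
        classical
        have hs := Nat.find_spec hex
        have hm := fun k => Nat.find_min (H := hex) (m := k)
        set k := Nat.find hex
        have hk0 : k ≠ 0 := by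
          intro h0
          rw [h0] at hs
          exact absurd hx.1 (not_le.2 hs)
        have hkn : k ≤ n := Nat.find_min' hex h1
        refine ⟨k - 1, by omega, not_lt.1 (hm (k - 1) (by omega)), ?_⟩
        convert hs using 2
        omega
      refine ⟨i, hi, ?_, ?_⟩
      · rw [bspline, if_pos (Or.inl hi')]
      · intro k _ hki
        rw [bspline, if_neg]
        rintro (⟨h2, h3⟩ | ⟨-, -, h3⟩)
        · rcases lt_or_gt_of_ne hki with h4 | h4
          · exact absurd (hi'.1.trans_lt h3) (not_lt.2 (h.mono (by omega)))
          · exact absurd (h2.trans_lt hi'.2) (not_lt.2 (h.mono (by omega)))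
        · exact absurd h1 (not_lt.2 (h3 n))
    · have := h.one_le
      refine ⟨n - 1, by omega, ?_, ?_⟩
      · rw [bspline, if_pos]
        right
        rw [show ((n - 1 : ℕ) : ℤ) + 1 = n by omega, h1]
        exact ⟨h.lt (by omega) (by omega) (by omega), rfl, h.le_last⟩
      · intro k hk hkn
        have hlt : T ((k : ℤ) + 1) < x := by
          rw [h1]; exact h.lt (by omega) (by omega) (by omega)
        exact bspline_zero_of_not (fun h2 => absurd h2.2 (not_le.2 hlt))
  obtain ⟨i, hi, h1, h2⟩ := key
  rw [Finset.sum_eq_single i, h1]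
  · intro k hk hki; exact h2 k (Finset.mem_range.1 hk) hki
  · intro hi'; exact absurd (Finset.mem_range.2 hi) hi'

/-- The B-splines form a partition of unity. -/
theorem sum_bspline (h : IsKnotSeq T n) (d : ℕ) {x : ℝ} (hx : x ∈ Icc (T 0) (T n)) :
    ∑ i ∈ Finset.range (n + d), bspline T d ((i : ℤ) - d) x = 1 := by
  induction d with
  | zero => simpa using h.bspline_zero_sum hx
  | succ d ih =>
    have := h.sum_bspline_succ d (fun _ => 1) x
    simp only [one_mul] at this
    rw [this, ← ih]
    apply Finset.sum_congr rfl
    intro i _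
    rw [h.bspline_eq]
    ring

/-- Greville's formula for the B-spline coefficients of the identity. -/
theorem sum_knotSum_mul_bspline (h : IsKnotSeq T n) (d : ℕ) {x : ℝ} (hx : x ∈ Icc (T 0) (T n)) :
    ∑ i ∈ Finset.range (n + d), knotSum T d i * bspline T d ((i : ℤ) - d) x = d * x := by
  induction d with
  | zero => simp [knotSum]
  | succ d ih =>
    rw [h.sum_bspline_succ d (fun i => knotSum T (d + 1) i) x]
    trans ∑ i ∈ Finset.range (n + d), (knotSum T d i * bspline T d ((i : ℤ) - d) x +
      x * bspline T d ((i : ℤ) - d) x)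
    · apply Finset.sum_congr rfl
      intro i _
      rw [h.bspline_eq]
      push_cast
      -- With `S` the sum of the `d` common knots, the two coefficients are `S + T (i + 1)` and `S +
      -- T (i - d)`, and the combination collapses to `(S + x) * (T (i + 1) - T (i - d))`.
      rw [knotSum_succ_add_one, knotSum_succ]
      ring
    · rw [Finset.sum_add_distrib, ← Finset.mul_sum, ih, h.sum_bspline d hx]
      push_cast; ring

/-- The B-spline coefficients of the square. -/
theorem sum_knotSqSum_mul_bspline (h : IsKnotSeq T n) (d : ℕ) {x : ℝ}
    (hx : x ∈ Icc (T 0) (T n)) :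
    ∑ i ∈ Finset.range (n + d), (knotSum T d i ^ 2 - knotSqSum T d i) *
      bspline T d ((i : ℤ) - d) x = d * (d - 1) * x ^ 2 := by
  induction d with
  | zero => simp [knotSum, knotSqSum]
  | succ d ih =>
    rw [h.sum_bspline_succ d (fun i => knotSum T (d + 1) i ^ 2 - knotSqSum T (d + 1) i) x]
    trans ∑ i ∈ Finset.range (n + d), ((knotSum T d i ^ 2 - knotSqSum T d i) *
      bspline T d ((i : ℤ) - d) x + (2 * x) * (knotSum T d i * bspline T d ((i : ℤ) - d) x))
    · apply Finset.sum_congr rfl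
      intro i _
      rw [h.bspline_eq]
      push_cast
      -- The coefficient is twice the second elementary symmetric function of the knots. A new knot
      -- `τ` adds `2 S τ` to it, and the combination turns this into `2 S x`.
      rw [knotSum_succ_add_one, knotSum_succ, knotSqSum_succ_add_one, knotSqSum_succ]
      ring
    · rw [Finset.sum_add_distrib, ← Finset.mul_sum, ih, h.sum_knotSum_mul_bspline d hx]
      push_cast; ring

theorem bspline_le_one (h : IsKnotSeq T n) (d : ℕ) (j : ℤ) {x : ℝ} (hx : x ∈ Icc (T 0) (T n)) :
    bspline T d j x ≤ 1 := by
  by_cases hj : -(d : ℤ) ≤ j ∧ j < n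
  · obtain ⟨i, hi⟩ : ∃ i : ℕ, j = (i : ℤ) - d := ⟨(j + d).toNat, by omega⟩
    rw [← h.sum_bspline d hx, hi]
    exact Finset.single_le_sum (f := fun i : ℕ => bspline T d ((i : ℤ) - d) x)
      (fun i _ => bspline_nonneg h.mono d _ x) (Finset.mem_range.2 (by omega))
  · rw [bspline_eq_mul_pspline h.mono]
    rcases not_and_or.1 hj with h1 | h1
    · rw [h.pspline_left_eq_zero d (by omega)]; simp
    · rw [h.pspline_right_eq_zero d (by omega)]; simp

/-! ### End values and continuity -/

/-- Supplies, with its counterpart on the right, the boundary terms in integrations by parts and the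
vanishing of derivatives at the ends. -/
theorem bspline_left_end (h : IsKnotSeq T n) (d : ℕ) (j : ℤ) :
    bspline T d j (T 0) = if j = -(d : ℤ) then 1 else 0 := by
  induction d generalizing j with
  | zero =>
    rw [bspline]
    have := h.one_le
    congr 1
    simp only [Nat.cast_zero, neg_zero, eq_iff_iff]
    constructor
    · rintro (⟨h1, h2⟩ | ⟨h1, -⟩)
      · by_contra h3
        rcases lt_or_gt_of_ne h3 with h4 | h4
        · rw [h.left (j + 1) (by omega)] at h2; exact lt_irrefl _ h2
        · exact absurd h1 (not_le.2 (h.lt (by omega) h4 h4))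
      · exact absurd h1 (not_lt.2 (h.zero_le j))
    · rintro rfl
      exact Or.inl ⟨le_rfl, h.lt (by omega) (by omega) (by omega)⟩
  | succ d ih =>
    have h1 : (T 0 - T j) * pspline T d j (T 0) = 0 := by
      by_cases hj : j = -(d : ℤ)
      · rw [h.left j (by omega)]; simp
      · simp [pspline, ih, hj]
    rw [bspline_succ, h1, zero_add, pspline, ih]
    have := h.one_le
    by_cases hj : j = -(d : ℤ) - 1
    · have h2 : T 0 < T 1 := h.lt (by omega) (by omega) (by omega)
      subst hj
      rw [if_pos (by ring), if_pos (by push_cast; ring),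
        show -(d : ℤ) - 1 + d + 2 = 1 by ring, show -(d : ℤ) - 1 + 1 + d + 1 = 1 by ring,
        h.left (-(d : ℤ) - 1 + 1) (by omega)]
      field_simp [sub_ne_zero.2 h2.ne']
    · rw [if_neg (by omega), if_neg (by push_cast; omega)]
      simp

theorem bspline_right_end (h : IsKnotSeq T n) (d : ℕ) (j : ℤ) :
    bspline T d j (T n) = if j = (n : ℤ) - 1 then 1 else 0 := by
  induction d generalizing j with
  | zero =>
    rw [bspline]
    have := h.one_le
    congr 1
    simp only [eq_iff_iff]
    constructor
    · rintro (⟨h1, h2⟩ | ⟨h1, h2, -⟩)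
      · exact absurd h2 (not_lt.2 (h.le_last _))
      · by_contra h3
        rcases lt_or_gt_of_ne h3 with h4 | h4
        · exact absurd h2 (h.lt (j := j + 1) (by omega) (by omega) (by omega)).ne'
        · rw [h.right j (by omega)] at h1; exact lt_irrefl _ h1
    · rintro rfl
      refine Or.inr ⟨h.lt (by omega) (by omega) (by omega), by congr 1; ring, h.le_last⟩
  | succ d ih =>
    have h1 : (T (j + d + 2) - T n) * pspline T d (j + 1) (T n) = 0 := by
      by_cases hj : j + 1 = (n : ℤ) - 1
      · rw [h.right (j + d + 2) (by omega)]; simp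
      · simp [pspline, ih, hj]
    rw [bspline_succ, h1, add_zero, pspline, ih]
    have := h.one_le
    by_cases hj : j = (n : ℤ) - 1
    · have h2 : T ((n : ℤ) - 1) < T n := h.lt (by omega) (by omega) (by omega)
      subst hj
      rw [if_pos rfl, h.right ((n : ℤ) - 1 + d + 1) (by omega)]
      field_simp [sub_ne_zero.2 h2.ne']
    · rw [if_neg hj]
      simp

/-- The cases are a hat, two half hats and zero. Half hats sit at the ends of the interval and jump
there, so continuity is claimed only on the closed interval. -/
theorem continuousOn_bspline_one (h : IsKnotSeq T n) (j : ℤ) :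
    ContinuousOn (bspline T 1 j) (Icc (T 0) (T n)) := by
  have hu : T j ≤ T (j + 1) := h.mono (by omega)
  have hv : T (j + 1) ≤ T (j + 2) := h.mono (by omega)
  have e : ∀ x, bspline T 1 j x = (x - T j) / (T (j + 1) - T j) * bspline T 0 j x +
      (T (j + 2) - x) / (T (j + 2) - T (j + 1)) * bspline T 0 (j + 1) x := by
    intro x
    rw [show (1 : ℕ) = 0 + 1 from rfl, bspline_succ]
    simp only [pspline, Nat.cast_zero, add_zero, show j + 1 + 1 = j + 2 by ring]
    ring
  rcases hu.lt_or_eq with hu | hu <;> rcases hv.lt_or_eq with hv | hv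
  · have hu' := sub_pos.2 hu
    have hv' := sub_pos.2 hv
    have : EqOn (bspline T 1 j) (fun x => max 0 (min ((x - T j) / (T (j + 1) - T j))
        ((T (j + 2) - x) / (T (j + 2) - T (j + 1))))) (Icc (T 0) (T n)) := by
      intro x hx
      simp only [e]
      rw [bspline, bspline, show j + 1 + 1 = j + 2 by ring]
      rcases lt_or_ge x (T j) with h1 | h1
      · rw [if_neg, if_neg, max_eq_left]
        · simp
        · exact (min_le_left _ _).trans (div_nonpos_of_nonpos_of_nonneg (by linarith) hu'.le)
        · rintro (⟨h2, -⟩ | ⟨h2, -⟩) <;> linarith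
        · rintro (⟨h2, -⟩ | ⟨h2, -⟩) <;> linarith
      rcases lt_or_ge x (T (j + 1)) with h2 | h2
      · rw [if_pos (Or.inl ⟨h1, h2⟩), if_neg, min_eq_left, max_eq_right]
        · simp
        · exact div_nonneg (by linarith) hu'.le
        · rw [div_le_div_iff₀ hu' hv']; nlinarith
        · rintro (⟨h2, -⟩ | ⟨h2, -⟩) <;> linarith
      rcases lt_or_ge x (T (j + 2)) with h3 | h3
      · rw [if_neg, if_pos (Or.inl ⟨h2, h3⟩), min_eq_right, max_eq_right]
        · simp
        · exact div_nonneg (by linarith) hv'.le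
        · rw [div_le_div_iff₀ hv' hu']; nlinarith
        · rintro (⟨-, h4⟩ | ⟨-, h4, h5⟩)
          · linarith
          · exact absurd (h5 (j + 2)) (not_le.2 h3)
      · rw [max_eq_left, if_neg]
        · rw [mul_zero, zero_add]
          split_ifs with h4
          · rcases h4 with ⟨-, h5⟩ | ⟨-, h5, -⟩
            · linarith
            · rw [h5]; simp
          · simp
        · rintro (⟨-, h4⟩ | ⟨-, h4, h5⟩) <;> linarith
        · exact (min_le_right _ _).trans (div_nonpos_of_nonpos_of_nonneg (by linarith) hv'.le)
    refine ContinuousOn.congr ?_ this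
    fun_prop
  -- A repeated knot is an end point, and `T j < T (j + 1)` excludes the left one.
  · have hn : T (j + 1) = T n := by
      rcases lt_or_ge (j + 1) (n : ℤ) with h1 | h1
      · exfalso
        by_cases h2 : 0 < j + 2
        · exact absurd hv (h.lt h1 h2 (by omega)).ne
        · rw [h.left j (by omega), h.left (j + 1) (by omega)] at hu
          exact lt_irrefl _ hu
      · exact h.right _ h1
    have hu' := sub_pos.2 hu
    have : EqOn (bspline T 1 j) (fun x => max 0 ((x - T j) / (T (j + 1) - T j)))
        (Icc (T 0) (T n)) := by
      intro x hx
      simp only [e]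
      rw [hv, sub_self, div_zero, zero_mul, add_zero, bspline, ← hv]
      rcases lt_or_ge x (T j) with h1 | h1
      · rw [if_neg, max_eq_left]
        · simp
        · exact div_nonpos_of_nonpos_of_nonneg (by linarith) hu'.le
        · rintro (⟨h2, -⟩ | ⟨h2, -⟩) <;> linarith
      · rw [if_pos, max_eq_right]
        · simp
        · exact div_nonneg (by linarith) hu'.le
        · rcases hx.2.lt_or_eq with h2 | h2
          · exact Or.inl ⟨h1, by rwa [hn]⟩
          · exact Or.inr ⟨by rw [h2, ← hn]; exact hu, by rw [h2, hn], fun k => by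
              rw [h2]; exact h.le_last k⟩
    refine ContinuousOn.congr ?_ this
    fun_prop
  · have hn : T (j + 1) = T 0 := by
      rcases lt_or_ge 0 (j + 1) with h1 | h1
      · exfalso
        by_cases h2 : j < n
        · exact absurd hu (h.lt h2 h1 (by omega)).ne
        · rw [h.right (j + 1) (by omega), h.right (j + 2) (by omega)] at hv
          exact lt_irrefl _ hv
      · exact h.left _ h1
    have hv' := sub_pos.2 hv
    have : EqOn (bspline T 1 j) (fun x => max 0 ((T (j + 2) - x) / (T (j + 2) - T (j + 1))))
        (Icc (T 0) (T n)) := by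
      intro x hx
      simp only [e]
      rw [← hu, sub_self, div_zero, zero_mul, zero_add, bspline, show j + 1 + 1 = j + 2 by ring, hu]
      have hx1 : T (j + 1) ≤ x := by rw [hn]; exact hx.1
      rcases lt_or_ge x (T (j + 2)) with h1 | h1
      · rw [if_pos (Or.inl ⟨hx1, h1⟩), max_eq_right]
        · simp
        · exact div_nonneg (by linarith) hv'.le
      · rw [max_eq_left]
        · split_ifs with h4
          · rcases h4 with ⟨-, h5⟩ | ⟨-, h5, -⟩
            · linarith
            · rw [h5]; simp
          · simp
        · exact div_nonpos_of_nonpos_of_nonneg (by linarith) hv'.le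
    refine ContinuousOn.congr ?_ this
    fun_prop
  · have : bspline T 1 j = fun _ => 0 := by
      ext x; rw [e, hu, hv]; simp
    rw [this]
    exact continuousOn_const

theorem continuousOn_bspline (h : IsKnotSeq T n) (d : ℕ) (j : ℤ) :
    ContinuousOn (bspline T (d + 1) j) (Icc (T 0) (T n)) := by
  induction d generalizing j with
  | zero => exact h.continuousOn_bspline_one j
  | succ d ih =>
    have e : bspline T (d + 1 + 1) j = fun x => (x - T j) * (bspline T (d + 1) j x /
        (T (j + (d + 1 : ℕ) + 1) - T j)) + (T (j + (d + 1 : ℕ) + 2) - x) *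
        (bspline T (d + 1) (j + 1) x / (T (j + 1 + (d + 1 : ℕ) + 1) - T (j + 1))) := by
      ext x; rw [bspline_succ]; rfl
    rw [e]
    have h1 := (ih j).div_const (T (j + (d + 1 : ℕ) + 1) - T j)
    have h2 := (ih (j + 1)).div_const (T (j + 1 + (d + 1 : ℕ) + 1) - T (j + 1))
    exact ((by fun_prop : ContinuousOn (fun x => x - T j) _).mul h1).add
      ((by fun_prop : ContinuousOn (fun x => T (j + (d + 1 : ℕ) + 2) - x) _).mul h2)

theorem continuousOn_pspline (h : IsKnotSeq T n) (d : ℕ) (j : ℤ) :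
    ContinuousOn (pspline T (d + 1) j) (Icc (T 0) (T n)) :=
  (h.continuousOn_bspline d j).div_const _

end IsKnotSeq

/-! ### Integrability and moments of B-splines -/

open MeasureTheory in
theorem measurable_bspline (T : ℤ → ℝ) (d : ℕ) (j : ℤ) : Measurable (bspline T d j) := by
  induction d generalizing j with
  | zero =>
    have e : bspline T 0 j = Set.indicator
        ((Ici (T j) ∩ Iio (T (j + 1))) ∪ (Ioi (T j) ∩ ({T (j + 1)} ∩ ⋂ k, Ici (T k))))
        (fun _ => 1) := by
      ext x
      classical
      rw [bspline, Set.indicator_apply]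
      congr 1
      simp
    rw [e]
    refine Measurable.indicator measurable_const ?_
    refine (measurableSet_Ici.inter measurableSet_Iio).union (measurableSet_Ioi.inter
      ((measurableSet_singleton _).inter (MeasurableSet.iInter fun k => measurableSet_Ici)))
  | succ d ih =>
    have h1 := ih j
    have h2 := ih (j + 1)
    have e : bspline T (d + 1) j = fun x =>
        (x - T j) / (T (j + d + 1) - T j) * bspline T d j x +
          (T (j + d + 2) - x) / (T (j + d + 2) - T (j + 1)) * bspline T d (j + 1) x := by
      ext x; rw [bspline]
    rw [e]
    fun_prop

namespace IsKnotSeq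

open MeasureTheory

variable {T : ℤ → ℝ} {n : ℕ}

theorem integrableOn_bspline (h : IsKnotSeq T n) (d : ℕ) (j : ℤ) :
    IntegrableOn (bspline T d j) (Icc (T 0) (T n)) := by
  apply Measure.integrableOn_of_bounded (M := 1)
  · simp
  · exact (measurable_bspline T d j).aestronglyMeasurable
  · filter_upwards [ae_restrict_mem measurableSet_Icc] with x hx
    rw [Real.norm_of_nonneg (bspline_nonneg h.mono d j x)]
    exact h.bspline_le_one d j hx

theorem integrableOn_pspline (h : IsKnotSeq T n) (d : ℕ) (j : ℤ) :
    IntegrableOn (pspline T d j) (Icc (T 0) (T n)) :=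
  (h.integrableOn_bspline d j).div_const _

theorem intervalIntegrable_of_integrableOn {f : ℝ → ℝ} {a b u v : ℝ}
    (hf : IntegrableOn f (Icc a b)) (hu : u ∈ Icc a b) (hv : v ∈ Icc a b) :
    IntervalIntegrable f volume u v := by
  rw [intervalIntegrable_iff]
  apply hf.mono_set
  exact uIoc_subset_uIcc.trans (uIcc_subset_Icc hu hv)

theorem left_mem (h : IsKnotSeq T n) : T 0 ∈ Icc (T 0) (T n) :=
  left_mem_Icc.2 h.zero_lt_last.le

theorem right_mem (h : IsKnotSeq T n) : T n ∈ Icc (T 0) (T n) :=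
  right_mem_Icc.2 h.zero_lt_last.le

/-- The integral of `f` against the B-spline with the knots `T (i - d), …, T (i + 1)`, scaled to
have integral `1`. -/
noncomputable def _root_.splineMoment (T : ℤ → ℝ) (n d i : ℕ) (f : ℝ → ℝ) : ℝ :=
  (d + 1) * ∫ x in (T 0)..(T n), pspline T d ((i : ℤ) - d) x * f x

/-- Integration by parts. The sum `C` of all B-splines of degree `d + 1` with index above `i` has
derivative `(d + 1) * pspline T d (i - d)`, by telescoping, and rises from `0` to `1`. The degree
goes up and `g` is replaced by `g'`, so polynomial moments are found recursively. -/
theorem splineMoment_eq (h : IsKnotSeq T n) {d i : ℕ} (hi : i < n + d) {g g' : ℝ → ℝ}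
    (hg : ∀ x, HasDerivAt g (g' x) x) (hg' : Continuous g') :
    splineMoment T n d i g = g (T n) - ∑ k ∈ Finset.Ico (i + 1) (n + d + 1),
      (T (k + 1) - T ((k : ℤ) - (d + 1 : ℕ))) / (d + 2) * splineMoment T n (d + 1) k g' := by
  set C : ℝ → ℝ := fun x => ∑ k ∈ Finset.Ico (i + 1) (n + d + 1),
    bspline T (d + 1) ((k : ℤ) - (d + 1 : ℕ)) x with hC
  have hgc : Continuous g := continuous_iff_continuousAt.2 fun x => (hg x).continuousAt
  have hCc : ContinuousOn C (Icc (T 0) (T n)) :=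
    continuousOn_finsetSum _ fun k _ => h.continuousOn_bspline d _
  have hCd : ∀ x, x ∉ range T → HasDerivAt C ((d + 1) * pspline T d ((i : ℤ) - d) x) x := by
    intro x hx
    have h1 := HasDerivAt.fun_sum (u := Finset.Ico (i + 1) (n + d + 1)) (fun (k : ℕ) _ =>
      hasDerivAt_bspline_succ h.mono d ((k : ℤ) - (d + 1 : ℕ)) hx)
    refine h1.congr_deriv ?_
    have h2 := Finset.sum_Ico_sub_succ
      (fun k : ℕ => ((d : ℝ) + 1) * pspline T d ((k : ℤ) - (d + 1 : ℕ)) x)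
      (show i + 1 ≤ n + d + 1 by omega)
    rw [h.pspline_right_eq_zero d (j := ((n + d + 1 : ℕ) : ℤ) - (d + 1 : ℕ)) (by push_cast; omega)]
      at h2
    rw [show ((i + 1 : ℕ) : ℤ) - (d + 1 : ℕ) = i - d by push_cast; ring] at h2
    rw [mul_zero, sub_zero] at h2
    rw [← h2]
    apply Finset.sum_congr rfl
    intro k _
    rw [show ((k + 1 : ℕ) : ℤ) - (d + 1 : ℕ) = (k : ℤ) - (d + 1 : ℕ) + 1 by push_cast; ring]
    ring
  have hC0 : C (T 0) = 0 := by
    rw [hC]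
    apply Finset.sum_eq_zero
    intro k hk
    rw [Finset.mem_Ico] at hk
    rw [h.bspline_left_end, if_neg (by push_cast; omega)]
  have hC1 : C (T n) = 1 := by
    rw [hC]
    simp only
    rw [Finset.sum_eq_single (n + d)]
    · rw [h.bspline_right_end, if_pos (by push_cast; omega)]
    · intro k hk hk'
      rw [h.bspline_right_end, if_neg (by push_cast; omega)]
    · intro h1
      exact absurd (Finset.mem_Ico.2 ⟨by omega, by omega⟩) h1
  have hle := h.zero_lt_last.le
  have hi1 : IntervalIntegrable (fun x => pspline T d ((i : ℤ) - d) x * g x) volume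
      (T 0) (T n) :=
    intervalIntegrable_of_integrableOn ((h.integrableOn_pspline d _).mul_continuousOn
      hgc.continuousOn isCompact_Icc) h.left_mem h.right_mem
  have hi2 : IntervalIntegrable (fun x => C x * g' x) volume (T 0) (T n) :=
    intervalIntegrable_of_integrableOn
      ((hCc.mul hg'.continuousOn).integrableOn_compact isCompact_Icc) h.left_mem h.right_mem
  -- The derivative of `C` is available only off the knots, a finite set.
  have hftc := integral_eq_of_hasDerivAt_off_countable_of_le (fun x => C x * g x)
    (fun x => (d + 1) * (pspline T d ((i : ℤ) - d) x * g x) + C x * g' x) hle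
    h.finite_range.countable (hCc.mul hgc.continuousOn)
    (fun x hx => ((hCd x hx.2).mul (hg x)).congr_deriv (by ring))
    ((hi1.const_mul _).add hi2)
  rw [intervalIntegral.integral_add (hi1.const_mul _) hi2,
    intervalIntegral.integral_const_mul, hC0, hC1, zero_mul, one_mul, sub_zero] at hftc
  have hsum : ∫ x in (T 0)..(T n), C x * g' x = ∑ k ∈ Finset.Ico (i + 1) (n + d + 1),
      (T (k + 1) - T ((k : ℤ) - (d + 1 : ℕ))) / (d + 2) * splineMoment T n (d + 1) k g' := by
    simp only [hC, Finset.sum_mul]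
    rw [intervalIntegral.integral_finsetSum]
    · apply Finset.sum_congr rfl
      intro k _
      simp only [h.bspline_eq, splineMoment, mul_assoc]
      rw [intervalIntegral.integral_const_mul]
      have : ((d + 1 : ℕ) : ℝ) + 1 ≠ 0 := by positivity
      push_cast
      field_simp
      ring
    · intro k _
      exact intervalIntegrable_of_integrableOn ((h.integrableOn_bspline _ _).mul_continuousOn
        hg'.continuousOn isCompact_Icc) h.left_mem h.right_mem
  rw [splineMoment, ← hsum]
  linarith

theorem splineMoment_one (h : IsKnotSeq T n) {d i : ℕ} (hi : i < n + d) :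
    splineMoment T n d i (fun _ => 1) = 1 := by
  rw [h.splineMoment_eq hi (g' := fun _ => 0) (fun x => hasDerivAt_const x 1) continuous_const]
  simp [splineMoment]

theorem splineMoment_const_mul (c : ℝ) (d i : ℕ) (f : ℝ → ℝ) :
    splineMoment T n d i (fun x => c * f x) = c * splineMoment T n d i f := by
  simp only [splineMoment]
  rw [mul_left_comm c, ← intervalIntegral.integral_const_mul c]
  congr 1
  apply intervalIntegral.integral_congr
  intro x _
  simp only
  ring

theorem knotSum_last (h : IsKnotSeq T n) (d : ℕ) {i : ℤ} (hi : (n : ℤ) + d ≤ i + 1) :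
    knotSum T d i = d * T n := by
  rw [knotSum, Finset.sum_congr rfl (g := fun _ => T n)]
  · simp
  · intro k hk
    have := Finset.mem_range.1 hk
    exact h.right _ (by omega)

theorem knotSqSum_last (h : IsKnotSeq T n) (d : ℕ) {i : ℤ} (hi : (n : ℤ) + d ≤ i + 1) :
    knotSqSum T d i = d * T n ^ 2 := by
  rw [knotSqSum, Finset.sum_congr rfl (g := fun _ => T n ^ 2)]
  · simp
  · intro k hk
    have := Finset.mem_range.1 hk
    rw [h.right _ (by omega)]

/-- The moments of the constant `1` left by `splineMoment_eq` all equal `1`. Their factors `T (k +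
1) - T (k - d - 1)` are differences of consecutive knot sums, so the sum telescopes to its end at `T
n`. -/
theorem splineMoment_id (h : IsKnotSeq T n) {d i : ℕ} (hi : i < n + d) :
    splineMoment T n d i (fun x => x) = knotSum T (d + 2) (i + 1) / (d + 2) := by
  rw [h.splineMoment_eq hi (g := fun x => x) (g' := fun _ => 1) (fun x => hasDerivAt_id' x) continuous_const]
  have h1 : ∀ k ∈ Finset.Ico (i + 1) (n + d + 1),
      (T (k + 1) - T ((k : ℤ) - (d + 1 : ℕ))) / (d + 2) * splineMoment T n (d + 1) k (fun _ => 1)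
      = -knotSum T (d + 2) (k : ℕ) / (d + 2) - -knotSum T (d + 2) (k + 1 : ℕ) / (d + 2) := by
    intro k hk
    rw [Finset.mem_Ico] at hk
    rw [h.splineMoment_one (by omega)]
    push_cast
    rw [knotSum_succ_add_one, knotSum_succ]
    push_cast
    ring
  rw [Finset.sum_congr rfl h1, Finset.sum_Ico_sub_succ (fun k : ℕ =>
    -knotSum T (d + 2) (k : ℕ) / (d + 2)) (by omega), h.knotSum_last (d + 2) (i := ((n + d + 1 : ℕ) : ℤ)) (by push_cast; omega)]
  push_cast
  field_simp
  ring

/-- Telescopes like the first moment: the length of a support times the sum of its `d + 3` knots is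
half the difference of consecutive values of `knotSum ^ 2 + knotSqSum`. -/
theorem splineMoment_sq (h : IsKnotSeq T n) {d i : ℕ} (hi : i < n + d) :
    splineMoment T n d i (fun x => x ^ 2) =
      (knotSum T (d + 2) (i + 1) ^ 2 + knotSqSum T (d + 2) (i + 1)) / ((d + 2) * (d + 3)) := by
  rw [h.splineMoment_eq hi (g' := fun x => 2 * x)
    (fun x => by simpa using hasDerivAt_pow 2 x) (by fun_prop)]
  have h1 : ∀ k ∈ Finset.Ico (i + 1) (n + d + 1),
      (T (k + 1) - T ((k : ℤ) - (d + 1 : ℕ))) / (d + 2) *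
        splineMoment T n (d + 1) k (fun x => 2 * x) =
      -(knotSum T (d + 2) (k : ℕ) ^ 2 + knotSqSum T (d + 2) (k : ℕ)) / ((d + 2) * (d + 3)) -
      -(knotSum T (d + 2) (k + 1 : ℕ) ^ 2 + knotSqSum T (d + 2) (k + 1 : ℕ)) /
        ((d + 2) * (d + 3)) := by
    intro k hk
    rw [Finset.mem_Ico] at hk
    rw [splineMoment_const_mul, h.splineMoment_id (by omega)]
    push_cast
    rw [knotSum_succ_add_one, knotSum_succ_add_one, knotSum_succ, knotSum_succ,
      knotSqSum_succ_add_one, knotSqSum_succ]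
    push_cast
    field_simp
    ring
  rw [Finset.sum_congr rfl h1, Finset.sum_Ico_sub_succ (fun k : ℕ =>
    -(knotSum T (d + 2) (k : ℕ) ^ 2 + knotSqSum T (d + 2) (k : ℕ)) / ((d + 2) * (d + 3)))
    (by omega), h.knotSum_last (d + 2) (i := ((n + d + 1 : ℕ) : ℤ)) (by push_cast; omega),
    h.knotSqSum_last (d + 2) (i := ((n + d + 1 : ℕ) : ℤ)) (by push_cast; omega)]
  push_cast
  field_simp
  ring

theorem abs_splineMoment_le (h : IsKnotSeq T n) {d i : ℕ} (hi : i < n + d) {f : ℝ → ℝ}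
    (hf : ContinuousOn f (Icc (T 0) (T n))) {c : ℝ} (hc : ∀ x ∈ Icc (T 0) (T n), |f x| ≤ c) :
    |splineMoment T n d i f| ≤ c := by
  have hle := h.zero_lt_last.le
  have h1 := h.splineMoment_one hi
  rw [splineMoment, abs_mul, abs_of_pos (by positivity : (0 : ℝ) < d + 1)]
  have h2 : |∫ x in (T 0)..(T n), pspline T d ((i : ℤ) - d) x * f x| ≤
      ∫ x in (T 0)..(T n), pspline T d ((i : ℤ) - d) x * c := by
    refine (intervalIntegral.abs_integral_le_integral_abs hle).trans ?_
    apply intervalIntegral.integral_mono_on hle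
    · exact (intervalIntegrable_of_integrableOn ((h.integrableOn_pspline d _).mul_continuousOn
        hf isCompact_Icc) h.left_mem h.right_mem).abs
    · exact (intervalIntegrable_of_integrableOn (h.integrableOn_pspline d _)
        h.left_mem h.right_mem).mul_const _
    · intro x hx
      rw [abs_mul, abs_of_nonneg (pspline_nonneg h.mono _ _ _)]
      exact mul_le_mul_of_nonneg_left (hc x hx) (pspline_nonneg h.mono _ _ _)
  simp only [splineMoment, mul_one] at h1
  rw [intervalIntegral.integral_mul_const] at h2
  calc _ ≤ ((d : ℝ) + 1) * ((∫ x in (T 0)..(T n), pspline T d ((i : ℤ) - d) x) * c) := by gcongr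
    _ = c := by rw [← mul_assoc, h1, one_mul]

theorem splineMoment_add (h : IsKnotSeq T n) (d i : ℕ) {f g : ℝ → ℝ}
    (hf : ContinuousOn f (Icc (T 0) (T n))) (hg : ContinuousOn g (Icc (T 0) (T n))) :
    splineMoment T n d i (fun x => f x + g x) =
      splineMoment T n d i f + splineMoment T n d i g := by
  simp only [splineMoment]
  rw [← mul_add, ← intervalIntegral.integral_add]
  · simp only [mul_add]
  · exact intervalIntegrable_of_integrableOn ((h.integrableOn_pspline d _).mul_continuousOn
      hf isCompact_Icc) h.left_mem h.right_mem
  · exact intervalIntegrable_of_integrableOn ((h.integrableOn_pspline d _).mul_continuousOn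
      hg isCompact_Icc) h.left_mem h.right_mem

/-! ### Linear independence -/

/-- The B-splines are linearly independent, even away from the knots. -/
theorem bspline_linearIndependent (h : IsKnotSeq T n) (d : ℕ) {c : ℕ → ℝ}
    (hc : ∀ x ∈ Ioo (T 0) (T n) \ range T,
      ∑ i ∈ Finset.range (n + d), c i * bspline T d ((i : ℤ) - d) x = 0) :
    ∀ i < n + d, c i = 0 := by
  have hopen : IsOpen (Ioo (T 0) (T n) \ range T) :=
    isOpen_Ioo.sdiff h.finite_range.isClosed
  have hne : ∀ i : ℕ, i < n → ∃ x ∈ Ioo (T i) (T ((i : ℕ) + 1 : ℤ)),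
      x ∈ Ioo (T 0) (T n) \ range T := by
    intro i hi
    have hlt := h.lt_succ i (by omega) (by omega)
    obtain ⟨x, hx, hx'⟩ := ((Ioo_infinite hlt).sdiff h.finite_range).nonempty
    exact ⟨x, hx, ⟨⟨(h.zero_le _).trans_lt hx.1, hx.2.trans_le (h.le_last _)⟩, hx'⟩⟩
  induction d generalizing c with
  | zero =>
    intro i hi
    obtain ⟨x, hx, hx'⟩ := hne i (by omega)
    have h1 := hc x hx'
    rw [Finset.sum_eq_single i] at h1
    · simp only [Nat.cast_zero, sub_zero] at h1
      rwa [bspline, if_pos (Or.inl ⟨hx.1.le, hx.2⟩), mul_one] at h1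
    · intro k hk hki
      simp only [Nat.cast_zero, sub_zero]
      rw [bspline_zero_of_not, mul_zero]
      rintro ⟨h2, h3⟩
      rcases lt_or_gt_of_ne hki with h4 | h4
      · exact absurd (h3.trans (h.mono (by omega : (k : ℤ) + 1 ≤ i))) (not_le.2 hx.1)
      · exact absurd ((h.mono (by omega : (i : ℤ) + 1 ≤ k)).trans h2) (not_le.2 hx.2)
    · intro h2
      exact absurd (Finset.mem_range.2 hi) h2
  | succ d ih =>
    -- Differentiating the relation off the knots gives one of degree `d` whose coefficients are
    -- proportional to `c (i + 1) - c i`. So `c` is constant by induction, and the partition of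
    -- unity makes the constant `0`.
    have key : ∀ i < n + d, (c (i + 1) - c i) / (T (i + 1) - T ((i : ℤ) - d)) = 0 := by
      apply ih
      intro x hx
      have h1 : HasDerivAt (fun y => ∑ i ∈ Finset.range (n + (d + 1)),
          c i * bspline T (d + 1) ((i : ℤ) - (d + 1 : ℕ)) y)
          (∑ i ∈ Finset.range (n + (d + 1)), c i * ((d + 1) *
            (pspline T d ((i : ℤ) - (d + 1 : ℕ)) x -
              pspline T d ((i : ℤ) - (d + 1 : ℕ) + 1) x))) x :=
        HasDerivAt.fun_sum fun i _ => (hasDerivAt_bspline_succ h.mono d _ hx.2).const_mul _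
      have h2 : HasDerivAt (fun y => ∑ i ∈ Finset.range (n + (d + 1)),
          c i * bspline T (d + 1) ((i : ℤ) - (d + 1 : ℕ)) y) 0 x := by
        apply (hasDerivAt_const x (0 : ℝ)).congr_of_eventuallyEq
        filter_upwards [hopen.mem_nhds hx] with y hy
        exact hc y hy
      have h3 := h1.unique h2
      have h4 : ∑ i ∈ Finset.range (n + (d + 1)), c i * ((d + 1) *
            (pspline T d ((i : ℤ) - (d + 1 : ℕ)) x -
              pspline T d ((i : ℤ) - (d + 1 : ℕ) + 1) x)) =
          (d + 1) * ∑ i ∈ Finset.range (n + d), (c (i + 1) - c i) *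
            pspline T d ((i : ℤ) - d) x := by
        have e : ∀ i : ℕ, c i * (((d : ℝ) + 1) * (pspline T d ((i : ℤ) - (d + 1 : ℕ)) x -
              pspline T d ((i : ℤ) - (d + 1 : ℕ) + 1) x)) =
            (d + 1) * (c i * pspline T d ((i : ℤ) - d - 1) x) -
              (d + 1) * (c i * pspline T d ((i : ℤ) - d) x) := by
          intro i
          push_cast
          rw [show (i : ℤ) - (d + 1) = i - d - 1 by ring, show (i : ℤ) - d - 1 + 1 = i - d by ring]
          ring
        rw [Finset.sum_congr rfl fun i _ => e i, Finset.sum_sub_distrib, ← Finset.mul_sum,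
          ← Finset.mul_sum, ← mul_sub, show n + (d + 1) = n + d + 1 by ring,
          Finset.sum_range_succ', Finset.sum_range_succ]
        rw [h.pspline_left_eq_zero d (j := ((0 : ℕ) : ℤ) - d - 1) (by push_cast; omega),
          h.pspline_right_eq_zero d (j := ((n + d : ℕ) : ℤ) - d) (by push_cast; omega)]
        rw [mul_zero, mul_zero, add_zero, add_zero, ← Finset.sum_sub_distrib]
        congr 1
        apply Finset.sum_congr rfl
        intro i _
        push_cast
        rw [show (i : ℤ) + 1 - d - 1 = i - d by ring]
        ring
      rw [h4] at h3
      have h5 := (mul_eq_zero.1 h3).resolve_left (by positivity)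
      rw [← h5]
      apply Finset.sum_congr rfl
      intro i hi
      have := sub_pos.2 (h.length_pos (Finset.mem_range.1 hi))
      rw [h.bspline_eq]
      field_simp
    have hconst : ∀ i < n + (d + 1), c i = c 0 := by
      intro i
      induction i with
      | zero => intro _; rfl
      | succ i ihi =>
        intro hi
        have h1 := key i (by omega)
        have := sub_pos.2 (h.length_pos (d := d) (i := i) (by omega))
        rw [div_eq_zero_iff] at h1
        have h2 := h1.resolve_right this.ne'
        rw [← ihi (by omega)]
        linarith
    obtain ⟨x, -, hx⟩ := hne 0 (by have := h.one_le; omega)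
    have h1 := hc x hx
    rw [Finset.sum_congr rfl (fun i hi => by rw [hconst i (Finset.mem_range.1 hi)]),
      ← Finset.mul_sum, h.sum_bspline (d + 1) (Ioo_subset_Icc_self hx.1), mul_one] at h1
    intro i hi
    rw [hconst i hi, h1]

end IsKnotSeq

/-! ### B-splines as integrals along vertical lines -/

section Fourier

open MeasureTheory Filter Topology

/-- The integrand of the representation of B-splines by integrals along the vertical line through
`x`: the product runs over the `N` knots `T j, …, T (j + N - 1)`. -/
noncomputable def lineKernel (T : ℤ → ℝ) (d N : ℕ) (j : ℤ) (x y : ℝ) : ℂ :=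
  ((y : ℂ) * Complex.I) ^ d /
    ∏ k ∈ Finset.range N, (((x - T (j + k) : ℝ) : ℂ) + (y : ℂ) * Complex.I)

variable {T : ℤ → ℝ}

theorem ofReal_add_mul_I_ne_zero {r : ℝ} (hr : r ≠ 0) (y : ℝ) :
    (r : ℂ) + (y : ℂ) * Complex.I ≠ 0 := by
  intro h
  have := congrArg Complex.re h
  simp at this
  exact hr this

theorem norm_sq_ofReal_add_mul_I (r y : ℝ) : ‖(r : ℂ) + (y : ℂ) * Complex.I‖ ^ 2 = r ^ 2 + y ^ 2 := by
  rw [Complex.sq_norm, Complex.normSq_add_mul_I]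

theorem norm_sq_lineKernel (T : ℤ → ℝ) (d N : ℕ) (j : ℤ) (x y : ℝ) :
    ‖lineKernel T d N j x y‖ ^ 2 =
      (y ^ 2) ^ d / ∏ k ∈ Finset.range N, ((x - T (j + k)) ^ 2 + y ^ 2) := by
  rw [lineKernel, norm_div, div_pow, norm_pow, ← pow_mul, mul_comm d 2, pow_mul, norm_prod,
    ← Finset.prod_pow]
  simp only [norm_sq_ofReal_add_mul_I]
  simp

theorem sub_ne_zero_of_notMem {x : ℝ} (hx : x ∉ range T) (j : ℤ) : x - T j ≠ 0 :=
  sub_ne_zero.2 fun h => hx ⟨j, h.symm⟩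

theorem prod_pos_of_notMem {x : ℝ} (hx : x ∉ range T) (N : ℕ) (j : ℤ) (y : ℝ) :
    0 < ∏ k ∈ Finset.range N, ((x - T (j + k)) ^ 2 + y ^ 2) := by
  apply Finset.prod_pos
  intro k _
  have := sub_ne_zero_of_notMem hx (j + k)
  positivity

theorem continuous_lineKernel (d N : ℕ) (j : ℤ) {x : ℝ} (hx : x ∉ range T) :
    Continuous (lineKernel T d N j x) := by
  unfold lineKernel
  apply Continuous.div
  · fun_prop
  · fun_prop
  · intro y
    exact Finset.prod_ne_zero_iff.2 fun k _ =>
      ofReal_add_mul_I_ne_zero (sub_ne_zero_of_notMem hx _) y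

theorem integrable_inv_sq_add_sq {R : ℝ} (hR : 0 < R) :
    Integrable (fun y : ℝ => (y ^ 2 + R ^ 2)⁻¹) := by
  have h := (integrable_inv_one_add_sq.comp_mul_left' (inv_ne_zero hR.ne')).const_mul (R ^ 2)⁻¹
  refine h.congr (Eventually.of_forall fun y => ?_)
  simp only
  rw [← mul_inv]
  congr 1
  field_simp
  ring

theorem integral_inv_sq_add_sq_of_pos {R : ℝ} (hR : 0 < R) :
    ∫ y : ℝ, (y ^ 2 + R ^ 2)⁻¹ = Real.pi / R := by
  have h := Measure.integral_comp_mul_left (fun y : ℝ => (1 + y ^ 2)⁻¹) R⁻¹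
  rw [integral_univ_inv_one_add_sq, inv_inv, abs_of_pos hR, smul_eq_mul] at h
  have e : ∀ y : ℝ, (y ^ 2 + R ^ 2)⁻¹ = (R ^ 2)⁻¹ * (1 + (R⁻¹ * y) ^ 2)⁻¹ := by
    intro y
    rw [← mul_inv]
    congr 1
    field_simp
    ring
  simp only [e]
  rw [integral_const_mul, h]
  field_simp

/-- The numerator has squared modulus `y ^ (2 d)`; what the product contains beyond this factor is
decay of the kernel. -/
theorem norm_lineKernel_le {d N e : ℕ} {j : ℤ} {x : ℝ} (hx : x ∉ range T) {A y : ℝ}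
    (hA : 0 < A)
    (h : (y ^ 2) ^ d * (y ^ 2 + A) ^ e ≤ ∏ k ∈ Finset.range N, ((x - T (j + k)) ^ 2 + y ^ 2)) :
    ‖lineKernel T d N j x y‖ ^ 2 ≤ ((y ^ 2 + A) ^ e)⁻¹ := by
  rw [norm_sq_lineKernel, div_le_iff₀ (prod_pos_of_notMem hx N j y)]
  have : 0 < y ^ 2 + A := by positivity
  rw [inv_mul_eq_div, le_div_iff₀ (by positivity)]
  exact h

theorem integrable_of_norm_sq_le {f : ℝ → ℂ} (hf : Continuous f) {R : ℝ} (hR : 0 < R)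
    (h : ∀ y, ‖f y‖ ^ 2 ≤ ((y ^ 2 + R ^ 2) ^ 2)⁻¹) : Integrable f := by
  refine (integrable_inv_sq_add_sq hR).mono' hf.aestronglyMeasurable
    (Eventually.of_forall fun y => ?_)
  have h1 := h y
  rw [← inv_pow] at h1
  exact (abs_le_of_sq_le_sq' h1 (by positivity)).2

theorem exists_pos_le_dist (T : ℤ → ℝ) {x : ℝ} (hx : x ∉ range T) (N : ℕ) (j : ℤ) :
    ∃ R > 0, ∀ k ∈ Finset.range N, R ^ 2 ≤ (x - T (j + k)) ^ 2 := by
  induction N with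
  | zero => exact ⟨1, one_pos, by simp⟩
  | succ N ih =>
    obtain ⟨R, hR, h⟩ := ih
    have h1 := abs_pos.2 (sub_ne_zero_of_notMem hx (j + N))
    refine ⟨min R |x - T (j + N)|, lt_min hR h1, fun k hk => ?_⟩
    rcases Finset.mem_range_succ_iff.1 hk |>.lt_or_eq with hk' | hk'
    · exact (pow_le_pow_left₀ (le_min hR.le h1.le) (min_le_left _ _) 2).trans
        (h k (Finset.mem_range.2 hk'))
    · rw [hk', ← sq_abs (x - T (j + N))]
      exact pow_le_pow_left₀ (le_min hR.le h1.le) (min_le_right _ _) 2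

theorem integrable_lineKernel (d : ℕ) (j : ℤ) {x : ℝ} (hx : x ∉ range T) :
    Integrable (lineKernel T d (d + 2) j x) := by
  obtain ⟨R, hR, h⟩ := exists_pos_le_dist T hx (d + 2) j
  refine integrable_of_norm_sq_le (continuous_lineKernel d _ j hx) hR fun y => ?_
  refine norm_lineKernel_le hx (by positivity) ?_
  calc (y ^ 2) ^ d * (y ^ 2 + R ^ 2) ^ 2 ≤ (y ^ 2 + R ^ 2) ^ d * (y ^ 2 + R ^ 2) ^ 2 := by
        gcongr; nlinarith
    _ = ∏ k ∈ Finset.range (d + 2), (R ^ 2 + y ^ 2) := by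
        rw [Finset.prod_const, Finset.card_range, ← pow_add, add_comm (y ^ 2)]
    _ ≤ _ := by
        apply Finset.prod_le_prod
        · intro k _; positivity
        · intro k hk; linarith [h k hk]

/-- Partial fractions leave two Cauchy kernels, each contributing `π` times a sign. The difference
of the signs detects whether `0` lies between `a` and `b`, which is the B-spline of degree `0`. -/
theorem integral_re_lineKernel_one {a b : ℝ} (ha : a ≠ 0) (hb : b ≠ 0) (hab : a ≠ b) :
    ∫ y : ℝ, (1 / (((a : ℂ) + (y : ℂ) * Complex.I) * ((b : ℂ) + (y : ℂ) * Complex.I))).re =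
      Real.pi * (a / |a| - b / |b|) / (b - a) := by
  have e : ∀ y : ℝ, (1 / (((a : ℂ) + (y : ℂ) * Complex.I) *
      ((b : ℂ) + (y : ℂ) * Complex.I))).re =
      (b - a)⁻¹ * (a * (y ^ 2 + |a| ^ 2)⁻¹ - b * (y ^ 2 + |b| ^ 2)⁻¹) := by
    intro y
    have h1 : a ^ 2 + y ^ 2 ≠ 0 := by positivity
    have h2 : b ^ 2 + y ^ 2 ≠ 0 := by positivity
    have h3 : b - a ≠ 0 := sub_ne_zero.2 hab.symm
    have h1' : y ^ 2 + a ^ 2 ≠ 0 := by positivity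
    have h2' : y ^ 2 + b ^ 2 ≠ 0 := by positivity
    rw [one_div, Complex.inv_re, Complex.normSq_mul, Complex.normSq_add_mul_I,
      Complex.normSq_add_mul_I, sq_abs, sq_abs]
    simp only [Complex.mul_re, Complex.add_re, Complex.ofReal_re, Complex.I_re, mul_zero,
      Complex.ofReal_im, Complex.I_im, mul_one, sub_self, add_zero, Complex.add_im,
      Complex.mul_im, zero_add]
    field_simp
    ring
  have ha' := abs_pos.2 ha
  have hb' := abs_pos.2 hb
  simp only [e]
  rw [integral_const_mul, integral_sub ((integrable_inv_sq_add_sq ha').const_mul a)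
    ((integrable_inv_sq_add_sq hb').const_mul b), integral_const_mul, integral_const_mul,
    integral_inv_sq_add_sq_of_pos ha', integral_inv_sq_add_sq_of_pos hb']
  ring

theorem tendsto_div_ofReal_add_mul_I {r : ℝ} (hr : r ≠ 0) {l : Filter ℝ}
    (hl : Tendsto (fun y : ℝ => |y|) l atTop) :
    Tendsto (fun y : ℝ => ((y : ℂ) * Complex.I) / ((r : ℂ) + (y : ℂ) * Complex.I)) l (𝓝 1) := by
  have e : ∀ y : ℝ, ((y : ℂ) * Complex.I) / ((r : ℂ) + (y : ℂ) * Complex.I) =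
      1 - r / ((r : ℂ) + (y : ℂ) * Complex.I) := by
    intro y
    have := ofReal_add_mul_I_ne_zero hr y
    field_simp
    ring
  simp only [e]
  have : Tendsto (fun y : ℝ => (r : ℂ) / ((r : ℂ) + (y : ℂ) * Complex.I)) l (𝓝 0) := by
    rw [tendsto_zero_iff_norm_tendsto_zero]
    have h1 : Tendsto (fun y : ℝ => |r| / |y|) l (𝓝 0) := hl.const_div_atTop _
    refine tendsto_of_tendsto_of_tendsto_of_le_of_le' tendsto_const_nhds h1
      (Eventually.of_forall fun y => norm_nonneg _) ?_
    filter_upwards [hl.eventually_gt_atTop 0] with y hy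
    rw [norm_div, Complex.norm_real, Real.norm_eq_abs]
    gcongr
    apply abs_le_of_sq_le_sq' _ (norm_nonneg _) |>.2
    rw [norm_sq_ofReal_add_mul_I, sq_abs]
    nlinarith
  simpa using this.const_sub 1

/-- When all knots coincide there is an explicit primitive, a multiple of `(i y / (r + i y)) ^ (d +
1)`, with the same limit at both ends of the line. -/
theorem integral_re_lineKernel_degenerate (d : ℕ) {r : ℝ} (hr : r ≠ 0)
    (hi : Integrable fun y : ℝ =>
      ((y : ℂ) * Complex.I) ^ d / ((r : ℂ) + (y : ℂ) * Complex.I) ^ (d + 2)) :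
    ∫ y : ℝ, (((y : ℂ) * Complex.I) ^ d / ((r : ℂ) + (y : ℂ) * Complex.I) ^ (d + 2)).re = 0 := by
  have hr' : (r : ℂ) ≠ 0 := by exact_mod_cast hr
  have hd : ((d : ℂ) + 1) ≠ 0 := by exact_mod_cast Nat.succ_ne_zero d
  have hder : ∀ y : ℝ, HasDerivAt (fun y : ℝ =>
      (((y : ℂ) * Complex.I) / ((r : ℂ) + (y : ℂ) * Complex.I)) ^ (d + 1) /
        ((d + 1) * (r * Complex.I)))
      (((y : ℂ) * Complex.I) ^ d / ((r : ℂ) + (y : ℂ) * Complex.I) ^ (d + 2)) y := by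
    intro y
    have h0 := ofReal_add_mul_I_ne_zero hr y
    have h1 : HasDerivAt (fun y : ℝ => (y : ℂ) * Complex.I) Complex.I y := by
      simpa using (Complex.ofRealCLM.hasDerivAt (x := y)).mul_const Complex.I
    have h2 := ((h1.div (h1.const_add (r : ℂ)) h0).pow (d + 1)).div_const
      (((d : ℂ) + 1) * (r * Complex.I))
    refine h2.congr_deriv ?_
    have := Complex.I_ne_zero
    simp only [Nat.add_sub_cancel, Pi.div_apply]
    push_cast
    rw [div_pow]
    field_simp
    ring
  have habs : Tendsto (fun y : ℝ => |y|) atBot atTop := tendsto_abs_atBot_atTop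
  have h := integral_of_hasDerivAt_of_tendsto hder hi
    (((tendsto_div_ofReal_add_mul_I hr habs).pow (d + 1)).div_const _)
    (((tendsto_div_ofReal_add_mul_I hr tendsto_abs_atTop_atTop).pow (d + 1)).div_const _)
  have h2 := integral_re hi
  simp only [RCLike.re_eq_complex_re] at h2
  rw [h2, h]
  simp

/-- The recursion of `pspline_succ` at the level of kernels. With `w = i y` and outer knots `α, β`
it is the identity `(x - α) (x - β + w) + (β - x) (x - α + w) = (β - α) w` over a common
denominator. -/
theorem lineKernel_succ (T : ℤ → ℝ) (d : ℕ) (j : ℤ) {x : ℝ} (hx : x ∉ range T) (y : ℝ) :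
    ((T (j + d + 2) - T j : ℝ) : ℂ) * lineKernel T (d + 1) (d + 3) j x y =
      ((x - T j : ℝ) : ℂ) * lineKernel T d (d + 2) j x y +
        ((T (j + d + 2) - x : ℝ) : ℂ) * lineKernel T d (d + 2) (j + 1) x y := by
  have h0 := ofReal_add_mul_I_ne_zero (sub_ne_zero_of_notMem hx j) y
  have h1 := ofReal_add_mul_I_ne_zero (sub_ne_zero_of_notMem hx (j + d + 2)) y
  simp only [lineKernel]
  rw [Finset.prod_range_succ (n := d + 2), Finset.prod_range_succ' (n := d + 1),
    Finset.prod_range_succ (n := d + 1)]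
  have e : ∀ k : ℕ, j + ((k + 1 : ℕ) : ℤ) = j + 1 + k := by intro k; push_cast; ring
  simp only [e]
  rw [show j + 1 + ((d + 1 : ℕ) : ℤ) = j + d + 2 by push_cast; ring,
    show j + ((0 : ℕ) : ℤ) = j by simp]
  have h2 : ∏ k ∈ Finset.range (d + 1), (((x - T (j + 1 + k) : ℝ) : ℂ) + (y : ℂ) * Complex.I)
      ≠ 0 := Finset.prod_ne_zero_iff.2 fun k _ =>
      ofReal_add_mul_I_ne_zero (sub_ne_zero_of_notMem hx _) y
  set Q := ∏ k ∈ Finset.range (d + 1), (((x - T (j + 1 + k) : ℝ) : ℂ) + (y : ℂ) * Complex.I)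
  push_cast at h0 h1 ⊢
  field_simp
  ring

theorem lineKernel_sub (T : ℤ → ℝ) (d : ℕ) (j : ℤ) {x : ℝ} (hx : x ∉ range T) (y : ℝ) :
    lineKernel T d (d + 2) j x y - lineKernel T d (d + 2) (j + 1) x y =
      -((T (j + d + 2) - T j : ℝ) : ℂ) * lineKernel T d (d + 3) j x y := by
  have h0 := ofReal_add_mul_I_ne_zero (sub_ne_zero_of_notMem hx j) y
  have h1 := ofReal_add_mul_I_ne_zero (sub_ne_zero_of_notMem hx (j + d + 2)) y
  simp only [lineKernel]
  rw [Finset.prod_range_succ (n := d + 2), Finset.prod_range_succ' (n := d + 1),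
    Finset.prod_range_succ (n := d + 1)]
  have e : ∀ k : ℕ, j + ((k + 1 : ℕ) : ℤ) = j + 1 + k := by intro k; push_cast; ring
  simp only [e]
  rw [show j + 1 + ((d + 1 : ℕ) : ℤ) = j + d + 2 by push_cast; ring,
    show j + ((0 : ℕ) : ℤ) = j by simp]
  have h2 : ∏ k ∈ Finset.range (d + 1), (((x - T (j + 1 + k) : ℝ) : ℂ) + (y : ℂ) * Complex.I)
      ≠ 0 := Finset.prod_ne_zero_iff.2 fun k _ =>
      ofReal_add_mul_I_ne_zero (sub_ne_zero_of_notMem hx _) y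
  set Q := ∏ k ∈ Finset.range (d + 1), (((x - T (j + 1 + k) : ℝ) : ℂ) + (y : ℂ) * Complex.I)
  push_cast at h0 h1 ⊢
  field_simp
  ring

/-- B-splines as integrals along a vertical line in the complex plane. -/
theorem pspline_eq_integral (hT : Monotone T) (d : ℕ) (j : ℤ) {x : ℝ} (hx : x ∉ range T) :
    pspline T d j x = -(2 * Real.pi)⁻¹ * ∫ y : ℝ, (lineKernel T d (d + 2) j x y).re := by
  -- For a support of length `0` the recursion only says `0 = 0`, so the integral must be shown to
  -- vanish directly.
  have hdeg : ∀ (d : ℕ) (j : ℤ), T (j + d + 1) = T j →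
      pspline T d j x = -(2 * Real.pi)⁻¹ * ∫ y : ℝ, (lineKernel T d (d + 2) j x y).re := by
    intro d j hS
    have e : ∀ y : ℝ, lineKernel T d (d + 2) j x y =
        ((y : ℂ) * Complex.I) ^ d / (((x - T j : ℝ) : ℂ) + (y : ℂ) * Complex.I) ^ (d + 2) := by
      intro y
      rw [lineKernel, Finset.prod_congr rfl
        (g := fun _ => ((x - T j : ℝ) : ℂ) + (y : ℂ) * Complex.I)]
      · simp
      · intro k hk
        have := Finset.mem_range.1 hk
        rw [le_antisymm ((hT (by omega)).trans hS.le) (hT (by omega : j ≤ j + k))]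
    have hi := integrable_lineKernel d j hx
    have hi' := hi.congr (Eventually.of_forall e)
    rw [pspline_eq_zero_of_degenerate x hS]
    simp only [e]
    rw [integral_re_lineKernel_degenerate d (sub_ne_zero_of_notMem hx j) hi', mul_zero]
  induction d generalizing j with
  | zero =>
    by_cases hS : T (j + (0 : ℕ) + 1) = T j
    · exact hdeg 0 j hS
    · have e : ∀ y : ℝ, lineKernel T 0 (0 + 2) j x y =
          1 / ((((x - T j : ℝ) : ℂ) + (y : ℂ) * Complex.I) *
            (((x - T (j + 1) : ℝ) : ℂ) + (y : ℂ) * Complex.I)) := by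
        intro y
        simp [lineKernel, Finset.prod_range_succ]
      simp only [Nat.cast_zero, add_zero] at hS
      have hlt : T j < T (j + 1) := lt_of_le_of_ne (hT (by omega)) (Ne.symm hS)
      have h0 := sub_ne_zero_of_notMem hx j
      have h1 := sub_ne_zero_of_notMem hx (j + 1)
      simp only [e]
      rw [integral_re_lineKernel_one h0 h1 (by intro h2; linarith)]
      have hpi := Real.pi_ne_zero
      have hS' : T j - T (j + 1) ≠ 0 := by linarith
      have hS'' : T (j + 1) - T j ≠ 0 := by linarith
      rw [pspline, bspline]
      simp only [Nat.cast_zero, add_zero]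
      have hr : -(2 * Real.pi)⁻¹ * (Real.pi * ((x - T j) / |x - T j| -
          (x - T (j + 1)) / |x - T (j + 1)|) / (x - T (j + 1) - (x - T j))) =
          2⁻¹ * ((x - T j) / |x - T j| - (x - T (j + 1)) / |x - T (j + 1)|) /
            (T (j + 1) - T j) := by
        rw [show x - T (j + 1) - (x - T j) = -(T (j + 1) - T j) by ring]
        field_simp
      rw [hr]
      congr 1
      rcases lt_or_gt_of_ne h0 with h2 | h2 <;> rcases lt_or_gt_of_ne h1 with h3 | h3
      · rw [abs_of_neg h2, abs_of_neg h3, div_neg_self h0, div_neg_self h1, if_neg]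
        · norm_num
        · rintro (⟨h4, -⟩ | ⟨h4, -⟩) <;> linarith
      · linarith
      · rw [abs_of_pos h2, abs_of_neg h3, div_self h0, div_neg_self h1, if_pos]
        · norm_num
        · left; constructor <;> linarith
      · rw [abs_of_pos h2, abs_of_pos h3, div_self h0, div_self h1, if_neg]
        · norm_num
        · rintro (⟨-, h4⟩ | ⟨-, h4, -⟩) <;> linarith
  | succ d ih =>
    by_cases hS : T (j + (d + 1 : ℕ) + 1) = T j
    · exact hdeg (d + 1) j hS
    · rw [show j + ((d + 1 : ℕ) : ℤ) + 1 = j + d + 2 by push_cast; ring] at hS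
      have hS' := sub_ne_zero.2 hS
      apply mul_left_cancel₀ hS'
      rw [pspline_succ hT, ih j, ih (j + 1)]
      have hre : ∀ (d : ℕ) (j : ℤ), Integrable fun y => (lineKernel T d (d + 2) j x y).re :=
        fun d j => (integrable_lineKernel d j hx).re
      rw [mul_left_comm (x - T j), mul_left_comm (T (j + d + 2) - x),
        mul_left_comm (T (j + d + 2) - T j), ← mul_add, ← integral_const_mul,
        ← integral_const_mul, ← integral_const_mul, ← integral_add]
      · congr 1
        apply integral_congr_ae
        refine Eventually.of_forall fun y => ?_
        simp only
        have h1 := congrArg Complex.re (lineKernel_succ T d j hx y)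
        rw [Complex.add_re, Complex.re_ofReal_mul, Complex.re_ofReal_mul,
          Complex.re_ofReal_mul] at h1
        exact h1.symm
      · exact (hre d j).const_mul _
      · exact (hre d (j + 1)).const_mul _

/-- The difference of the two kernels in the derivative formula puts all `d + 3` knots into one
denominator, and the length of the support cancels. -/
theorem psplineDeriv_eq_integral (hT : Monotone T) (d : ℕ) {j : ℤ} {x : ℝ} (hx : x ∉ range T)
    (hS : T j < T (j + d + 2)) :
    psplineDeriv T (d + 1) j x =
      (d + 1) / (2 * Real.pi) * ∫ y : ℝ, (lineKernel T d (d + 3) j x y).re := by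
  have hS' := sub_pos.2 hS
  have hpi := Real.pi_ne_zero
  have hre : ∀ (d : ℕ) (j : ℤ), Integrable fun y => (lineKernel T d (d + 2) j x y).re :=
    fun d j => (integrable_lineKernel d j hx).re
  rw [psplineDeriv, pspline_eq_integral hT d j hx, pspline_eq_integral hT d (j + 1) hx,
    ← mul_sub, ← integral_sub (hre d j) (hre d (j + 1))]
  have e : ∀ y, (lineKernel T d (d + 2) j x y).re - (lineKernel T d (d + 2) (j + 1) x y).re =
      -(T (j + d + 2) - T j) * (lineKernel T d (d + 3) j x y).re := by
    intro y
    have := congrArg Complex.re (lineKernel_sub T d j hx y)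
    rw [Complex.sub_re, ← Complex.ofReal_neg, Complex.re_ofReal_mul] at this
    exact this
  simp only [e]
  rw [integral_const_mul]
  field_simp

theorem abs_integral_re_le {f : ℝ → ℂ} {g : ℝ → ℝ} (hg : Integrable g)
    (h : ∀ y, ‖f y‖ ≤ g y) : |∫ y, (f y).re| ≤ ∫ y, g y := by
  rw [← Real.norm_eq_abs]
  exact norm_integral_le_of_norm_le hg
    (Eventually.of_forall fun y => (Complex.abs_re_le_norm _).trans (h y))

theorem pspline_le_of_prod {d : ℕ} {j : ℤ} {x R : ℝ} (hT : Monotone T) (hx : x ∉ range T)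
    (hR : 0 < R) (h : ∀ y : ℝ, (y ^ 2) ^ d * (y ^ 2 + R ^ 2) ^ 2 ≤
      ∏ k ∈ Finset.range (d + 2), ((x - T (j + k)) ^ 2 + y ^ 2)) :
    pspline T d j x ≤ 1 / (2 * R) := by
  have h1 := abs_integral_re_le (f := lineKernel T d (d + 2) j x) (integrable_inv_sq_add_sq hR)
    (fun y => by
      have h2 := norm_lineKernel_le hx (by positivity) (h y)
      rw [← inv_pow] at h2
      exact (abs_le_of_sq_le_sq' h2 (by positivity)).2)
  rw [integral_inv_sq_add_sq_of_pos hR] at h1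
  have hpi := Real.pi_pos
  rw [pspline_eq_integral hT d j hx, neg_mul]
  calc _ ≤ |-((2 * Real.pi)⁻¹ * ∫ y : ℝ, (lineKernel T d (d + 2) j x y).re)| := le_abs_self _
    _ = (2 * Real.pi)⁻¹ * |∫ y : ℝ, (lineKernel T d (d + 2) j x y).re| := by
        rw [abs_neg, abs_mul, abs_of_pos (by positivity)]
    _ ≤ (2 * Real.pi)⁻¹ * (Real.pi / R) := by gcongr
    _ = 1 / (2 * R) := by field_simp

/-- The primitive that evaluates the integral of `(y ^ 2 + A) ^ (-3/2)` as `2 / A`. -/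
theorem hasDerivAt_div_sqrt {A : ℝ} (hA : 0 < A) (y : ℝ) :
    HasDerivAt (fun y : ℝ => y / (A * √(y ^ 2 + A))) (√((y ^ 2 + A) ^ 3))⁻¹ y := by
  have hp : 0 < y ^ 2 + A := by positivity
  have hs := Real.sqrt_pos.2 hp
  have hss := Real.sq_sqrt hp.le
  have h1 : HasDerivAt (fun y : ℝ => y ^ 2 + A) (2 * y) y := by
    simpa using (hasDerivAt_pow 2 y).add_const A
  have h2 := (hasDerivAt_id' y).div ((h1.sqrt hp.ne').const_mul A) (by positivity)
  refine h2.congr_deriv ?_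
  have h3 : √((y ^ 2 + A) ^ 3) = √(y ^ 2 + A) ^ 3 := by
    rw [Real.sqrt_eq_iff_mul_self_eq (by positivity) (by positivity)]
    rw [← mul_pow, ← sq, hss]
  rw [h3]
  field_simp
  rw [hss]
  ring

theorem integrable_inv_sqrt_cube {A : ℝ} (hA : 0 < A) :
    Integrable (fun y : ℝ => (√((y ^ 2 + A) ^ 3))⁻¹) := by
  have h := (integrable_inv_sq_add_sq (Real.sqrt_pos.2 hA)).const_mul (√A)⁻¹
  rw [Real.sq_sqrt hA.le] at h
  refine h.mono' ?_ (Eventually.of_forall fun y => ?_)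
  · apply Continuous.aestronglyMeasurable
    apply Continuous.inv₀
    · fun_prop
    · intro y
      have hp : 0 < y ^ 2 + A := by positivity
      positivity
  · have hp : 0 < y ^ 2 + A := by positivity
    have hsA := Real.sqrt_pos.2 hA
    rw [Real.norm_of_nonneg (by positivity), ← mul_inv]
    apply inv_anti₀ (by positivity)
    apply Real.le_sqrt_of_sq_le
    rw [mul_pow, Real.sq_sqrt hA.le, pow_succ' (y ^ 2 + A) 2]
    gcongr
    nlinarith [sq_nonneg y]

theorem tendsto_div_sqrt {A : ℝ} (hA : 0 < A) :
    Tendsto (fun y : ℝ => y / (A * √(y ^ 2 + A))) atTop (𝓝 (1 / A)) := by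
  have h1 : Tendsto (fun y : ℝ => A / y ^ 2) atTop (𝓝 0) :=
    (tendsto_pow_atTop two_ne_zero).const_div_atTop _
  have h2 : Tendsto (fun y : ℝ => 1 / (A * √(1 + A / y ^ 2))) atTop (𝓝 (1 / (A * √(1 + 0)))) := by
    apply Tendsto.div tendsto_const_nhds
    · exact ((Real.continuous_sqrt.tendsto _).comp (h1.const_add 1)).const_mul A
    · simp [hA.ne']
  simp only [add_zero, Real.sqrt_one, mul_one] at h2
  refine h2.congr' ?_
  filter_upwards [eventually_gt_atTop 0] with y hy
  have : √(y ^ 2 + A) = y * √(1 + A / y ^ 2) := by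
    rw [show y ^ 2 + A = y ^ 2 * (1 + A / y ^ 2) by field_simp, Real.sqrt_mul (by positivity),
      Real.sqrt_sq hy.le]
  rw [this]
  have h3 : 0 < √(1 + A / y ^ 2) := Real.sqrt_pos.2 (by positivity)
  field_simp

theorem integral_inv_sqrt_cube {A : ℝ} (hA : 0 < A) :
    ∫ y : ℝ, (√((y ^ 2 + A) ^ 3))⁻¹ = 2 / A := by
  have hbot : Tendsto (fun y : ℝ => y / (A * √(y ^ 2 + A))) atBot (𝓝 (-(1 / A))) := by
    have := ((tendsto_div_sqrt hA).comp tendsto_neg_atBot_atTop).neg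
    refine this.congr fun y => ?_
    simp [neg_div]
  rw [integral_of_hasDerivAt_of_tendsto (hasDerivAt_div_sqrt hA) (integrable_inv_sqrt_cube hA)
    hbot (tendsto_div_sqrt hA)]
  ring

/-- The kernel is dominated by `(y ^ 2 + A) ^ (-3/2)`, as if three knots were at squared distance
`A` from `x` and the others at `x`. -/
theorem abs_psplineDeriv_le_of_prod (hT : Monotone T) {d : ℕ} {j : ℤ} {x A : ℝ}
    (hx : x ∉ range T) (hS : T j < T (j + d + 2)) (hA : 0 < A)
    (h : ∀ y : ℝ, (y ^ 2) ^ d * (y ^ 2 + A) ^ 3 ≤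
      ∏ k ∈ Finset.range (d + 3), ((x - T (j + k)) ^ 2 + y ^ 2)) :
    |psplineDeriv T (d + 1) j x| ≤ (d + 1) / (Real.pi * A) := by
  have h1 := abs_integral_re_le (f := lineKernel T d (d + 3) j x) (integrable_inv_sqrt_cube hA)
    (fun y => by
      have h2 := norm_lineKernel_le hx hA (h y)
      have hp : 0 < y ^ 2 + A := by positivity
      rw [← Real.sqrt_inv]
      exact Real.le_sqrt_of_sq_le h2)
  rw [integral_inv_sqrt_cube hA] at h1
  have hpi := Real.pi_pos
  rw [psplineDeriv_eq_integral hT d hx hS, abs_mul, abs_of_pos (by positivity)]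
  calc _ ≤ (d + 1) / (2 * Real.pi) * (2 / A) := by gcongr
    _ = _ := by field_simp

end Fourier

/-! ### Sign patterns and total variation -/

/-- Up to countably many points, `f` is nonnegative, then nonpositive, then nonnegative on
`(a, b)`. -/
def PosNegPos (f : ℝ → ℝ) (a b : ℝ) : Prop :=
  ∃ u w : ℝ, ∃ s : Set ℝ, s.Countable ∧ a ≤ u ∧ u ≤ w ∧ w ≤ b ∧
    (∀ x ∈ Ioo a u \ s, 0 ≤ f x) ∧ (∀ x ∈ Ioo u w \ s, f x ≤ 0) ∧ ∀ x ∈ Ioo w b \ s, 0 ≤ f x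

section RealAnalysis

open MeasureTheory

theorem exists_sign_change {F : ℝ → ℝ} {a b : ℝ} (hab : a ≤ b) (hF : MonotoneOn F (Ioo a b)) :
    ∃ z ∈ Icc a b, (∀ x ∈ Ioo a z, F x ≤ 0) ∧ ∀ x ∈ Ioo z b, 0 ≤ F x := by
  -- Its supremum is the point of sign change; `a` is added so that the set is nonempty when `F` is
  -- positive throughout.
  set A := insert a {x | x ∈ Ioo a b ∧ F x ≤ 0}
  have hbdd : BddAbove A := by
    refine ⟨b, ?_⟩
    rintro x (rfl | ⟨hx, -⟩)
    · exact hab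
    · exact hx.2.le
  have hne : A.Nonempty := ⟨a, mem_insert _ _⟩
  have haz : a ≤ sSup A := le_csSup hbdd (mem_insert _ _)
  have hzb : sSup A ≤ b := csSup_le hne (by
    rintro x (rfl | ⟨hx, -⟩)
    · exact hab
    · exact hx.2.le)
  refine ⟨sSup A, ⟨haz, hzb⟩, ?_, ?_⟩
  · intro x hx
    obtain ⟨y, hy, hxy⟩ := exists_lt_of_lt_csSup hne hx.2
    rcases hy with rfl | ⟨hy, hy'⟩
    · exact absurd hx.1 (not_lt.2 hxy.le)
    · exact (hF ⟨hx.1, hxy.trans hy.2⟩ hy hxy.le).trans hy'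
  · intro x hx
    by_contra h
    exact absurd (le_csSup hbdd (mem_insert_of_mem a ⟨⟨haz.trans_lt hx.1, hx.2⟩, (not_le.1 h).le⟩))
      (not_le.2 hx.1)

theorem integral_nonneg_of_countable {G : ℝ → ℝ} {x y : ℝ} (hxy : x ≤ y) {s : Set ℝ}
    (hs : s.Countable) (h : ∀ z ∈ Ioo x y \ s, 0 ≤ G z) : 0 ≤ ∫ z in x..y, G z := by
  rw [intervalIntegral.integral_of_le hxy, integral_Ioc_eq_integral_Ioo]
  apply setIntegral_nonneg_of_ae_restrict
  have h1 : ∀ᵐ z ∂(volume.restrict (Ioo x y)), z ∉ s :=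
    ae_restrict_of_ae (hs.ae_notMem volume)
  filter_upwards [ae_restrict_mem measurableSet_Ioo, h1] with z hz hz'
  exact h z ⟨hz, hz'⟩

variable {F G : ℝ → ℝ} {a b : ℝ} {S : Set ℝ}

theorem sub_eq_integral (hS : S.Countable) (hFc : ContinuousOn F (Ico a b))
    (hF : ∀ x ∈ Ioo a b \ S, HasDerivAt F (G x) x)
    (hG : ∀ y ∈ Ico a b, IntervalIntegrable G volume a y) {x y : ℝ} (hx : x ∈ Ico a b)
    (hy : y ∈ Ico a b) (hxy : x ≤ y) : ∫ z in x..y, G z = F y - F x := by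
  have hsub : Icc x y ⊆ Ico a b := fun z hz => ⟨hx.1.trans hz.1, hz.2.trans_lt hy.2⟩
  refine integral_eq_of_hasDerivAt_off_countable_of_le F G hxy hS (hFc.mono hsub) ?_
    ((hG x hx).symm.trans (hG y hy))
  intro z hz
  exact hF z ⟨⟨hx.1.trans_lt hz.1.1, hz.1.2.trans hy.2⟩, hz.2⟩

/-- An increasing function is first nonpositive, then nonnegative: the pattern with an empty first
interval. No starting value is required. -/
theorem posNegPos_of_deriv_nonneg (hab : a ≤ b) (hS : S.Countable)
    (hFc : ContinuousOn F (Ico a b)) (hF : ∀ x ∈ Ioo a b \ S, HasDerivAt F (G x) x)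
    (hG : ∀ y ∈ Ico a b, IntervalIntegrable G volume a y)
    (hpos : ∀ x ∈ Ioo a b \ S, 0 ≤ G x) : PosNegPos F a b := by
  have hm : MonotoneOn F (Ioo a b) := by
    intro x hx y hy hxy
    have h1 := sub_eq_integral hS hFc hF hG (Ioo_subset_Ico_self hx) (Ioo_subset_Ico_self hy) hxy
    have h2 : 0 ≤ ∫ z in x..y, G z := integral_nonneg_of_countable hxy hS fun z hz =>
      hpos z ⟨⟨hx.1.trans hz.1.1, hz.1.2.trans hy.2⟩, hz.2⟩
    linarith
  obtain ⟨z, hz, h1, h2⟩ := exists_sign_change hab hm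
  exact ⟨a, z, ∅, countable_empty, le_rfl, hz.1, hz.2, by simp,
    fun x hx => h1 x hx.1, fun x hx => h2 x hx.1⟩

/-- If the derivative of `F` has the sign pattern `+, -, +` and `F` starts with a nonnegative
value, then `F` has this sign pattern as well. -/
theorem posNegPos_of_deriv (hS : S.Countable)
    (hFc : ContinuousOn F (Ico a b)) (hF : ∀ x ∈ Ioo a b \ S, HasDerivAt F (G x) x)
    (hG : ∀ y ∈ Ico a b, IntervalIntegrable G volume a y)
    (hpat : PosNegPos G a b) (h0 : 0 ≤ F a) : PosNegPos F a b := by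
  obtain ⟨u, w, s, hs, hau, huw, hwb, h1, h2, h3⟩ := hpat
  have hint : ∀ x ∈ Ico a b, ∀ y ∈ Ico a b, x ≤ y → ∫ z in x..y, G z = F y - F x :=
    fun x hx y hy hxy => sub_eq_integral hS hFc hF hG hx hy hxy
  have p1 : ∀ x ∈ Ioo a u, 0 ≤ F x := by
    intro x hx
    have hx' : x ∈ Ico a b := ⟨hx.1.le, hx.2.trans_le (huw.trans hwb)⟩
    have e1 := hint a ⟨le_rfl, hx.1.trans hx'.2⟩ x hx' hx.1.le
    have e2 : 0 ≤ ∫ z in a..x, G z := integral_nonneg_of_countable hx.1.le hs fun z hz =>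
      h1 z ⟨⟨hz.1.1, hz.1.2.trans hx.2⟩, hz.2⟩
    linarith
  have p2 : MonotoneOn (fun x => -F x) (Ioo u w) := by
    intro x hx y hy hxy
    have e1 := hint x ⟨hau.trans hx.1.le, hx.2.trans_le hwb⟩ y
      ⟨hau.trans hy.1.le, hy.2.trans_le hwb⟩ hxy
    have e2 : 0 ≤ ∫ z in x..y, -G z := integral_nonneg_of_countable hxy hs fun z hz =>
      neg_nonneg.2 (h2 z ⟨⟨hx.1.trans hz.1.1, hz.1.2.trans hy.2⟩, hz.2⟩)
    rw [intervalIntegral.integral_neg] at e2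
    simp only
    linarith
  have p3 : MonotoneOn F (Ioo w b) := by
    intro x hx y hy hxy
    have e1 := hint x ⟨(hau.trans huw).trans hx.1.le, hx.2⟩ y
      ⟨(hau.trans huw).trans hy.1.le, hy.2⟩ hxy
    have e2 : 0 ≤ ∫ z in x..y, G z := integral_nonneg_of_countable hxy hs fun z hz =>
      h3 z ⟨⟨hx.1.trans hz.1.1, hz.1.2.trans hy.2⟩, hz.2⟩
    linarith
  -- `F` is nonnegative up to `u`, then decreases, then increases, so it changes sign at most once
  -- on each of the last two intervals, and the pieces join to `+, -, +`.
  obtain ⟨z1, hz1, q1, q2⟩ := exists_sign_change huw p2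
  obtain ⟨z2, hz2, q3, q4⟩ := exists_sign_change hwb p3
  refine ⟨z1, z2, {u, w}, (Set.toFinite _).countable, hau.trans hz1.1, hz1.2.trans hz2.1, hz2.2,
    ?_, ?_, ?_⟩
  · rintro x ⟨hx, hx'⟩
    simp only [mem_insert_iff, mem_singleton_iff, not_or] at hx'
    rcases lt_or_gt_of_ne hx'.1 with h | h
    · exact p1 x ⟨hx.1, h⟩
    · simpa using q1 x ⟨h, hx.2⟩
  · rintro x ⟨hx, hx'⟩
    simp only [mem_insert_iff, mem_singleton_iff, not_or] at hx'
    rcases lt_or_gt_of_ne hx'.2 with h | h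
    · simpa using q2 x ⟨hx.1, h⟩
    · exact q3 x ⟨h, hx.2⟩
  · rintro x ⟨hx, -⟩
    exact q4 x hx

/-- The integral of `|G|` for a derivative `G` with the sign pattern `+, -, +`. -/
theorem integral_abs_le_of_posNegPos {C : ℝ} (hab : a ≤ b) (hS : S.Countable)
    (hFc : ContinuousOn F (Icc a b)) (hF : ∀ x ∈ Ioo a b \ S, HasDerivAt F (G x) x)
    (hG : IntegrableOn G (Icc a b)) (hpat : PosNegPos G a b) (ha : F a = 0) (hb : F b = 0)
    (hC : ∀ x ∈ Icc a b, ∀ y ∈ Icc a b, F x - F y ≤ C) :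
    ∫ x in a..b, |G x| ≤ 2 * C := by
  obtain ⟨u, w, s, hs, hau, huw, hwb, h1, h2, h3⟩ := hpat
  have hu : u ∈ Icc a b := ⟨hau, huw.trans hwb⟩
  have hw : w ∈ Icc a b := ⟨hau.trans huw, hwb⟩
  have hii : ∀ x ∈ Icc a b, ∀ y ∈ Icc a b, IntervalIntegrable G volume x y := fun x hx y hy =>
    IsKnotSeq.intervalIntegrable_of_integrableOn hG hx hy
  have hint : ∀ x ∈ Icc a b, ∀ y ∈ Icc a b, x ≤ y → ∫ z in x..y, G z = F y - F x := by
    intro x hx y hy hxy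
    refine integral_eq_of_hasDerivAt_off_countable_of_le F G hxy hS
      (hFc.mono (Icc_subset_Icc hx.1 hy.2)) ?_ (hii x hx y hy)
    intro z hz
    exact hF z ⟨⟨hx.1.trans_lt hz.1.1, hz.1.2.trans_le hy.2⟩, hz.2⟩
  have hle : ∀ x y, x ≤ y → (∀ z ∈ Ioo x y \ s, 0 ≤ G z) →
      ∫ z in x..y, |G z| = ∫ z in x..y, G z := by
    intro x y hxy h
    rw [intervalIntegral.integral_of_le hxy, intervalIntegral.integral_of_le hxy,
      integral_Ioc_eq_integral_Ioo, integral_Ioc_eq_integral_Ioo]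
    apply integral_congr_ae
    have h1 : ∀ᵐ z ∂(volume.restrict (Ioo x y)), z ∉ s :=
      ae_restrict_of_ae (hs.ae_notMem volume)
    filter_upwards [ae_restrict_mem measurableSet_Ioo, h1] with z hz hz'
    exact abs_of_nonneg (h z ⟨hz, hz'⟩)
  have hle' : ∀ x y, x ≤ y → (∀ z ∈ Ioo x y \ s, G z ≤ 0) →
      ∫ z in x..y, |G z| = -∫ z in x..y, G z := by
    intro x y hxy h
    rw [← intervalIntegral.integral_neg,
      intervalIntegral.integral_of_le hxy, intervalIntegral.integral_of_le hxy,
      integral_Ioc_eq_integral_Ioo, integral_Ioc_eq_integral_Ioo]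
    apply integral_congr_ae
    have h1 : ∀ᵐ z ∂(volume.restrict (Ioo x y)), z ∉ s :=
      ae_restrict_of_ae (hs.ae_notMem volume)
    filter_upwards [ae_restrict_mem measurableSet_Ioo, h1] with z hz hz'
    exact abs_of_nonpos (h z ⟨hz, hz'⟩)
  have ha' : a ∈ Icc a b := left_mem_Icc.2 hab
  have hb' : b ∈ Icc a b := right_mem_Icc.2 hab
  rw [← intervalIntegral.integral_add_adjacent_intervals (hii a ha' u hu).abs
    (hii u hu b hb').abs, ← intervalIntegral.integral_add_adjacent_intervals (hii u hu w hw).abs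
    (hii w hw b hb').abs, hle a u hau h1, hle' u w huw h2, hle w b hwb h3,
    hint a ha' u hu hau, hint u hu w hw huw, hint w hw b hb' hwb, ha, hb]
  -- As `F` vanishes at both ends, the three pieces add up to `2 * (F u - F w)`.
  have := hC u hu w hw
  linarith

end RealAnalysis

/-! ### The sign pattern of the second derivative -/

/-- The second derivative of `pspline T (d + 2) j` away from the knots. -/
noncomputable def psplineDeriv₂ (T : ℤ → ℝ) (d : ℕ) (j : ℤ) (x : ℝ) : ℝ :=
  (d + 2) * (psplineDeriv T (d + 1) j x - psplineDeriv T (d + 1) (j + 1) x) /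
    (T (j + d + 3) - T j)

section SecondDerivative

variable {T : ℤ → ℝ}

theorem hasDerivAt_psplineDeriv (hT : Monotone T) (d : ℕ) (j : ℤ) {x : ℝ} (hx : x ∉ range T) :
    HasDerivAt (psplineDeriv T (d + 2) j) (psplineDeriv₂ T d j x) x := by
  have h := ((((hasDerivAt_pspline hT (d + 1) j hx).sub
    (hasDerivAt_pspline hT (d + 1) (j + 1) hx)).const_mul ((d : ℝ) + 1 + 1)).div_const
    (T (j + d + 3) - T j))
  have e : psplineDeriv T (d + 2) j = fun y => ((d : ℝ) + 1 + 1) *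
      (pspline T (d + 1) j y - pspline T (d + 1) (j + 1) y) / (T (j + d + 3) - T j) := by
    ext y
    rw [psplineDeriv]
    push_cast
    rw [show j + ((d : ℤ) + 1) + 2 = j + d + 3 by ring]
  rw [e]
  refine h.congr_deriv ?_
  rw [psplineDeriv₂]
  ring

/-- Obtained by differentiating `sub_right_mul_psplineDeriv`. -/
theorem sub_mul_psplineDeriv₂ (hT : Monotone T) (d : ℕ) (j : ℤ) {x : ℝ} (hx : x ∉ range T) :
    (T (j + d + 3) - x) * psplineDeriv₂ T d j x =
      (d + 2) * psplineDeriv T (d + 1) j x - (d + 1) * psplineDeriv T (d + 2) j x := by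
  have e : (fun y => (T (j + d + 3) - y) * psplineDeriv T (d + 2) j y) =
      fun y => ((d : ℝ) + 2) * (pspline T (d + 1) j y - pspline T (d + 2) j y) := by
    ext y
    have := sub_right_mul_psplineDeriv hT (d + 1) j y
    push_cast at this
    rw [show j + ((d : ℤ) + 1) + 2 = j + d + 3 by ring] at this
    rw [this]
    ring
  have h1 := ((hasDerivAt_id' x).const_sub (T (j + d + 3))).mul (hasDerivAt_psplineDeriv hT d j hx)
  have h2 := ((hasDerivAt_pspline hT (d + 1) j hx).sub
    (hasDerivAt_pspline hT (d + 2) j hx)).const_mul ((d : ℝ) + 2)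
  have h3 := h1.unique (h2.congr_of_eventuallyEq (Filter.Eventually.of_forall (congrFun e)))
  linarith

/-- A first-order linear equation with integrating factor a power of `T (j + d + 4) - x`; this is
what allows induction on the degree for signs. -/
theorem IsKnotSeq.hasDerivAt_psplineDeriv₂ {n : ℕ} (h : IsKnotSeq T n) (d : ℕ) (j : ℤ) {x : ℝ}
    (hx : x ∉ range T) :
    HasDerivAt (psplineDeriv₂ T (d + 1) j)
      (((d + 3) * psplineDeriv₂ T d j x - (d + 1) * psplineDeriv₂ T (d + 1) j x) /
        (T (j + d + 4) - x)) x := by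
  have hT := h.mono
  have hne : ∀ y, y ∉ range T → T (j + d + 4) - y ≠ 0 := fun y hy =>
    sub_ne_zero.2 fun h => hy ⟨_, h⟩
  have hid : ∀ y, y ∉ range T → (T (j + d + 4) - y) * psplineDeriv₂ T (d + 1) j y =
      (d + 3) * psplineDeriv T (d + 2) j y - (d + 2) * psplineDeriv T (d + 3) j y := by
    intro y hy
    have := sub_mul_psplineDeriv₂ hT (d + 1) j hy
    push_cast at this
    rw [show j + ((d : ℤ) + 1) + 3 = j + d + 4 by ring] at this
    rw [this]
    ring
  have h1 := ((hasDerivAt_psplineDeriv hT d j hx).const_mul ((d : ℝ) + 3)).sub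
    ((hasDerivAt_psplineDeriv hT (d + 1) j hx).const_mul ((d : ℝ) + 2))
  have h2 := h1.div ((hasDerivAt_id' x).const_sub (T (j + d + 4))) (hne x hx)
  refine (h2.congr_of_eventuallyEq ?_).congr_deriv ?_
  · filter_upwards [h.finite_range.isClosed.isOpen_compl.mem_nhds hx] with y hy
    simp only [Pi.div_apply]
    rw [eq_div_iff (hne y hy), mul_comm, hid y hy]
    rfl
  · have e := hid x hx
    have := hne x hx
    simp only [Pi.sub_apply]
    rw [← e]
    field_simp
    ring

theorem psplineDeriv₂_eq (T : ℤ → ℝ) (d : ℕ) (j : ℤ) (x : ℝ) :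
    psplineDeriv₂ T d j x = (d + 2) * (d + 1) / (T (j + d + 3) - T j) *
      ((pspline T d j x - pspline T d (j + 1) x) / (T (j + d + 2) - T j) -
       (pspline T d (j + 1) x - pspline T d (j + 2) x) / (T (j + d + 3) - T (j + 1))) := by
  rw [psplineDeriv₂, psplineDeriv, psplineDeriv, show j + 1 + 1 = j + 2 by ring,
    show j + 1 + (d : ℤ) + 2 = j + d + 3 by ring]
  ring

namespace IsKnotSeq

open MeasureTheory

variable {n : ℕ}

theorem integrableOn_psplineDeriv₂ (h : IsKnotSeq T n) (d : ℕ) (j : ℤ) :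
    IntegrableOn (psplineDeriv₂ T d j) (Icc (T 0) (T n)) := by
  have e : psplineDeriv₂ T d j = fun x => (d + 2) * (d + 1) / (T (j + d + 3) - T j) *
      ((pspline T d j x - pspline T d (j + 1) x) / (T (j + d + 2) - T j) -
       (pspline T d (j + 1) x - pspline T d (j + 2) x) / (T (j + d + 3) - T (j + 1))) := by
    ext x; exact psplineDeriv₂_eq T d j x
  rw [e]
  have hi := h.integrableOn_pspline d
  exact ((((hi _).sub (hi _)).div_const _).sub (((hi _).sub (hi _)).div_const _)).const_mul _

theorem continuousOn_psplineDeriv (h : IsKnotSeq T n) (d : ℕ) (j : ℤ) :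
    ContinuousOn (psplineDeriv T (d + 2) j) (Icc (T 0) (T n)) := by
  have hc := h.continuousOn_pspline d
  unfold psplineDeriv
  exact (((hc j).sub (hc (j + 1))).const_mul _).div_const _

theorem continuousOn_psplineDeriv₂ (h : IsKnotSeq T n) (d : ℕ) (j : ℤ) :
    ContinuousOn (psplineDeriv₂ T (d + 1) j) (Icc (T 0) (T n)) := by
  have hc := h.continuousOn_psplineDeriv d
  have e : psplineDeriv₂ T (d + 1) j = fun x => (((d + 1 : ℕ) : ℝ) + 2) *
      (psplineDeriv T (d + 2) j x - psplineDeriv T (d + 2) (j + 1) x) /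
    (T (j + (d + 1 : ℕ) + 3) - T j) := by ext x; rfl
  rw [e]
  exact (((hc j).sub (hc (j + 1))).const_mul _).div_const _

theorem psplineDeriv₂_eq_zero (h : IsKnotSeq T n) (d : ℕ) (j : ℤ) {x : ℝ}
    (hx : T (j + d + 3) < x) : psplineDeriv₂ T d j x = 0 := by
  have hT := h.mono
  have e : ∀ k : ℤ, k ≤ j + 2 → pspline T d k x = 0 := fun k hk =>
    pspline_eq_zero_of_notMem hT d k fun h1 =>
      absurd (h1.2.trans (hT (by omega : k + d + 1 ≤ j + d + 3))) (not_le.2 hx)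
  rw [psplineDeriv₂_eq, e j (by omega), e (j + 1) (by omega), e (j + 2) le_rfl]
  simp

/-- All knots but the last sit at the left end, so two of the three splines of degree `d` vanish;
the third has a nonnegative coefficient. -/
theorem psplineDeriv₂_nonneg (h : IsKnotSeq T n) (d : ℕ) {j : ℤ} (hj : j + d + 2 ≤ 0) (x : ℝ) :
    0 ≤ psplineDeriv₂ T d j x := by
  have hT := h.mono
  rw [psplineDeriv₂_eq, h.pspline_left_eq_zero d (j := j) (by omega),
    h.pspline_left_eq_zero d (j := j + 1) (by omega), sub_self, zero_div, zero_sub, zero_sub,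
    neg_div, neg_neg]
  have h1 := pspline_nonneg hT d (j + 2) x
  have h2 := sub_nonneg.2 (hT (by omega : j ≤ j + d + 3))
  have h3 := sub_nonneg.2 (hT (by omega : j + 1 ≤ j + d + 3))
  positivity

theorem psplineDeriv₂_left_nonneg (h : IsKnotSeq T n) (d : ℕ) {j : ℤ} (hj : -(d : ℤ) ≤ j) :
    0 ≤ psplineDeriv₂ T d j (T 0) := by
  have hT := h.mono
  have e1 : pspline T d (j + 1) (T 0) = 0 := by
    rw [pspline, h.bspline_left_end, if_neg (by omega), zero_div]
  have e2 : pspline T d (j + 2) (T 0) = 0 := by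
    rw [pspline, h.bspline_left_end, if_neg (by omega), zero_div]
  rw [psplineDeriv₂_eq, e1, e2, sub_self, zero_div, sub_zero, sub_zero]
  have h1 := pspline_nonneg hT d j (T 0)
  have h2 := sub_nonneg.2 (hT (by omega : j ≤ j + d + 3))
  have h3 := sub_nonneg.2 (hT (by omega : j ≤ j + d + 2))
  positivity

/-- In degree `0` the function is a step function with signs `+, -, +` on the three knot intervals;
the maxima with `T 0` discard intervals of length zero at the left end. -/
theorem posNegPos_psplineDeriv₂_zero (h : IsKnotSeq T n) (j : ℤ) (hj : T 0 < T (j + 3)) :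
    PosNegPos (psplineDeriv₂ T 0 j) (T 0) (T (j + 3)) := by
  have hT := h.mono
  have e0 : ∀ k x, x < T k → pspline T 0 k x = 0 := fun k x hx =>
    pspline_eq_zero_of_notMem hT 0 k fun h1 => absurd h1.1 (not_le.2 hx)
  have e1 : ∀ k x, T (k + 1) < x → pspline T 0 k x = 0 := fun k x hx =>
    pspline_eq_zero_of_notMem hT 0 k fun h1 => absurd h1.2 (by simpa using hx)
  have s1 := sub_nonneg.2 (hT (by omega : j ≤ j + 3))
  have s2 := sub_nonneg.2 (hT (by omega : j ≤ j + 2))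
  have s3 := sub_nonneg.2 (hT (by omega : j + 1 ≤ j + 3))
  have m1 : T (j + 1) ≤ T (j + 2) := hT (by omega)
  have m2 : T (j + 2) ≤ T (j + 3) := hT (by omega)
  refine ⟨max (T 0) (T (j + 1)), max (T 0) (T (j + 2)), ∅, countable_empty, le_max_left _ _,
    max_le_max le_rfl m1, max_le hj.le m2, ?_, ?_, ?_⟩
  · rintro x ⟨⟨hx0, hx⟩, -⟩
    have hx' : x < T (j + 1) := (lt_max_iff.1 hx).resolve_left (not_lt.2 hx0.le)
    rw [psplineDeriv₂_eq, e0 (j + 1) x hx', e0 (j + 2) x (hx'.trans_le m1)]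
    have := pspline_nonneg hT 0 j x
    simp only [Nat.cast_zero, add_zero, zero_add, sub_zero, zero_div]
    positivity
  · rintro x ⟨⟨hx0, hx⟩, -⟩
    have hx1 : T (j + 1) < x := (le_max_right _ _).trans_lt hx0
    have hx2 : x < T (j + 2) :=
      (lt_max_iff.1 hx).resolve_left (not_lt.2 ((le_max_left _ _).trans hx0.le))
    rw [psplineDeriv₂_eq, e1 j x hx1, e0 (j + 2) x hx2]
    have := pspline_nonneg hT 0 (j + 1) x
    simp only [Nat.cast_zero, add_zero, zero_add, sub_zero, zero_sub]
    apply mul_nonpos_of_nonneg_of_nonpos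
    · positivity
    · rw [neg_div]
      have h1 : 0 ≤ pspline T 0 (j + 1) x / (T (j + 2) - T j) := by positivity
      have h2 : 0 ≤ pspline T 0 (j + 1) x / (T (j + 3) - T (j + 1)) := by positivity
      linarith
  · rintro x ⟨⟨hx0, hx⟩, -⟩
    have hx2 : T (j + 2) < x := (le_max_right _ _).trans_lt hx0
    rw [psplineDeriv₂_eq, e1 j x (m1.trans_lt hx2), e1 (j + 1) x (by
      rw [show j + 1 + 1 = j + 2 by ring]; exact hx2)]
    have := pspline_nonneg hT 0 (j + 2) x
    simp only [Nat.cast_zero, add_zero, zero_add, sub_zero, zero_sub, zero_div, neg_div, neg_neg]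
    positivity

/-- Division by `(e - x) ^ (d + 1)`, with `e` the last knot, changes no sign, and the quotient is a
primitive of a positive multiple of the function of one degree lower. Thus raising the degree is an
integration, which keeps the pattern by `posNegPos_of_deriv`. -/
theorem posNegPos_psplineDeriv₂ (h : IsKnotSeq T n) (d : ℕ) (j : ℤ) (hj : T 0 < T (j + d + 3)) :
    PosNegPos (psplineDeriv₂ T d j) (T 0) (T (j + d + 3)) := by
  have hT := h.mono
  induction d with
  | zero => simpa using h.posNegPos_psplineDeriv₂_zero j (by simpa using hj)
  | succ d ih =>
    have ecast : j + ((d + 1 : ℕ) : ℤ) + 3 = j + d + 4 := by push_cast; ring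
    rw [ecast] at hj ⊢
    -- If the knots up to index `j + d + 3` all lie at the left end, the lower-degree function is
    -- supported at a point and the induction hypothesis is void, but everything is nonnegative.
    rcases le_or_gt (j + d + 3) 0 with hj0 | hj0
    · exact ⟨T (j + d + 4), T (j + d + 4), ∅, countable_empty, hj.le, le_rfl, le_rfl,
        fun x _ => h.psplineDeriv₂_nonneg (d + 1) (by push_cast; omega) x, by simp, by simp⟩
    have hj1 : T 0 < T (j + d + 3) := h.lt (by have := h.one_le; omega) hj0 hj0
    set e := T (j + d + 4) with he
    have hen : e ≤ T n := h.le_last _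
    set F : ℝ → ℝ := fun x => psplineDeriv₂ T (d + 1) j x / (e - x) ^ (d + 1) with hF
    set G : ℝ → ℝ := fun x => (d + 3) * psplineDeriv₂ T d j x / (e - x) ^ (d + 2) with hG
    have hFc : ContinuousOn F (Ico (T 0) e) := by
      apply ContinuousOn.div
      · exact (h.continuousOn_psplineDeriv₂ d j).mono fun x hx => ⟨hx.1, hx.2.le.trans hen⟩
      · fun_prop
      · intro x hx
        exact pow_ne_zero _ (sub_ne_zero.2 hx.2.ne')
    have hFd : ∀ x ∈ Ioo (T 0) e \ range T, HasDerivAt F (G x) x := by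
      intro x hx
      have hne : e - x ≠ 0 := sub_ne_zero.2 hx.1.2.ne'
      have h1 := (h.hasDerivAt_psplineDeriv₂ d j hx.2).div
        (((hasDerivAt_id' x).const_sub e).pow (d + 1)) (pow_ne_zero _ hne)
      refine h1.congr_deriv ?_
      simp only [hG, ← he, Nat.add_sub_cancel, Pi.pow_apply]
      push_cast
      field_simp
      ring
    have hGi : ∀ y ∈ Ico (T 0) e, IntervalIntegrable G volume (T 0) y := by
      intro y hy
      have h1 := (h.integrableOn_psplineDeriv₂ d j).mono_set (Icc_subset_Icc_right
        (hy.2.le.trans hen) : Icc (T 0) y ⊆ _)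
      have h2 : ContinuousOn (fun x => (d + 3) / (e - x) ^ (d + 2)) (Icc (T 0) y) := by
        apply ContinuousOn.div
        · fun_prop
        · fun_prop
        · intro x hx
          exact pow_ne_zero _ (sub_ne_zero.2 (hx.2.trans_lt hy.2).ne')
      have h3 := h1.mul_continuousOn h2 isCompact_Icc
      have h4 : G = fun x => psplineDeriv₂ T d j x * ((d + 3) / (e - x) ^ (d + 2)) := by
        ext x; simp only [hG]; ring
      rw [h4]
      exact intervalIntegrable_of_integrableOn h3 (left_mem_Icc.2 hy.1) (right_mem_Icc.2 hy.1)
    have hGs : ∀ x, x < e → 0 ≤ psplineDeriv₂ T d j x → 0 ≤ G x := by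
      intro x hx h1
      have := sub_pos.2 hx
      simp only [hG]
      positivity
    have hGs' : ∀ x, x < e → psplineDeriv₂ T d j x ≤ 0 → G x ≤ 0 := by
      intro x hx h1
      have := sub_pos.2 hx
      simp only [hG]
      apply div_nonpos_of_nonpos_of_nonneg
      · exact mul_nonpos_of_nonneg_of_nonpos (by positivity) h1
      · positivity
    have hpat : PosNegPos F (T 0) e := by
      -- For small `j` the starting value may be negative; then, however, the derivative is
      -- nonnegative throughout.
      rcases lt_or_ge j (-((d + 1 : ℕ) : ℤ)) with hj2 | hj2
      · apply posNegPos_of_deriv_nonneg hj.le h.finite_range.countable hFc hFd hGi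
        intro x hx
        exact hGs x hx.1.2 (h.psplineDeriv₂_nonneg d (by push_cast at hj2; omega) x)
      · apply posNegPos_of_deriv h.finite_range.countable hFc hFd hGi
        · obtain ⟨u, w, s, hs, h1, h2, h3, p1, p2, p3⟩ := ih hj1
          have hle : T (j + d + 3) ≤ e := hT (by omega)
          refine ⟨u, w, insert (T (j + d + 3)) s, hs.insert _, h1, h2, h3.trans hle, ?_, ?_, ?_⟩
          · rintro x ⟨hx, hx'⟩
            rw [mem_insert_iff, not_or] at hx'
            exact hGs x (hx.2.trans_le ((h2.trans h3).trans hle)) (p1 x ⟨hx, hx'.2⟩)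
          · rintro x ⟨hx, hx'⟩
            rw [mem_insert_iff, not_or] at hx'
            exact hGs' x (hx.2.trans_le (h3.trans hle)) (p2 x ⟨hx, hx'.2⟩)
          · rintro x ⟨hx, hx'⟩
            rw [mem_insert_iff, not_or] at hx'
            apply hGs x hx.2
            rcases lt_or_gt_of_ne hx'.1 with h4 | h4
            · exact p3 x ⟨⟨hx.1, h4⟩, hx'.2⟩
            · exact (h.psplineDeriv₂_eq_zero d j h4).ge
        · simp only [hF]
          apply div_nonneg (h.psplineDeriv₂_left_nonneg (d + 1) hj2)
          exact pow_nonneg (sub_nonneg.2 hj.le) _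
    obtain ⟨u, w, s, hs, h1, h2, h3, p1, p2, p3⟩ := hpat
    have hFs : ∀ x, x < e → psplineDeriv₂ T (d + 1) j x = F x * (e - x) ^ (d + 1) := by
      intro x hx
      have := sub_pos.2 hx
      simp only [hF]
      field_simp
    refine ⟨u, w, s, hs, h1, h2, h3, ?_, ?_, ?_⟩
    · intro x hx
      have hxe : x < e := hx.1.2.trans_le (h2.trans h3)
      rw [hFs x hxe]
      exact mul_nonneg (p1 x hx) (pow_nonneg (sub_nonneg.2 hxe.le) _)
    · intro x hx
      have hxe : x < e := hx.1.2.trans_le h3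
      rw [hFs x hxe]
      exact mul_nonpos_of_nonpos_of_nonneg (p2 x hx) (pow_nonneg (sub_nonneg.2 hxe.le) _)
    · intro x hx
      rw [hFs x hx.1.2]
      exact mul_nonneg (p3 x hx) (pow_nonneg (sub_nonneg.2 hx.1.2.le) _)

theorem le_of_le_off_knots (h : IsKnotSeq T n) {f : ℝ → ℝ}
    (hf : ContinuousOn f (Icc (T 0) (T n))) {c : ℝ}
    (hc : ∀ x ∈ Icc (T 0) (T n) \ range T, f x ≤ c) : ∀ x ∈ Icc (T 0) (T n), f x ≤ c := by
  have hdense : Dense ((range T)ᶜ) := h.finite_range.countable.dense_compl ℝ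
  intro x hx
  have hcl : x ∈ closure (Ioo (T 0) (T n) ∩ (range T)ᶜ) := by
    have h1 := hdense.open_subset_closure_inter (isOpen_Ioo (a := T 0) (b := T n))
    have h2 := closure_minimal h1 isClosed_closure
    rw [closure_Ioo h.zero_lt_last.ne] at h2
    exact h2 hx
  refine ContinuousWithinAt.closure_le hcl
    ((hf x hx).mono fun y hy => Ioo_subset_Icc_self hy.1) continuousWithinAt_const ?_
  intro y hy
  exact hc y ⟨Ioo_subset_Icc_self hy.1, hy.2⟩

/-- The total variation of the derivative of a B-spline that is continuously differentiable. -/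
theorem integral_abs_psplineDeriv₂_le (h : IsKnotSeq T n) (d : ℕ) {j : ℤ} (h1 : -(d : ℤ) ≤ j)
    (h2 : j + 2 < n) {C : ℝ}
    (hC : ∀ x ∈ Icc (T 0) (T n) \ range T, ∀ y ∈ Icc (T 0) (T n) \ range T,
      psplineDeriv T (d + 2) j x - psplineDeriv T (d + 2) j y ≤ C) :
    ∫ x in (T 0)..(T n), |psplineDeriv₂ T d j x| ≤ 2 * C := by
  have hT := h.mono
  have hc := h.continuousOn_psplineDeriv d j
  have hpos : 0 < j + d + 3 := by omega
  have hj : T 0 < T (j + d + 3) := h.lt (by have := h.one_le; omega) hpos hpos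
  have hpat : PosNegPos (psplineDeriv₂ T d j) (T 0) (T n) := by
    obtain ⟨u, w, s, hs, q1, q2, q3, p1, p2, p3⟩ := h.posNegPos_psplineDeriv₂ d j hj
    refine ⟨u, w, insert (T (j + d + 3)) s, hs.insert _, q1, q2, q3.trans (h.le_last _), ?_, ?_, ?_⟩
    · rintro x ⟨hx, hx'⟩
      rw [mem_insert_iff, not_or] at hx'
      exact p1 x ⟨hx, hx'.2⟩
    · rintro x ⟨hx, hx'⟩
      rw [mem_insert_iff, not_or] at hx'
      exact p2 x ⟨hx, hx'.2⟩
    · rintro x ⟨hx, hx'⟩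
      rw [mem_insert_iff, not_or] at hx'
      rcases lt_or_gt_of_ne hx'.1 with h4 | h4
      · exact p3 x ⟨⟨hx.1, h4⟩, hx'.2⟩
      · exact (h.psplineDeriv₂_eq_zero d j h4).ge
  refine integral_abs_le_of_posNegPos h.zero_lt_last.le h.finite_range.countable hc
    (fun x hx => hasDerivAt_psplineDeriv hT d j hx.2) (h.integrableOn_psplineDeriv₂ d j) hpat
    ?_ ?_ ?_
  -- The bounds on `j` limit the multiplicity of the end knots, so that neither spline of degree `d
  -- + 1` is the one that is nonzero at an end point.
  · rw [psplineDeriv, pspline, pspline, h.bspline_left_end, h.bspline_left_end,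
      if_neg (by push_cast; omega), if_neg (by push_cast; omega)]
    simp
  · rw [psplineDeriv, pspline, pspline, h.bspline_right_end, h.bspline_right_end,
      if_neg (by omega), if_neg (by omega)]
    simp
  · intro x hx y hy
    refine h.le_of_le_off_knots (f := fun x => psplineDeriv T (d + 2) j x -
      psplineDeriv T (d + 2) j y) (hc.sub continuousOn_const) (fun x hx => ?_) x hx
    have := h.le_of_le_off_knots (f := fun y => psplineDeriv T (d + 2) j x -
      psplineDeriv T (d + 2) j y) (continuousOn_const.sub hc) (fun y hy => hC x hx y hy) y hy
    exact this

end IsKnotSeq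

end SecondDerivative

/-! ### Lower bounds for products of squared distances -/

section ProductBounds

/-- Bernoulli's inequality `(1 + s) ^ p ≤ 1 + p s` with the exponents `3 ρ k / e`, which are at most
`1` and sum to `3`. -/
theorem one_add_pow_three_le_prod {ι : Type*} (s : Finset ι) {ρ : ι → ℝ} {e Y : ℝ} (hY : 0 < Y)
    (he : 0 < e) (h0 : ∀ k ∈ s, 0 ≤ ρ k) (h1 : ∀ k ∈ s, ρ k ≤ e / 3) (hs : ∑ k ∈ s, ρ k = e) :
    (1 + e / (3 * Y)) ^ 3 ≤ ∏ k ∈ s, (1 + ρ k / Y) := by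
  have hz : 0 < 1 + e / (3 * Y) := by positivity
  have hsum : ∑ k ∈ s, 3 * ρ k / e = ((3 : ℕ) : ℝ) := by
    rw [← Finset.sum_div, ← Finset.mul_sum, hs]
    field_simp
    norm_num
  rw [← Real.rpow_natCast, ← hsum, Real.rpow_sum_of_pos hz]
  refine Finset.prod_le_prod (fun k _ => Real.rpow_nonneg hz.le _) fun k hk => ?_
  have hp0 : 0 ≤ 3 * ρ k / e := div_nonneg (mul_nonneg (by norm_num) (h0 k hk)) he.le
  have hp1 : 3 * ρ k / e ≤ 1 := by
    rw [div_le_one he]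
    linarith [h1 k hk]
  have hB := rpow_one_add_le_one_add_mul_self (s := e / (3 * Y))
    (le_trans (by norm_num) (div_nonneg he.le (by positivity))) hp0 hp1
  refine hB.trans (le_of_eq ?_)
  field_simp

theorem pow_mul_add_le_prod_of_le_third {N : ℕ} {ρ : ℕ → ℝ} {A e Y : ℝ} (hY : 0 ≤ Y) (he : 0 < e)
    (h0 : ∀ k, 0 ≤ ρ k) (h1 : ∀ k ∈ Finset.range (N + 4), ρ k ≤ e / 3)
    (hs : ∑ k ∈ Finset.range (N + 4), ρ k = e) (hA0 : 0 ≤ A) (hA : A ≤ e / 3) :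
    Y ^ (N + 1) * (Y + A) ^ 3 ≤ ∏ k ∈ Finset.range (N + 4), (ρ k + Y) := by
  rcases hY.eq_or_lt with rfl | hY
  · rw [zero_pow (by simp), zero_mul]
    exact Finset.prod_nonneg fun k _ => add_nonneg (h0 k) le_rfl
  have hmul : ∏ k ∈ Finset.range (N + 4), (ρ k + Y) =
      Y ^ (N + 4) * ∏ k ∈ Finset.range (N + 4), (1 + ρ k / Y) := by
    conv_rhs => rw [← Finset.card_range (N + 4), ← Finset.prod_const, Finset.card_range,
      ← Finset.prod_mul_distrib]
    refine Finset.prod_congr rfl fun k _ => ?_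
    field_simp
    ring
  have h := one_add_pow_three_le_prod _ hY he (fun k _ => h0 k) h1 hs
  rw [hmul]
  calc Y ^ (N + 1) * (Y + A) ^ 3 ≤ Y ^ (N + 1) * (Y + e / 3) ^ 3 := by gcongr
    _ = Y ^ (N + 4) * (1 + e / (3 * Y)) ^ 3 := by
      field_simp
      ring
    _ ≤ _ := by gcongr

/-- Keeps the two highest powers of `Y` in the expanded product. -/
theorem pow_mul_add_sum_le_prod {ρ : ℕ → ℝ} {Y : ℝ} (hY : 0 ≤ Y) (h0 : ∀ k, 0 ≤ ρ k) (N : ℕ) :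
    Y ^ N * (Y + ∑ k ∈ Finset.range (N + 1), ρ k) ≤ ∏ k ∈ Finset.range (N + 1), (ρ k + Y) := by
  induction N with
  | zero => simp [add_comm]
  | succ N ih =>
    rw [Finset.sum_range_succ, Finset.prod_range_succ]
    have hs : 0 ≤ ∑ k ∈ Finset.range (N + 1), ρ k := Finset.sum_nonneg fun k _ => h0 k
    have := mul_le_mul_of_nonneg_right ih (add_nonneg (h0 (N + 1)) hY)
    refine le_trans ?_ this
    have h2 : 0 ≤ Y ^ N * ((∑ k ∈ Finset.range (N + 1), ρ k) * ρ (N + 1)) :=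
      mul_nonneg (pow_nonneg hY _) (mul_nonneg hs (h0 _))
    rw [pow_succ]
    nlinarith

/-- Coefficientwise comparison: by AM-GM the elementary symmetric functions of `a, a, b` dominate
those of `A, A, A` once the product does. The slack is a multiple of `(a - b) ^ 2`. -/
theorem add_pow_three_le {A a b Y : ℝ} (hY : 0 ≤ Y) (hA : 0 ≤ A) (ha : 0 < a) (hb : 0 ≤ b)
    (h : A ^ 3 ≤ a ^ 2 * b) : (Y + A) ^ 3 ≤ (Y + a) ^ 2 * (Y + b) := by
  have h1 : 3 * A ≤ 2 * a + b := by
    by_contra! hc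
    have : (2 * a + b) ^ 3 < (3 * A) ^ 3 := pow_lt_pow_left₀ hc (by positivity) (by norm_num)
    nlinarith [mul_nonneg (sq_nonneg (a - b)) (by positivity : 0 ≤ 8 * a + b)]
  have h2 : 3 * A ^ 2 ≤ a ^ 2 + 2 * (a * b) := by
    by_contra! hc
    have h3 : (a ^ 2 + 2 * (a * b)) ^ 3 < (3 * A ^ 2) ^ 3 :=
      pow_lt_pow_left₀ hc (by positivity) (by norm_num)
    have h4 : (A ^ 3) ^ 2 ≤ (a ^ 2 * b) ^ 2 := pow_le_pow_left₀ (by positivity) h 2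
    have h5 : 27 * (a ^ 2 * b) ^ 2 ≤ (a ^ 2 + 2 * (a * b)) ^ 3 := by
      have : (a ^ 2 + 2 * (a * b)) ^ 3 - 27 * (a ^ 2 * b) ^ 2 =
          a ^ 3 * ((a - b) ^ 2 * (a + 8 * b)) := by ring
      have h6 : 0 ≤ a ^ 3 * ((a - b) ^ 2 * (a + 8 * b)) := by positivity
      linarith
    nlinarith
  nlinarith [mul_nonneg hY (sub_nonneg.2 h2), mul_nonneg (sq_nonneg Y) (sub_nonneg.2 h1)]

/-- For two dominant distances: these are kept as factors and all others are merged into their sum,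
which plays the part of `b` in `add_pow_three_le`. -/
theorem pow_mul_add_le_prod_of_last {N : ℕ} {ρ : ℕ → ℝ} {A a Y : ℝ} (hY : 0 ≤ Y)
    (h0 : ∀ k, 0 ≤ ρ k) (ha : 0 < a) (h1 : ρ (N + 2) = a) (h2 : ρ (N + 3) = a) (hA0 : 0 ≤ A)
    (hA : A ^ 3 ≤ a ^ 2 * ∑ k ∈ Finset.range (N + 2), ρ k) :
    Y ^ (N + 1) * (Y + A) ^ 3 ≤ ∏ k ∈ Finset.range (N + 4), (ρ k + Y) := by
  rw [Finset.prod_range_succ, Finset.prod_range_succ, h1, h2]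
  have h3 := pow_mul_add_sum_le_prod hY h0 (N + 1)
  have h4 := add_pow_three_le hY hA0 ha (Finset.sum_nonneg fun k _ => h0 k) hA
  calc Y ^ (N + 1) * (Y + A) ^ 3
      ≤ Y ^ (N + 1) * ((Y + a) ^ 2 * (Y + ∑ k ∈ Finset.range (N + 2), ρ k)) := by gcongr
    _ = (Y ^ (N + 1) * (Y + ∑ k ∈ Finset.range (N + 2), ρ k)) * ((a + Y) * (a + Y)) := by ring
    _ ≤ (∏ k ∈ Finset.range (N + 2), (ρ k + Y)) * ((a + Y) * (a + Y)) := by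
      have : 0 ≤ (a + Y) * (a + Y) := by positivity
      exact mul_le_mul_of_nonneg_right h3 this
    _ = _ := by ring

end ProductBounds

/-! ### Numerical estimates: `m` interior knots in the unit interval with sum `p` and normalized
variance `N`; `D` sums the squared distances from `x` to all knots but the last two -/

section Numerics

variable {m N p x D : ℝ}

theorem lower_of_le_quarter (hm : 4 ≤ m) (hN : 1 ≤ N) (hp : 1 ≤ p) (hx0 : 0 ≤ x) (hx : x ≤ 1 / 4)
    (hD : D * m = (m - 1) * N + (p - m * x) ^ 2 - m * (1 - 2 * x)) :
    3 / 4 * (N - 1) + 4 * x ^ 2 ≤ D := by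
  have hm0 : 0 < m := by linarith
  refine le_of_mul_le_mul_right ?_ hm0
  rw [hD]
  -- In the first case `(p - m x) ^ 2 ≥ (1 - m x) ^ 2`, so `D m ≥ (m - 1) (N - 1) + m ^ 2 x ^ 2`. In
  -- the second `x m ≥ 1`, and the square can be dropped.
  rcases le_total (2 * x * m) (p + 1) with h | h
  · nlinarith [mul_nonneg (sub_nonneg.2 hp) (sub_nonneg.2 h),
      mul_nonneg (sub_nonneg.2 hN) (sub_nonneg.2 hm),
      mul_nonneg (mul_nonneg hm0.le (sub_nonneg.2 hm)) (sq_nonneg x)]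
  · have h1 : 1 ≤ x * m := by linarith
    have h2 : 4 * x ^ 2 ≤ x := by nlinarith
    nlinarith [sq_nonneg (p - m * x), mul_nonneg (sub_nonneg.2 hN) (sub_nonneg.2 hm),
      mul_nonneg hm0.le (sub_nonneg.2 h2)]

theorem lower_of_quarter_le (hm : 4 ≤ m) (hN : 1 ≤ N)
    (hD : D * m = (m - 1) * N + (p - m * x) ^ 2 - m * (1 - 2 * x)) :
    3 / 4 * (N - 1) + (2 * x - 1 / 4) ≤ D := by
  have hm0 : 0 < m := by linarith
  refine le_of_mul_le_mul_right ?_ hm0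
  rw [hD]
  nlinarith [sq_nonneg (p - m * x), mul_nonneg (sub_nonneg.2 hN) (sub_nonneg.2 hm)]

theorem le_third_of_half (hm : 4 ≤ m) (hNm : 4 * (m - 1) * N ≤ m ^ 2)
    (hD : D * m = (m - 1) * N + (p - m * x) ^ 2 - m * (1 - 2 * x)) :
    N + 1 / 10 ≤ D + 2 * (1 - x) ^ 2 := by
  have hm0 : 0 < m := by linarith
  -- From `m ^ 2 / (m - 1) = m + 1 + 1 / (m - 1)` and `m ≥ 4`.
  have h1 : 4 * N ≤ m + 4 / 3 := by
    refine le_of_mul_le_mul_right ?_ (by linarith : 0 < m - 1)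
    nlinarith
  refine le_of_mul_le_mul_right ?_ hm0
  nlinarith [sq_nonneg (p - m * x), mul_nonneg hm0.le (sq_nonneg (1 - 2 * x))]

/-- On each of a few ranges of `x`, constant or linear lower bounds `r` for `(1 - x) ^ 2` and `d`
for `D` suffice, while `D < (1 - x) ^ 2` bounds `N` and `x` from above. The constant `30.95` lies
just below `3.14 ^ 3`. -/
theorem cube_le_of_large (hm : 4 ≤ m) (hN : 11 / 10 ≤ N) (hp : 1 ≤ p) (hx0 : 0 ≤ x)
    (hx : x ≤ 1 / 2) (hD : D * m = (m - 1) * N + (p - m * x) ^ 2 - m * (1 - 2 * x))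
    (hDR : D < (1 - x) ^ 2) : (N / 3.14) ^ 3 ≤ ((1 - x) ^ 2) ^ 2 * D := by
  have key : ∀ r d : ℝ, 0 ≤ r → 0 ≤ d → r ≤ (1 - x) ^ 2 → d ≤ D → N ^ 3 ≤ 30.95 * r ^ 2 * d →
      (N / 3.14) ^ 3 ≤ ((1 - x) ^ 2) ^ 2 * D := by
    intro r d hr hd h1 h2 h3
    have h4 : r ^ 2 * d ≤ ((1 - x) ^ 2) ^ 2 * D := by gcongr
    have h5 : 0 ≤ r ^ 2 * d := by positivity
    rw [div_pow, div_le_iff₀ (by norm_num)]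
    norm_num
    nlinarith
  rcases le_total x (1 / 4) with hx4 | hx4
  · have hl := lower_of_le_quarter hm (by linarith) hp hx0 hx4 hD
    have hN2 : N ≤ 7 / 3 := by nlinarith
    rcases le_total x (1 / 8) with hx8 | hx8
    · refine key (49 / 64) (3 / 4 * (N - 1)) (by norm_num) (by linarith) (by nlinarith)
        (by nlinarith [sq_nonneg x]) ?_
      nlinarith [mul_nonneg (sub_nonneg.2 hN) (sub_nonneg.2 hN2)]
    · have hN3 : N ≤ 1.94 := by nlinarith
      refine key (9 / 16) (3 / 4 * (N - 1) + 1 / 16) (by norm_num) (by linarith) (by nlinarith)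
        (by nlinarith) ?_
      nlinarith [mul_nonneg (sub_nonneg.2 hN) (sub_nonneg.2 hN3)]
  · have hl := lower_of_quarter_le hm (by linarith) hD
    have hx3 : x ≤ 0.342 := by nlinarith
    have hN3 : N ≤ 1.42 := by nlinarith
    refine key (0.4329) (3 / 4 * (N - 1) + 1 / 4) (by norm_num) (by linarith) (by nlinarith)
        (by nlinarith) ?_
    nlinarith [mul_nonneg (sub_nonneg.2 hN) (sub_nonneg.2 hN3)]

/-- Here `2.826 = 0.9 * 3.14`, for a bound better by the factor `9 / 10`; `22.569` lies just below
`2.826 ^ 3`. -/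
theorem cube_le_of_small (hm : 4 ≤ m) (hN : 1 ≤ N) (hN2 : N ≤ 11 / 10) (hp : 1 ≤ p) (hx0 : 0 ≤ x)
    (hx : x ≤ 1 / 2) (hxp : 1 / 5 ≤ x ∨ m / 2 ≤ p)
    (hD : D * m = (m - 1) * N + (p - m * x) ^ 2 - m * (1 - 2 * x))
    (hDR : D < (1 - x) ^ 2) : (N / 2.826) ^ 3 ≤ ((1 - x) ^ 2) ^ 2 * D := by
  have key : ∀ r d : ℝ, 0 ≤ r → 0 ≤ d → r ≤ (1 - x) ^ 2 → d ≤ D → N ^ 3 ≤ 22.569 * r ^ 2 * d →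
      (N / 2.826) ^ 3 ≤ ((1 - x) ^ 2) ^ 2 * D := by
    intro r d hr hd h1 h2 h3
    have h4 : r ^ 2 * d ≤ ((1 - x) ^ 2) ^ 2 * D := by gcongr
    have h5 : 0 ≤ r ^ 2 * d := by positivity
    rw [div_pow, div_le_iff₀ (by norm_num)]
    norm_num
    nlinarith
  have hNN := mul_nonneg (sub_nonneg.2 hN) (sub_nonneg.2 hN2)
  rcases lt_or_ge x (1 / 5) with hx5 | hx5
  · have hp2 : m / 2 ≤ p := hxp.resolve_left (not_le.2 hx5)
    have hm0 : 0 < m := by linarith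
    have h1 : m * (1 / 2 - x) ≤ p - m * x := by nlinarith
    have h2 : (m * (1 / 2 - x)) ^ 2 ≤ (p - m * x) ^ 2 :=
      pow_le_pow_left₀ (mul_nonneg hm0.le (by linarith)) h1 2
    have h3 : 1 / 2 ≤ D := by
      refine le_of_mul_le_mul_right ?_ hm0
      have h4 : 0.09 ≤ (1 / 2 - x) ^ 2 := by nlinarith
      nlinarith [mul_nonneg (sub_nonneg.2 hN) (sub_nonneg.2 hm),
        mul_nonneg (mul_nonneg hm0.le (sub_nonneg.2 hm)) (sq_nonneg (1 / 2 - x)),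
        mul_nonneg hm0.le (mul_nonneg (sub_nonneg.2 hx5.le) (sub_nonneg.2 hx5.le))]
    exact key (16 / 25) (1 / 2) (by norm_num) (by norm_num) (by nlinarith) h3 (by nlinarith)
  rcases le_total x (1 / 4) with hx4 | hx4
  · have hl := lower_of_le_quarter hm (by linarith) hp hx0 hx4 hD
    refine key (9 / 16) (3 / 4 * (N - 1) + 4 / 25) (by norm_num) (by linarith) (by nlinarith)
        (by nlinarith) ?_
    nlinarith
  · have hl := lower_of_quarter_le hm (by linarith) hD
    have hx3 : x ≤ 0.342 := by nlinarith
    refine key (0.4329) (3 / 4 * (N - 1) + 1 / 4) (by norm_num) (by linarith) (by nlinarith)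
        (by nlinarith) ?_
    nlinarith

end Numerics

/-! ### The product bound for knots in the unit interval -/

section UnitKnots

variable {d : ℕ} {c : ℕ → ℝ} {N x A Y : ℝ}

theorem one_le_sum_interior (h0 : ∀ k, 0 ≤ c k) (hm : c (d + 2) = 1) :
    1 ≤ ∑ k ∈ Finset.range (d + 2), c (k + 1) := by
  rw [Finset.sum_range_succ, hm]
  linarith [Finset.sum_nonneg fun k (_ : k ∈ Finset.range (d + 1)) => h0 (k + 1)]

/-- Popoviciu's inequality: numbers in `[0, 1]` have variance at most `1 / 4`, because `c ^ 2 ≤ c`.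
-/
theorem interior_le_quarter (h0 : ∀ k, 0 ≤ c k) (h1 : ∀ k, c k ≤ 1)
    (hQ : ((d : ℝ) + 2) * ∑ k ∈ Finset.range (d + 2), c (k + 1) ^ 2 -
      (∑ k ∈ Finset.range (d + 2), c (k + 1)) ^ 2 = ((d : ℝ) + 1) * N) :
    4 * ((d : ℝ) + 2 - 1) * N ≤ ((d : ℝ) + 2) ^ 2 := by
  have h : ∑ k ∈ Finset.range (d + 2), c (k + 1) ^ 2 ≤ ∑ k ∈ Finset.range (d + 2), c (k + 1) :=
    Finset.sum_le_sum fun k _ => by nlinarith [h0 (k + 1), h1 (k + 1)]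
  have h2 := mul_le_mul_of_nonneg_left h (by positivity : (0 : ℝ) ≤ d + 2)
  nlinarith [sq_nonneg (((d : ℝ) + 2) - 2 * ∑ k ∈ Finset.range (d + 2), c (k + 1))]

/-- For `x ≤ 1 / 2` the last two knots, both `1`, are the farthest from `x`. If `D ≥ (1 - x) ^ 2`,
no squared distance exceeds a third of the sum and Bernoulli applies; otherwise the two farthest are
kept apart. -/
theorem pow_mul_add_le_prod_half (hd : 2 ≤ d) (h0 : ∀ k, 0 ≤ c k) (h1 : ∀ k, c k ≤ 1)
    (hc0 : c 0 = 0) (hcm : c (d + 2) = 1) (hcm' : c (d + 3) = 1)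
    (hQ : ((d : ℝ) + 2) * ∑ k ∈ Finset.range (d + 2), c (k + 1) ^ 2 -
      (∑ k ∈ Finset.range (d + 2), c (k + 1)) ^ 2 = ((d : ℝ) + 1) * N)
    (hN : 0 < N) (hx : x ≤ 1 / 2) (hA0 : 0 ≤ A) (hA : 3 * A ≤ N + 1 / 10)
    (hcube : ∀ D : ℝ, D * ((d : ℝ) + 2) = ((d : ℝ) + 2 - 1) * N +
      (∑ k ∈ Finset.range (d + 2), c (k + 1) - ((d : ℝ) + 2) * x) ^ 2 -
        ((d : ℝ) + 2) * (1 - 2 * x) → D < (1 - x) ^ 2 → A ^ 3 ≤ ((1 - x) ^ 2) ^ 2 * D)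
    (hY : 0 ≤ Y) :
    Y ^ (d + 1) * (Y + A) ^ 3 ≤ ∏ k ∈ Finset.range (d + 4), ((x - c k) ^ 2 + Y) := by
  have hd' : (2 : ℝ) ≤ d := by exact_mod_cast hd
  set p := ∑ k ∈ Finset.range (d + 2), c (k + 1) with hp
  set p' := ∑ k ∈ Finset.range (d + 2), c (k + 1) ^ 2 with hp'
  set D := ∑ k ∈ Finset.range (d + 2), (x - c k) ^ 2 with hDdef
  have hint : ∑ k ∈ Finset.range (d + 2), (x - c (k + 1)) ^ 2 =
      ((d : ℝ) + 2) * x ^ 2 - 2 * x * p + p' := by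
    simp only [hp, hp', sub_sq, Finset.sum_add_distrib, Finset.sum_sub_distrib, Finset.mul_sum]
    simp
  have hDint : D + (1 - x) ^ 2 = ((d : ℝ) + 2) * x ^ 2 - 2 * x * p + p' + x ^ 2 := by
    rw [← hint]
    have e1 := Finset.sum_range_succ (fun k => (x - c k) ^ 2) (d + 2)
    have e2 := Finset.sum_range_succ' (fun k => (x - c k) ^ 2) (d + 2)
    rw [e1] at e2
    rw [hcm, hc0] at e2
    linarith
  have hD : D * ((d : ℝ) + 2) = ((d : ℝ) + 2 - 1) * N + (p - ((d : ℝ) + 2) * x) ^ 2 -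
      ((d : ℝ) + 2) * (1 - 2 * x) := by
    have : D = ((d : ℝ) + 2) * x ^ 2 - 2 * x * p + p' + x ^ 2 - (1 - x) ^ 2 := by linarith
    rw [this]
    linear_combination hQ
  have he : ∑ k ∈ Finset.range (d + 4), (x - c k) ^ 2 = D + 2 * (1 - x) ^ 2 := by
    rw [Finset.sum_range_succ, Finset.sum_range_succ, hcm, hcm']
    ring
  have hthird := le_third_of_half (by linarith) (interior_le_quarter h0 h1 hQ) hD
  rcases le_or_gt ((1 - x) ^ 2) D with hR | hR
  · refine pow_mul_add_le_prod_of_le_third hY (by linarith) (fun k => sq_nonneg _) (fun k _ => ?_)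
      he hA0 (by linarith)
    have : (x - c k) ^ 2 ≤ (1 - x) ^ 2 :=
      sq_le_sq' (by linarith [h1 k]) (by linarith [h0 k])
    linarith
  · exact pow_mul_add_le_prod_of_last hY (fun k => sq_nonneg _) (by nlinarith : 0 < (1 - x) ^ 2)
      (by rw [hcm]; ring) (by rw [hcm']; ring) hA0 (hcube D hD hR)

theorem pow_mul_add_le_prod_unit (hd : 2 ≤ d) (h0 : ∀ k, 0 ≤ c k) (h1 : ∀ k, c k ≤ 1)
    (hc0 : c 0 = 0) (hc1 : c 1 = 0) (hcm : c (d + 2) = 1) (hcm' : c (d + 3) = 1)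
    (hQ : ((d : ℝ) + 2) * ∑ k ∈ Finset.range (d + 2), c (k + 1) ^ 2 -
      (∑ k ∈ Finset.range (d + 2), c (k + 1)) ^ 2 = ((d : ℝ) + 1) * N)
    (hN : 1 ≤ N) (hx0 : 0 ≤ x) (hx1 : x ≤ 1)
    (hA : (11 / 10 ≤ N ∧ A = N / 3.14) ∨ (N ≤ 11 / 10 ∧ A = N / 2.826 ∧
      (1 / 5 ≤ x ∨ ((d : ℝ) + 2) / 2 ≤ ∑ k ∈ Finset.range (d + 2), c (k + 1)) ∧
      (x ≤ 4 / 5 ∨ ∑ k ∈ Finset.range (d + 2), c (k + 1) ≤ ((d : ℝ) + 2) / 2)))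
    (hY : 0 ≤ Y) :
    Y ^ (d + 1) * (Y + A) ^ 3 ≤ ∏ k ∈ Finset.range (d + 4), ((x - c k) ^ 2 + Y) := by
  have hd' : (2 : ℝ) ≤ d := by exact_mod_cast hd
  have hA0 : 0 ≤ A := by
    rcases hA with ⟨-, rfl⟩ | ⟨-, rfl, -⟩ <;> positivity
  have hA3 : 3 * A ≤ N + 1 / 10 := by
    rcases hA with ⟨-, rfl⟩ | ⟨hN', rfl, -⟩
    · rw [mul_div_assoc', div_le_iff₀ (by norm_num)]
      linarith
    · rw [mul_div_assoc', div_le_iff₀ (by norm_num)]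
      linarith
  rcases le_total x (1 / 2) with hx | hx
  · refine pow_mul_add_le_prod_half hd h0 h1 hc0 hcm hcm' hQ (by linarith) hx hA0 hA3
      (fun D hD hDR => ?_) hY
    have hp := one_le_sum_interior h0 hcm
    rcases hA with ⟨hN', rfl⟩ | ⟨hN', rfl, hl, -⟩
    · exact cube_le_of_large (by linarith) hN' hp hx0 hx hD hDR
    · exact cube_le_of_small (by linarith) hN hN' hp hx0 hx hl hD hDR
  -- Reflection at `1 / 2` preserves the variance and reduces to the other half; `c 1 = 0` becomes
  -- the condition on the last interior knot.
  · set c' : ℕ → ℝ := fun k => 1 - c (d + 3 - k) with hc'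
    have hprod : ∏ k ∈ Finset.range (d + 4), ((x - c k) ^ 2 + Y) =
        ∏ k ∈ Finset.range (d + 4), ((1 - x - c' k) ^ 2 + Y) := by
      rw [← Finset.prod_range_reflect]
      refine Finset.prod_congr rfl fun k _ => ?_
      rw [hc', show d + 4 - 1 - k = d + 3 - k by omega]
      ring
    have hs : ∀ f : ℝ → ℝ, ∑ k ∈ Finset.range (d + 2), f (c' (k + 1)) =
        ∑ k ∈ Finset.range (d + 2), f (1 - c (k + 1)) := by
      intro f
      rw [← Finset.sum_range_reflect]
      refine Finset.sum_congr rfl fun k hk => ?_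
      rw [Finset.mem_range] at hk
      rw [hc']
      simp only
      rw [show d + 3 - (d + 2 - 1 - k + 1) = k + 1 by omega]
    have hs1 := hs fun y => y
    have hs2 := hs fun y => y ^ 2
    have hp1 : ∑ k ∈ Finset.range (d + 2), (1 - c (k + 1)) =
        (d : ℝ) + 2 - ∑ k ∈ Finset.range (d + 2), c (k + 1) := by
      simp
    have hp2 : ∑ k ∈ Finset.range (d + 2), (1 - c (k + 1)) ^ 2 =
        (d : ℝ) + 2 - 2 * ∑ k ∈ Finset.range (d + 2), c (k + 1) +
          ∑ k ∈ Finset.range (d + 2), c (k + 1) ^ 2 := by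
      simp only [sub_sq, Finset.sum_add_distrib, Finset.sum_sub_distrib, Finset.mul_sum]
      simp
    have hQ' : ((d : ℝ) + 2) * ∑ k ∈ Finset.range (d + 2), c' (k + 1) ^ 2 -
        (∑ k ∈ Finset.range (d + 2), c' (k + 1)) ^ 2 = ((d : ℝ) + 1) * N := by
      rw [hs1, hs2, hp1, hp2]
      linear_combination hQ
    have h0' : ∀ k, 0 ≤ c' k := fun k => sub_nonneg.2 (h1 _)
    have hcm1 : c' (d + 2) = 1 := by
      simp only [hc']
      rw [show d + 3 - (d + 2) = 1 by omega, hc1, sub_zero]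
    rw [hprod]
    refine pow_mul_add_le_prod_half hd h0' (fun k => sub_le_self _ (h0 _))
      (by simp [hc', hcm']) hcm1 (by simp [hc', hc0]) hQ' (by linarith)
      (by linarith) hA0 hA3 (fun D hD hDR => ?_) hY
    have hp := one_le_sum_interior h0' hcm1
    rcases hA with ⟨hN', rfl⟩ | ⟨hN', rfl, -, hl⟩
    · exact cube_le_of_large (by linarith) hN' hp (by linarith) (by linarith) hD hDR
    · refine cube_le_of_small (by linarith) hN hN' hp (by linarith) (by linarith) ?_ hD hDR
      rw [hs1, hp1]
      exact hl.imp (fun h => by linarith) fun h => by linarith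

end UnitKnots

/-! ### Pointwise bounds for the derivative -/

section DerivativeBound

/-- The nearest point of the unit interval. -/
noncomputable def unitClamp (y : ℝ) : ℝ := max 0 (min 1 y)

theorem unitClamp_nonneg (y : ℝ) : 0 ≤ unitClamp y := le_max_left _ _

theorem unitClamp_le_one (y : ℝ) : unitClamp y ≤ 1 :=
  max_le zero_le_one (min_le_left _ _)

theorem unitClamp_of_nonpos {y : ℝ} (hy : y ≤ 0) : unitClamp y = 0 :=
  max_eq_left ((min_le_right _ _).trans hy)

theorem unitClamp_of_one_le {y : ℝ} (hy : 1 ≤ y) : unitClamp y = 1 := by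
  rw [unitClamp, min_eq_left hy, max_eq_right zero_le_one]

theorem unitClamp_of_mem {y : ℝ} (h0 : 0 ≤ y) (h1 : y ≤ 1) : unitClamp y = y := by
  rw [unitClamp, min_eq_right h1, max_eq_right h0]

/-- Clamping is a contraction, so moving `x` and the two outer knots into the span of the interior
knots can only decrease the product, and a bound for unit knots suffices. -/
theorem sq_unitClamp_sub_le (y z : ℝ) : (unitClamp y - unitClamp z) ^ 2 ≤ (y - z) ^ 2 := by
  rw [sq_le_sq]
  have h1 : |unitClamp y - unitClamp z| ≤ |min 1 y - min 1 z| := by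
    simpa [unitClamp] using abs_max_sub_max_le_max 0 (min 1 y) 0 (min 1 z)
  exact h1.trans (by simpa using abs_min_sub_min_le_max 1 y 1 z)

theorem knotSum_eq_sum_add (T : ℤ → ℝ) (d : ℕ) (j : ℤ) :
    knotSum T d (j + d) = ∑ k ∈ Finset.range d, T (j + (k + 1 : ℕ)) := by
  rw [knotSum, ← Finset.sum_range_reflect]
  refine Finset.sum_congr rfl fun k hk => ?_
  rw [Finset.mem_range] at hk
  congr 1
  omega

theorem knotSqSum_eq_sum_add (T : ℤ → ℝ) (d : ℕ) (j : ℤ) :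
    knotSqSum T d (j + d) = ∑ k ∈ Finset.range d, T (j + (k + 1 : ℕ)) ^ 2 :=
  knotSum_eq_sum_add (fun k => T k ^ 2) d j

variable {T : ℤ → ℝ} {d : ℕ} {j : ℤ} {L : ℝ}

theorem abs_psplineDeriv_le_of_unit (hT : Monotone T) (hL : 0 < L) (hS : T j < T (j + d + 3))
    {x A : ℝ} (hx : x ∉ range T) (hA : 0 < A)
    (h : ∀ Y : ℝ, 0 ≤ Y → Y ^ (d + 1) * (Y + A) ^ 3 ≤ ∏ k ∈ Finset.range (d + 4),
      ((unitClamp ((x - T (j + 1)) / L) - unitClamp ((T (j + k) - T (j + 1)) / L)) ^ 2 + Y)) :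
    |psplineDeriv T (d + 2) j x| ≤ (d + 2) / (Real.pi * (L ^ 2 * A)) := by
  have h3 : j + ((d + 1 : ℕ) : ℤ) + 2 = j + d + 3 := by push_cast; ring
  have := abs_psplineDeriv_le_of_prod hT (d := d + 1) (j := j) (x := x) (A := L ^ 2 * A) hx
    (by rw [h3]; exact hS) (by positivity) ?_
  · refine this.trans (le_of_eq ?_)
    push_cast
    ring
  intro y
  have hy := h ((y / L) ^ 2) (sq_nonneg _)
  have e1 : (y ^ 2) ^ (d + 1) * (y ^ 2 + L ^ 2 * A) ^ 3 =
      (L ^ 2) ^ (d + 4) * (((y / L) ^ 2) ^ (d + 1) * ((y / L) ^ 2 + A) ^ 3) := by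
    have : y ^ 2 = L ^ 2 * (y / L) ^ 2 := by field_simp
    rw [this, mul_pow, ← mul_add, mul_pow]
    ring
  rw [e1]
  refine (mul_le_mul_of_nonneg_left hy (by positivity)).trans ?_
  conv_lhs => rw [← Finset.card_range (d + 4), ← Finset.prod_const, Finset.card_range,
    ← Finset.prod_mul_distrib]
  refine Finset.prod_le_prod (fun k _ => by positivity) fun k _ => ?_
  have h4 := sq_unitClamp_sub_le ((x - T (j + 1)) / L) ((T (j + k) - T (j + 1)) / L)
  have h5 : L ^ 2 * ((x - T (j + 1)) / L - (T (j + k) - T (j + 1)) / L) ^ 2 =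
      (x - T (j + k)) ^ 2 := by
    field_simp
    ring
  have h6 : L ^ 2 * (y / L) ^ 2 = y ^ 2 := by field_simp
  nlinarith [mul_le_mul_of_nonneg_left h4 (sq_nonneg L)]

theorem IsKnotSeq.pspline_le_one_div {n : ℕ} (hT : IsKnotSeq T n) {x : ℝ}
    (hx : x ∈ Icc (T 0) (T n)) (hL : 0 < L) (hlen : L ≤ T (j + d + 1) - T j) :
    pspline T d j x ≤ 1 / L := by
  rw [pspline]
  have h1 := hT.bspline_le_one d j hx
  have h0 := bspline_nonneg hT.mono d j x
  gcongr

/-- The derivative is `d + 2` times a difference of two numbers in `[0, 1 / L]`, divided by a length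
that is at least `L`. -/
theorem IsKnotSeq.abs_psplineDeriv_le {n : ℕ} (hT : IsKnotSeq T n) (hL : 0 < L)
    (hLT : L = T (j + d + 2) - T (j + 1)) {x : ℝ} (hx : x ∈ Icc (T 0) (T n)) :
    |psplineDeriv T (d + 2) j x| ≤ (d + 2) / L ^ 2 := by
  have m1 : T j ≤ T (j + 1) := hT.mono (by omega)
  have m2 : T (j + d + 2) ≤ T (j + d + 3) := hT.mono (by omega)
  have p1 : pspline T (d + 1) j x ≤ 1 / L := by
    refine hT.pspline_le_one_div hx hL ?_
    rw [show j + ((d + 1 : ℕ) : ℤ) + 1 = j + d + 2 by push_cast; ring]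
    linarith
  have p2 : pspline T (d + 1) (j + 1) x ≤ 1 / L := by
    refine hT.pspline_le_one_div hx hL ?_
    rw [show j + 1 + ((d + 1 : ℕ) : ℤ) + 1 = j + d + 3 by push_cast; ring]
    linarith
  have q1 := pspline_nonneg hT.mono (d + 1) j x
  have q2 := pspline_nonneg hT.mono (d + 1) (j + 1) x
  rw [psplineDeriv, show j + ((d + 1 : ℕ) : ℤ) + 2 = j + d + 3 by push_cast; ring, abs_div,
    abs_mul, abs_of_pos (by linarith : 0 < T (j + d + 3) - T j)]
  have ha : |pspline T (d + 1) j x - pspline T (d + 1) (j + 1) x| ≤ 1 / L := by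
    rw [abs_le]
    constructor <;> linarith
  have hb : |((d + 1 : ℕ) : ℝ) + 1| = d + 2 := by
    rw [abs_of_nonneg (by positivity)]
    push_cast
    ring
  rw [hb]
  calc ((d : ℝ) + 2) * |pspline T (d + 1) j x - pspline T (d + 1) (j + 1) x| /
        (T (j + d + 3) - T j) ≤ ((d : ℝ) + 2) * (1 / L) / L := by
        gcongr
        linarith
    _ = _ := by field_simp

/-- The last two knots lie at distance at least `R` from `x`, so two factors of the product are at
least `y ^ 2 + R ^ 2`. -/
theorem pspline_le_of_dist_right (hT : Monotone T) {x R : ℝ} (hx : x ∉ range T) (hR : 0 < R)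
    (h : R ≤ T (j + d) - x) : pspline T d j x ≤ 1 / (2 * R) := by
  refine pspline_le_of_prod hT hx hR fun y => ?_
  rw [Finset.prod_range_succ, Finset.prod_range_succ]
  have h1 : (y ^ 2) ^ d ≤ ∏ k ∈ Finset.range d, ((x - T (j + k)) ^ 2 + y ^ 2) := by
    conv_lhs => rw [← Finset.card_range d, ← Finset.prod_const]
    exact Finset.prod_le_prod (fun k _ => sq_nonneg y) fun k _ => by nlinarith [sq_nonneg (x - T (j + k))]
  have h2 : R ^ 2 ≤ (x - T (j + d)) ^ 2 := by nlinarith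
  have h3 : R ^ 2 ≤ (x - T (j + (d + 1 : ℕ))) ^ 2 := by
    have : T (j + d) ≤ T (j + (d + 1 : ℕ)) := hT (by push_cast; omega)
    nlinarith
  have h4 : 0 ≤ ∏ k ∈ Finset.range d, ((x - T (j + k)) ^ 2 + y ^ 2) :=
    Finset.prod_nonneg fun k _ => by positivity
  rw [pow_two (y ^ 2 + R ^ 2), ← mul_assoc]
  gcongr ?_ * ?_ * ?_
  · linarith
  · linarith

theorem pspline_le_of_dist_left (hT : Monotone T) {x R : ℝ} (hx : x ∉ range T) (hR : 0 < R)
    (h : R ≤ x - T (j + 1)) : pspline T d j x ≤ 1 / (2 * R) := by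
  refine pspline_le_of_prod hT hx hR fun y => ?_
  rw [Finset.prod_range_succ', Finset.prod_range_succ']
  have h1 : (y ^ 2) ^ d ≤ ∏ k ∈ Finset.range d, ((x - T (j + (k + 1 + 1 : ℕ))) ^ 2 + y ^ 2) := by
    conv_lhs => rw [← Finset.card_range d, ← Finset.prod_const]
    exact Finset.prod_le_prod (fun k _ => sq_nonneg y) fun k _ => by
      nlinarith [sq_nonneg (x - T (j + (k + 1 + 1 : ℕ)))]
  have h2 : R ^ 2 ≤ (x - T (j + (0 + 1 : ℕ))) ^ 2 := by
    push_cast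
    nlinarith
  have h3 : R ^ 2 ≤ (x - T (j + (0 : ℕ))) ^ 2 := by
    have : T (j + (0 : ℕ)) ≤ T (j + 1) := hT (by push_cast; omega)
    nlinarith
  have h4 : 0 ≤ ∏ k ∈ Finset.range d, ((x - T (j + (k + 1 + 1 : ℕ))) ^ 2 + y ^ 2) :=
    Finset.prod_nonneg fun k _ => by positivity
  rw [pow_two (y ^ 2 + R ^ 2), ← mul_assoc]
  gcongr ?_ * ?_ * ?_
  · linarith
  · linarith

/-- In `sub_right_mul_psplineDeriv` the spline of lower degree is nonnegative and can be dropped;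
the other one is at most `1 / (2 R)`. -/
theorem neg_psplineDeriv_le (hT : Monotone T) {x R : ℝ} (hx : x ∉ range T) (hR : 0 < R)
    (h : R ≤ T (j + d + 2) - x) : -psplineDeriv T (d + 2) j x ≤ (d + 2) / (2 * R ^ 2) := by
  have h1 := sub_right_mul_psplineDeriv hT (d + 1) j x
  rw [show j + ((d + 1 : ℕ) : ℤ) + 2 = j + d + 3 by push_cast; ring] at h1
  have h2 : T (j + d + 2) ≤ T (j + d + 3) := hT (by omega)
  have h3 := pspline_le_of_dist_right hT (d := d + 2) (j := j) hx hR
    (by rw [show j + ((d + 2 : ℕ) : ℤ) = j + d + 2 by push_cast; ring]; exact h)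
  have h4 := pspline_nonneg hT (d + 1) j x
  rcases le_or_gt 0 (psplineDeriv T (d + 2) j x) with h5 | h5
  · exact (neg_nonpos.2 h5).trans (by positivity)
  rw [le_div_iff₀ (by positivity)]
  have h6 : 2 * R * pspline T (d + 2) j x ≤ 1 := by
    rw [le_div_iff₀ (by positivity)] at h3
    linarith
  push_cast at h1
  have h7 : -psplineDeriv T (d + 2) j x * R ≤ (d + 2) * pspline T (d + 2) j x := by
    have h8 : 0 ≤ (d + 2 : ℝ) * pspline T (d + 1) j x := mul_nonneg (by positivity) h4
    nlinarith [mul_le_mul_of_nonneg_left (h.trans (sub_le_sub_right h2 x)) (neg_nonneg.2 h5.le)]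
  have h9 : (0 : ℝ) ≤ d + 2 := by positivity
  nlinarith [mul_le_mul_of_nonneg_left h6 h9, mul_le_mul_of_nonneg_left h7 hR.le]

theorem psplineDeriv_le (hT : Monotone T) {x R : ℝ} (hx : x ∉ range T) (hR : 0 < R)
    (h : R ≤ x - T (j + 1)) : psplineDeriv T (d + 2) j x ≤ (d + 2) / (2 * R ^ 2) := by
  have h1 := sub_left_mul_psplineDeriv hT (d + 1) j x
  have h2 : T j ≤ T (j + 1) := hT (by omega)
  have h3 := pspline_le_of_dist_left hT (d := d + 2) (j := j) hx hR h
  have h4 := pspline_nonneg hT (d + 1) (j + 1) x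
  rcases le_or_gt (psplineDeriv T (d + 2) j x) 0 with h5 | h5
  · exact h5.trans (by positivity)
  rw [le_div_iff₀ (by positivity)]
  have h6 : 2 * R * pspline T (d + 2) j x ≤ 1 := by
    rw [le_div_iff₀ (by positivity)] at h3
    linarith
  push_cast at h1
  have h7 : psplineDeriv T (d + 2) j x * R ≤ (d + 2) * pspline T (d + 2) j x := by
    have h8 : 0 ≤ (d + 2 : ℝ) * pspline T (d + 1) (j + 1) x := mul_nonneg (by positivity) h4
    nlinarith [mul_le_mul_of_nonneg_left (h.trans (sub_le_sub_left h2 x)) h5.le]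
  have h9 : (0 : ℝ) ≤ d + 2 := by positivity
  nlinarith [mul_le_mul_of_nonneg_left h6 h9, mul_le_mul_of_nonneg_left h7 hR.le]

end DerivativeBound

/-! ### The oscillation of the derivative -/

section Variation

variable {T : ℤ → ℝ} {d : ℕ} {j : ℤ} {L : ℝ}

theorem sum_unitClamp_eq (hT : Monotone T) (hL : 0 < L) (hLT : L = T (j + d + 2) - T (j + 1))
    (f : ℝ → ℝ) : ∑ k ∈ Finset.range (d + 2), f (unitClamp ((T (j + (k + 1 : ℕ)) - T (j + 1)) / L)) =
      ∑ k ∈ Finset.range (d + 2), f ((T (j + (k + 1 : ℕ)) - T (j + 1)) / L) := by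
  refine Finset.sum_congr rfl fun k hk => ?_
  rw [Finset.mem_range] at hk
  have h1 : T (j + 1) ≤ T (j + (k + 1 : ℕ)) := hT (by push_cast; omega)
  have h2 : T (j + (k + 1 : ℕ)) ≤ T (j + d + 2) := hT (by push_cast; omega)
  rw [unitClamp_of_mem (div_nonneg (by linarith) hL.le) (by rw [div_le_one hL]; linarith)]

/-- Let `M` be half of the claimed bound. If `N ≥ 11 / 10`, then `|psplineDeriv| ≤ M` off the knots.
For `N` near `1` the product estimate is unavailable in some end positions, and the crude bound `11
/ 10 * M` at one point is balanced by `9 / 10 * M` at the other. -/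
theorem IsKnotSeq.psplineDeriv_sub_le {n : ℕ} (hT : IsKnotSeq T n) (d : ℕ) (j : ℤ)
    (hL : T (j + 1) < T (j + d + 2)) (hd : 2 ≤ d)
    (hQ : (d + 1) * (T (j + d + 2) - T (j + 1)) ^ 2 <
      (d + 2) * knotSqSum T (d + 2) (j + d + 2) - knotSum T (d + 2) (j + d + 2) ^ 2)
    {u w : ℝ} (hu : u ∈ Icc (T 0) (T n) \ range T) (hw : w ∈ Icc (T 0) (T n) \ range T) :
    psplineDeriv T (d + 2) j u - psplineDeriv T (d + 2) j w ≤ 2 * ((d + 2) * (d + 1) /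
      ((d + 2) * knotSqSum T (d + 2) (j + d + 2) - knotSum T (d + 2) (j + d + 2) ^ 2)) := by
  have hm := hT.mono
  obtain ⟨L, hLT⟩ : ∃ L, L = T (j + d + 2) - T (j + 1) := ⟨_, rfl⟩
  have hL0 : 0 < L := by linarith
  rw [← hLT] at hQ
  have hidx : j + (d : ℤ) + 2 = j + ((d + 2 : ℕ) : ℤ) := by push_cast; ring
  set Q : ℝ := (d + 2) * knotSqSum T (d + 2) (j + d + 2) - knotSum T (d + 2) (j + d + 2) ^ 2
    with hQdef
  obtain ⟨N, hN⟩ : ∃ N, Q = (d + 1) * L ^ 2 * N := ⟨Q / ((d + 1) * L ^ 2), by field_simp⟩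
  have hN1 : 1 ≤ N := by
    by_contra! hc
    have : (0 : ℝ) < (d + 1) * L ^ 2 := by positivity
    nlinarith
  set c : ℕ → ℝ := fun k => unitClamp ((T (j + k) - T (j + 1)) / L) with hc
  set X : ℝ → ℝ := fun x => unitClamp ((x - T (j + 1)) / L) with hX
  set p := ∑ k ∈ Finset.range (d + 2), c (k + 1) with hp
  have hQc : ((d : ℝ) + 2) * ∑ k ∈ Finset.range (d + 2), c (k + 1) ^ 2 - p ^ 2 =
      ((d : ℝ) + 1) * N := by
    have s1 := sum_unitClamp_eq hm hL0 hLT fun y => y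
    have s2 := sum_unitClamp_eq hm hL0 hLT fun y => y ^ 2
    simp only [hp, hc]
    rw [s1, s2]
    simp only [div_pow, sub_sq, ← Finset.sum_div, Finset.sum_add_distrib, Finset.sum_sub_distrib,
      ← Finset.mul_sum, ← Finset.sum_mul]
    rw [hidx, knotSum_eq_sum_add, knotSqSum_eq_sum_add] at hQdef
    rw [hQdef] at hN
    simp only [Finset.sum_const, Finset.card_range, nsmul_eq_mul]
    push_cast at hN ⊢
    field_simp
    linear_combination hN
  have hS : T j < T (j + d + 3) :=
    (hm (by omega : j ≤ j + 1)).trans_lt (hL.trans_le (hm (by omega)))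
  have hmain : ∀ x, x ∉ range T → ∀ A : ℝ, (11 / 10 ≤ N ∧ A = N / 3.14) ∨
      (N ≤ 11 / 10 ∧ A = N / 2.826 ∧ (1 / 5 ≤ X x ∨ ((d : ℝ) + 2) / 2 ≤ p) ∧
        (X x ≤ 4 / 5 ∨ p ≤ ((d : ℝ) + 2) / 2)) →
      |psplineDeriv T (d + 2) j x| ≤ (d + 2) / (Real.pi * (L ^ 2 * A)) := by
    intro x hx A hA
    have hA0 : 0 < A := by
      rcases hA with ⟨-, rfl⟩ | ⟨-, rfl, -⟩ <;> positivity
    refine abs_psplineDeriv_le_of_unit hm hL0 hS hx hA0 fun Y hY => ?_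
    refine pow_mul_add_le_prod_unit (c := c) hd (fun k => unitClamp_nonneg _)
      (fun k => unitClamp_le_one _) ?_ ?_ ?_ ?_ hQc hN1 (unitClamp_nonneg _) (unitClamp_le_one _) hA hY
    · refine unitClamp_of_nonpos (div_nonpos_of_nonpos_of_nonneg ?_ hL0.le)
      have : T (j + (0 : ℕ)) ≤ T (j + 1) := hm (by push_cast; omega)
      linarith
    · simp [hc, unitClamp]
    · refine unitClamp_of_one_le ?_
      rw [one_le_div hL0, ← hidx, hLT]
    · refine unitClamp_of_one_le ?_
      have : T (j + d + 2) ≤ T (j + (d + 3 : ℕ)) := hm (by push_cast; omega)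
      rw [one_le_div hL0]
      linarith
  have hpi := Real.pi_gt_d2
  set M := ((d : ℝ) + 2) * (d + 1) / Q with hM
  have hMN : (d + 2) / L ^ 2 = M * N := by
    rw [hM, hN]
    field_simp
  have hM0 : 0 < M := by
    rw [hM, hN]
    positivity
  have hbig : ∀ κ : ℝ, 0 < κ →
      (d + 2) / (Real.pi * (L ^ 2 * (N / (3.14 * κ)))) ≤ M * κ := by
    intro κ hκ
    have : (d + 2) / (Real.pi * (L ^ 2 * (N / (3.14 * κ)))) = M * κ * (3.14 / Real.pi) := by
      rw [hM, hN]
      field_simp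
    rw [this]
    refine mul_le_of_le_one_right (by positivity) ?_
    rw [div_le_one Real.pi_pos]
    exact hpi.le
  rcases le_total (11 / 10) N with hN' | hN'
  · have hone : ∀ x, x ∉ range T → |psplineDeriv T (d + 2) j x| ≤ M := fun x hx =>
      (hmain x hx (N / 3.14) (Or.inl ⟨hN', rfl⟩)).trans (by simpa using hbig 1 one_pos)
    have h1 := abs_le.1 (hone u hu.2)
    have h2 := abs_le.1 (hone w hw.2)
    linarith
  have hcoarse : ∀ x ∈ Icc (T 0) (T n) \ range T, |psplineDeriv T (d + 2) j x| ≤ M * (11 / 10) :=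
    fun x hx => (hT.abs_psplineDeriv_le hL0 hLT hx.1).trans (by rw [hMN]; gcongr)
  have hfine : ∀ x ∈ Icc (T 0) (T n) \ range T, (1 / 5 ≤ X x ∨ ((d : ℝ) + 2) / 2 ≤ p) →
      (X x ≤ 4 / 5 ∨ p ≤ ((d : ℝ) + 2) / 2) → |psplineDeriv T (d + 2) j x| ≤ M * (9 / 10) := by
    intro x hx h1 h2
    refine (hmain x hx.2 (N / 2.826) (Or.inr ⟨hN', rfl, h1, h2⟩)).trans ?_
    have := hbig (9 / 10) (by norm_num)
    norm_num at this ⊢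
    exact this
  -- Uses `25 / 32 * 11 / 10 < 9 / 10`.
  have hclamp : (d + 2 : ℝ) / (2 * (4 / 5 * L) ^ 2) ≤ M * (9 / 10) := by
    have : (d + 2 : ℝ) / (2 * (4 / 5 * L) ^ 2) = (d + 2) / L ^ 2 * (25 / 32) := by
      field_simp
      norm_num
    rw [this, hMN]
    nlinarith
  have hneg : ∀ x ∈ Icc (T 0) (T n) \ range T, X x ≤ 4 / 5 →
      -psplineDeriv T (d + 2) j x ≤ M * (9 / 10) := by
    intro x hx h
    rcases le_or_gt (1 / 5) (X x) with h1 | h1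
    · exact (neg_le_abs _).trans (hfine x hx (Or.inl h1) (Or.inl h))
    · refine (neg_psplineDeriv_le hm hx.2 (R := 4 / 5 * L) (by positivity) ?_).trans hclamp
      have h2 : (x - T (j + 1)) / L < 1 / 5 := by
        by_contra! hc'
        rcases le_total ((x - T (j + 1)) / L) 1 with h3 | h3
        · have := unitClamp_of_mem (by linarith) h3
          simp only [hX] at h1
          linarith
        · have := unitClamp_of_one_le h3
          simp only [hX] at h1
          linarith
      rw [div_lt_iff₀ hL0] at h2
      linarith
  have hpos : ∀ x ∈ Icc (T 0) (T n) \ range T, 1 / 5 ≤ X x →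
      psplineDeriv T (d + 2) j x ≤ M * (9 / 10) := by
    intro x hx h
    rcases le_or_gt (X x) (4 / 5) with h1 | h1
    · exact (le_abs_self _).trans (hfine x hx (Or.inl h) (Or.inl h1))
    · refine (psplineDeriv_le hm hx.2 (R := 4 / 5 * L) (by positivity) ?_).trans hclamp
      have h2 : 4 / 5 < (x - T (j + 1)) / L := by
        by_contra! hc'
        rcases le_total 0 ((x - T (j + 1)) / L) with h3 | h3
        · have := unitClamp_of_mem h3 (by linarith)
          simp only [hX] at h1
          linarith
        · have := unitClamp_of_nonpos h3
          simp only [hX] at h1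
          linarith
      rw [lt_div_iff₀ hL0] at h2
      linarith
  have hu1 := abs_le.1 (hcoarse u hu)
  have hw1 := abs_le.1 (hcoarse w hw)
  -- Only `u` near the left end with `w` near the right end escapes the one-sided bounds. Then the
  -- mean of the knots lies in one half, and the point near the opposite end satisfies the product
  -- estimate.
  rcases le_or_gt (X w) (4 / 5) with h1 | h1
  · linarith [hneg w hw h1]
  rcases le_or_gt (1 / 5) (X u) with h2 | h2
  · linarith [hpos u hu h2]
  rcases le_total p (((d : ℝ) + 2) / 2) with h3 | h3
  · have := abs_le.1 (hfine w hw (Or.inl (by linarith)) (Or.inr h3))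
    linarith
  · have := abs_le.1 (hfine u hu (Or.inr h3) (Or.inl (by linarith)))
    linarith

end Variation

/-! ### The functionals on `1`, `x` and `x ^ 2` -/

section Functionals

variable {n : ℕ} {t : Fin (n + 1) → ℝ}

theorem mu_zero (hn : 1 ≤ n) (ht : StrictMono t) {m : ℕ} (hm : 1 ≤ m) (f : ℝ → ℝ) :
    mu m t 0 f = f (t 0) := by
  have h := knot_isKnotSeq hn ht
  rw [mu, if_pos]
  · simp [knot_zero]
  · simpa using h.left _ (by omega)

theorem mu_last (hn : 1 ≤ n) (ht : StrictMono t) {m i : ℕ} (hm : 1 ≤ m) (hi : i = n + m - 1)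
    (f : ℝ → ℝ) : mu m t i f = f (t (Fin.last n)) := by
  have h := knot_isKnotSeq hn ht
  have h1 : knot t i = knot t n := h.right _ (by omega)
  rw [mu, if_pos]
  · rw [h1, knot_last]
  · rw [h1]
    exact h.right _ (by omega)

theorem mu_eq_splineMoment (hn : 1 ≤ n) (ht : StrictMono t) {d i : ℕ} (hi : i < n + d)
    (f : ℝ → ℝ) : mu (d + 2) t (i + 1) f = splineMoment (knot t) n d i f := by
  have h := knot_isKnotSeq hn ht
  have hlen := h.length_pos hi
  have hidx : ((i + 1 : ℕ) : ℤ) - ((d + 2 : ℕ) : ℤ) + 1 = (i : ℤ) - d := by push_cast; ring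
  have hidx' : ((i + 1 : ℕ) : ℤ) = (i : ℤ) + 1 := by push_cast; ring
  have hB : ∀ x, Bred (d + 2) t (i + 1) x =
      (knot t (i + 1) - knot t ((i : ℤ) - d)) * pspline (knot t) d ((i : ℤ) - d) x := by
    intro x
    rw [Bred, hidx, Nat.add_sub_cancel]
    exact h.bspline_eq d i x
  have h1 := h.splineMoment_one hi
  rw [mu, if_neg (by rw [hidx, hidx']; exact hlen.ne), ← knot_zero t, ← knot_last t]
  simp only [hB, splineMoment, mul_one] at h1 ⊢
  rw [← intervalIntegral.integral_const_mul]
  have h2 : ∫ x in knot t 0..knot t n, pspline (knot t) d ((i : ℤ) - d) x = 1 / (d + 1) := by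
    rw [eq_div_iff (by positivity), mul_comm]
    exact h1
  refine intervalIntegral.integral_congr fun x _ => ?_
  simp only [intervalIntegral.integral_const_mul, h2]
  have : knot t (i + 1) - knot t ((i : ℤ) - d) ≠ 0 := (sub_pos.2 hlen).ne'
  field_simp

theorem mu_cases (d : ℕ) {i : ℕ} (hi : i ≤ n + d + 1) :
    i = 0 ∨ i = n + d + 1 ∨ ∃ k < n + d, i = k + 1 := by
  rcases i with _ | k
  · exact Or.inl rfl
  · rcases eq_or_ne k (n + d) with rfl | h
    · exact Or.inr (Or.inl rfl)
    · exact Or.inr (Or.inr ⟨k, by omega, rfl⟩)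

theorem mu_add (hn : 1 ≤ n) (ht : StrictMono t) (d : ℕ) {i : ℕ} (hi : i ≤ n + d + 1) {f g : ℝ → ℝ}
    (hf : ContinuousOn f (Icc (t 0) (t (Fin.last n))))
    (hg : ContinuousOn g (Icc (t 0) (t (Fin.last n)))) :
    mu (d + 2) t i (fun x => f x + g x) = mu (d + 2) t i f + mu (d + 2) t i g := by
  rcases mu_cases d hi with rfl | h | ⟨k, hk, rfl⟩
  · simp only [mu_zero hn ht (show 1 ≤ d + 2 by omega)]
  · simp only [mu_last hn ht (show 1 ≤ d + 2 by omega) (show i = n + (d + 2) - 1 by omega)]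
  · simp only [mu_eq_splineMoment hn ht hk]
    rw [← knot_zero t, ← knot_last t] at hf hg
    exact (knot_isKnotSeq hn ht).splineMoment_add d k hf hg

theorem mu_const_mul (hn : 1 ≤ n) (ht : StrictMono t) (d : ℕ) {i : ℕ} (hi : i ≤ n + d + 1) (c : ℝ) (f : ℝ → ℝ) :
    mu (d + 2) t i (fun x => c * f x) = c * mu (d + 2) t i f := by
  rcases mu_cases d hi with rfl | h | ⟨k, hk, rfl⟩
  · simp only [mu_zero hn ht (show 1 ≤ d + 2 by omega)]
  · simp only [mu_last hn ht (show 1 ≤ d + 2 by omega) (show i = n + (d + 2) - 1 by omega)]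
  · simp only [mu_eq_splineMoment hn ht hk]
    exact IsKnotSeq.splineMoment_const_mul c d k f

theorem abs_mu_le (hn : 1 ≤ n) (ht : StrictMono t) (d : ℕ) {i : ℕ} (hi : i ≤ n + d + 1) {f : ℝ → ℝ} {C : ℝ}
    (hf : ContinuousOn f (Icc (t 0) (t (Fin.last n))))
    (hC : ∀ x ∈ Icc (t 0) (t (Fin.last n)), |f x| ≤ C) : |mu (d + 2) t i f| ≤ C := by
  have hle : t 0 ≤ t (Fin.last n) := ht.monotone (Fin.zero_le _)
  rcases mu_cases d hi with rfl | h | ⟨k, hk, rfl⟩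
  · rw [mu_zero hn ht (by omega)]
    exact hC _ (left_mem_Icc.2 hle)
  · rw [mu_last hn ht (show 1 ≤ d + 2 by omega) (show i = n + (d + 2) - 1 by omega)]
    exact hC _ (right_mem_Icc.2 hle)
  · rw [mu_eq_splineMoment hn ht hk]
    rw [← knot_zero t, ← knot_last t] at hf hC
    exact (knot_isKnotSeq hn ht).abs_splineMoment_le hk hf hC

theorem mu_one (hn : 1 ≤ n) (ht : StrictMono t) (d : ℕ) {i : ℕ} (hi : i ≤ n + d + 1) : mu (d + 2) t i (fun _ => 1) = 1 := by
  rcases mu_cases d hi with rfl | h | ⟨k, hk, rfl⟩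
  · rw [mu_zero hn ht (by omega)]
  · rw [mu_last hn ht (show 1 ≤ d + 2 by omega) (show i = n + (d + 2) - 1 by omega)]
  · rw [mu_eq_splineMoment hn ht hk]
    exact (knot_isKnotSeq hn ht).splineMoment_one hk

theorem knotSum_of_nonpos {T : ℤ → ℝ} (h : IsKnotSeq T n) (m : ℕ) {i : ℤ} (hi : i ≤ 0) :
    knotSum T m i = m * T 0 := by
  rw [knotSum, Finset.sum_congr rfl (g := fun _ => T 0) fun k _ => h.left _ (by omega)]
  simp

theorem knotSqSum_of_nonpos {T : ℤ → ℝ} (h : IsKnotSeq T n) (m : ℕ) {i : ℤ} (hi : i ≤ 0) :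
    knotSqSum T m i = m * T 0 ^ 2 := by
  rw [knotSqSum, Finset.sum_congr rfl (g := fun _ => T 0 ^ 2)
    fun k _ => by rw [h.left _ (by omega)]]
  simp

/-- The two point evaluations fit the general formula, since all knots of their window equal the end
point. -/
theorem mu_id (hn : 1 ≤ n) (ht : StrictMono t) (d : ℕ) {i : ℕ} (hi : i ≤ n + d + 1) :
    mu (d + 2) t i (fun x => x) = knotSum (knot t) (d + 2) i / (d + 2) := by
  have h := knot_isKnotSeq hn ht
  have hd : (d : ℝ) + 2 ≠ 0 := by positivity
  rcases mu_cases d hi with rfl | hi' | ⟨k, hk, rfl⟩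
  · rw [mu_zero hn ht (by omega), knotSum_of_nonpos h _ (by simp), knot_zero]
    push_cast
    field_simp
  · rw [mu_last hn ht (show 1 ≤ d + 2 by omega) (show i = n + (d + 2) - 1 by omega),
      h.knotSum_last _ (by push_cast [hi']; omega), knot_last]
    push_cast
    field_simp
  · rw [mu_eq_splineMoment hn ht hk, h.splineMoment_id hk]
    push_cast
    rfl

theorem mu_sq (hn : 1 ≤ n) (ht : StrictMono t) (d : ℕ) {i : ℕ} (hi : i ≤ n + d + 1) :
    mu (d + 2) t i (fun x => x ^ 2) =
      (knotSum (knot t) (d + 2) i ^ 2 + knotSqSum (knot t) (d + 2) i) / ((d + 2) * (d + 3)) := by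
  have h := knot_isKnotSeq hn ht
  have hd : (d : ℝ) + 2 ≠ 0 := by positivity
  have hd' : (d : ℝ) + 3 ≠ 0 := by positivity
  rcases mu_cases d hi with rfl | hi' | ⟨k, hk, rfl⟩
  · rw [mu_zero hn ht (by omega), knotSum_of_nonpos h _ (by simp),
      knotSqSum_of_nonpos h _ (by simp), knot_zero]
    push_cast
    field_simp
    ring
  · rw [mu_last hn ht (show 1 ≤ d + 2 by omega) (show i = n + (d + 2) - 1 by omega),
      h.knotSum_last _ (by push_cast [hi']; omega),
      h.knotSqSum_last _ (by push_cast [hi']; omega), knot_last]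
    push_cast
    field_simp
    ring
  · rw [mu_eq_splineMoment hn ht hk, h.splineMoment_sq hk]
    push_cast
    rfl

end Functionals

/-! ### The linear system for the weights -/

section Weights

/-- `R` is the sum of the knots shared by three adjacent windows, and `X`, `Z` are the sum and the
square sum of the middle one. Given `a + b + c = 1`, the second equation says `c (δ - β) = a (γ -
α)`, and the third then determines this common value. -/
theorem weights_iff {m X R α β γ δ Z a b c : ℝ} (hm : 1 < m) (hX : X = R + β + γ)
    (hu : β < δ) (hv : α < γ) (hS : α < δ) :
    (a + b + c = 1 ∧
      a * ((R + α + β) / m) + b * (X / m) + c * ((R + γ + δ) / m) = X / m ∧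
      a * (((R + α + β) ^ 2 + (Z + α ^ 2 - γ ^ 2)) / (m * (m + 1))) +
        b * ((X ^ 2 + Z) / (m * (m + 1))) +
        c * (((R + γ + δ) ^ 2 + (Z + δ ^ 2 - β ^ 2)) / (m * (m + 1))) =
        (X ^ 2 - Z) / (m * (m - 1))) ↔
    (a = -(m * Z - X ^ 2) / ((m - 1) * (δ - α)) / (γ - α) ∧
      c = -(m * Z - X ^ 2) / ((m - 1) * (δ - α)) / (δ - β) ∧ b = 1 - a - c) := by
  have h1 : m - 1 ≠ 0 := by linarith
  have h2 : δ - α ≠ 0 := by linarith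
  have h3 : γ - α ≠ 0 := by linarith
  have h4 : δ - β ≠ 0 := by linarith
  have h5 : m ≠ 0 := by linarith
  have h6 : m + 1 ≠ 0 := by linarith
  have E2 : (a * ((R + α + β) / m) + b * (X / m) + c * ((R + γ + δ) / m) = X / m) ↔
      a * (R + α + β) + b * X + c * (R + γ + δ) = X := by
    rw [mul_div_assoc', mul_div_assoc', mul_div_assoc', ← add_div, ← add_div, div_left_inj' h5]
  have E3 : ∀ A₁ A₂ A₃ W : ℝ, (a * (A₁ / (m * (m + 1))) + b * (A₂ / (m * (m + 1))) +
      c * (A₃ / (m * (m + 1))) = W / (m * (m - 1))) ↔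
      (m - 1) * (a * A₁ + b * A₂ + c * A₃) = (m + 1) * W := by
    intro A₁ A₂ A₃ W
    rw [mul_div_assoc', mul_div_assoc', mul_div_assoc', ← add_div, ← add_div,
      div_eq_div_iff (mul_ne_zero h5 h6) (mul_ne_zero h5 h1)]
    constructor
    · intro h
      refine mul_left_cancel₀ h5 ?_
      linear_combination h
    · intro h
      linear_combination m * h
  rw [E2, E3]
  subst hX
  constructor
  · rintro ⟨e1, e2, e3⟩
    obtain rfl : b = 1 - a - c := by linarith
    have e4 : c * (δ - β) = a * (γ - α) := by linear_combination e2
    have e5 : (m - 1) * (δ - α) * (a * (γ - α)) = -(m * Z - (R + β + γ) ^ 2) := by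
      linear_combination e3 / 2 - (m - 1) * (R + β + γ + δ) * e4
    refine ⟨?_, ?_, rfl⟩
    · rw [← e5]
      field_simp
    · rw [← e5, ← e4]
      field_simp
  · rintro ⟨ha, hc, rfl⟩
    have e4 : c * (δ - β) = a * (γ - α) := by
      rw [ha, hc]
      field_simp
    have e5 : (m - 1) * (δ - α) * (a * (γ - α)) = -(m * Z - (R + β + γ) ^ 2) := by
      rw [ha]
      field_simp
    exact ⟨by ring, by linear_combination e4,
      by linear_combination 2 * e5 + 2 * (m - 1) * (R + β + γ + δ) * e4⟩

end Weights

/-! ### Exactness as a condition on the weights -/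

section Exactness

theorem knotSum_window (T : ℤ → ℝ) (d : ℕ) (i : ℤ) :
    knotSum T (d + 2) i = knotSum T d (i - 1) + T (i - d - 1) + T i ∧
    knotSum T (d + 2) (i - 1) = knotSum T d (i - 1) + T (i - d - 2) + T (i - d - 1) ∧
    knotSum T (d + 2) (i + 1) = knotSum T d (i - 1) + T i + T (i + 1) := by
  have h1 : knotSum T (d + 1) i = knotSum T d (i - 1) + T i := by
    simpa using knotSum_succ_add_one T d (i - 1)
  refine ⟨?_, ?_, ?_⟩
  · rw [knotSum_succ, h1]
    push_cast
    rw [show i - ((d : ℤ) + 1) = i - d - 1 by ring]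
    ring
  · rw [knotSum_succ, knotSum_succ]
    push_cast
    rw [show i - 1 - ((d : ℤ) + 1) = i - d - 2 by ring, show i - 1 - (d : ℤ) = i - d - 1 by ring]
    ring
  · rw [knotSum_succ_add_one, h1]

theorem knotSqSum_window (T : ℤ → ℝ) (d : ℕ) (i : ℤ) :
    knotSqSum T (d + 2) (i - 1) = knotSqSum T (d + 2) i + T (i - d - 2) ^ 2 - T i ^ 2 ∧
    knotSqSum T (d + 2) (i + 1) = knotSqSum T (d + 2) i + T (i + 1) ^ 2 - T (i - d - 1) ^ 2 := by
  have h := knotSum_window (fun k => T k ^ 2) d i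
  change knotSqSum T (d + 2) i = knotSqSum T d (i - 1) + _ + _ ∧
    knotSqSum T (d + 2) (i - 1) = knotSqSum T d (i - 1) + _ + _ ∧
    knotSqSum T (d + 2) (i + 1) = knotSqSum T d (i - 1) + _ + _ at h
  constructor <;> linarith [h.1, h.2.1, h.2.2]

variable {n : ℕ} {t : Fin (n + 1) → ℝ}

/-- The coefficient of `B_i` in the quasi-interpolant of `f`. -/
noncomputable def quasiCoef (m : ℕ) (t : Fin (n + 1) → ℝ) (a b c : ℕ → ℝ) (f : ℝ → ℝ) (i : ℕ) : ℝ :=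
  if i = 0 then f (t 0) else if i = n + m - 1 then f (t (Fin.last n)) else
    a i * mu m t (i - 1) f + b i * mu m t i f + c i * mu m t (i + 1) f

theorem quasiCoef_succ {d k : ℕ} (hk : k < n + d) (a b c : ℕ → ℝ) (f : ℝ → ℝ) :
    quasiCoef (d + 2) t a b c f (k + 1) = a (k + 1) * mu (d + 2) t k f +
      b (k + 1) * mu (d + 2) t (k + 1) f + c (k + 1) * mu (d + 2) t (k + 2) f := by
  rw [quasiCoef, if_neg (by omega), if_neg (by omega)]
  rfl

theorem G2_eq_sum (d : ℕ) (a b c : ℕ → ℝ) (f : ℝ → ℝ) (x : ℝ) :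
    G2 (d + 2) t a b c f x = ∑ i ∈ Finset.range (n + (d + 2)),
      quasiCoef (d + 2) t a b c f i * bspline (knot t) (d + 2) ((i : ℤ) - (d + 2 : ℕ)) x := by
  rw [← add_assoc n d 2, Finset.sum_range_succ, Finset.sum_range_succ', G2]
  have h0 : quasiCoef (d + 2) t a b c f 0 = f (t 0) := if_pos rfl
  have h1 : quasiCoef (d + 2) t a b c f (n + d + 1) = f (t (Fin.last n)) := by
    rw [quasiCoef, if_neg (by omega), if_pos (by omega)]
  rw [h0, h1]
  have h2 : ∑ i ∈ Finset.Icc 1 (n + (d + 2) - 2), (a i * mu (d + 2) t (i - 1) f +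
      b i * mu (d + 2) t i f + c i * mu (d + 2) t (i + 1) f) * B (d + 2) t i x =
      ∑ k ∈ Finset.range (n + d), quasiCoef (d + 2) t a b c f (k + 1) *
        bspline (knot t) (d + 2) (((k + 1 : ℕ) : ℤ) - (d + 2 : ℕ)) x := by
    symm
    refine Finset.sum_nbij' (fun k => k + 1) (fun i => i - 1) ?_ ?_ ?_ ?_ ?_
    · intro k hk
      simp only [Finset.mem_range, Finset.mem_Icc] at hk ⊢
      omega
    · intro k hk
      simp only [Finset.mem_range, Finset.mem_Icc] at hk ⊢
      omega
    · intro k hk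
      rfl
    · intro k hk
      simp only [Finset.mem_Icc] at hk
      omega
    · intro k hk
      rw [quasiCoef_succ (Finset.mem_range.1 hk)]
      rfl
  rw [h2]
  simp only [B]
  rw [show n + (d + 2) - 1 = n + d + 1 by omega]
  ring

theorem quasiCoef_add (hn : 1 ≤ n) (ht : StrictMono t) (d : ℕ) (a b c : ℕ → ℝ) {i : ℕ}
    (hi : i ≤ n + d + 1) {f g : ℝ → ℝ} (hf : ContinuousOn f (Icc (t 0) (t (Fin.last n))))
    (hg : ContinuousOn g (Icc (t 0) (t (Fin.last n)))) :
    quasiCoef (d + 2) t a b c (fun x => f x + g x) i =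
      quasiCoef (d + 2) t a b c f i + quasiCoef (d + 2) t a b c g i := by
  rw [quasiCoef, quasiCoef, quasiCoef]
  split_ifs
  · rfl
  · rfl
  · rw [mu_add hn ht d (by omega) hf hg, mu_add hn ht d (by omega) hf hg,
      mu_add hn ht d (by omega) hf hg]
    ring

theorem quasiCoef_const_mul (hn : 1 ≤ n) (ht : StrictMono t) (d : ℕ) (a b c : ℕ → ℝ) {i : ℕ}
    (hi : i ≤ n + d + 1) (r : ℝ) (f : ℝ → ℝ) :
    quasiCoef (d + 2) t a b c (fun x => r * f x) i = r * quasiCoef (d + 2) t a b c f i := by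
  rw [quasiCoef, quasiCoef]
  split_ifs
  · rfl
  · rfl
  · rw [mu_const_mul hn ht d (by omega), mu_const_mul hn ht d (by omega),
      mu_const_mul hn ht d (by omega)]
    ring

/-- The coefficients that represent `1`, `x`, `x ^ 2` in the B-spline basis. -/
noncomputable def monomialCoef (T : ℤ → ℝ) (d : ℕ) (i : ℤ) : Fin 3 → ℝ
  | 0 => 1
  | 1 => knotSum T (d + 2) i / (d + 2)
  | 2 => (knotSum T (d + 2) i ^ 2 - knotSqSum T (d + 2) i) / ((d + 2) * (d + 2 - 1))

theorem sum_monomialCoef {T : ℤ → ℝ} (h : IsKnotSeq T n) (d : ℕ) {x : ℝ}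
    (hx : x ∈ Icc (T 0) (T n)) (r : Fin 3) : ∑ i ∈ Finset.range (n + (d + 2)),
      monomialCoef T d i r * bspline T (d + 2) ((i : ℤ) - (d + 2 : ℕ)) x = x ^ (r : ℕ) := by
  have hd : (d : ℝ) + 2 ≠ 0 := by positivity
  have hd' : (d : ℝ) + 2 - 1 ≠ 0 := by
    rw [add_sub_assoc]
    norm_num
    positivity
  fin_cases r
  · simpa [monomialCoef] using h.sum_bspline (d + 2) hx
  · have := h.sum_knotSum_mul_bspline (d + 2) hx
    simp only [monomialCoef, div_mul_eq_mul_div, ← Finset.sum_div]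
    push_cast at this ⊢
    rw [this]
    field_simp
  · have := h.sum_knotSqSum_mul_bspline (d + 2) hx
    simp only [monomialCoef, div_mul_eq_mul_div, ← Finset.sum_div]
    push_cast at this ⊢
    rw [this]
    field_simp

theorem quasiCoef_boundary (hn : 1 ≤ n) (ht : StrictMono t) (d : ℕ) (a b c : ℕ → ℝ) (r : Fin 3)
    {i : ℕ} (hi : i = 0 ∨ i = n + d + 1) :
    quasiCoef (d + 2) t a b c (fun x => x ^ (r : ℕ)) i = monomialCoef (knot t) d i r := by
  have h := knot_isKnotSeq hn ht
  have hd : (d : ℝ) + 2 ≠ 0 := by positivity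
  have hd' : (d : ℝ) + 2 - 1 ≠ 0 := by
    rw [add_sub_assoc]
    norm_num
    positivity
  rcases hi with rfl | rfl
  · rw [quasiCoef, if_pos rfl, ← knot_zero t]
    fin_cases r
    · simp [monomialCoef]
    · simp only [monomialCoef]
      rw [knotSum_of_nonpos h _ (by simp)]
      push_cast
      field_simp
    · simp only [monomialCoef]
      rw [knotSum_of_nonpos h _ (by simp), knotSqSum_of_nonpos h _ (by simp)]
      push_cast
      field_simp
  · rw [quasiCoef, if_neg (by omega), if_pos (by omega), ← knot_last t]
    fin_cases r
    · simp [monomialCoef]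
    · simp only [monomialCoef]
      rw [h.knotSum_last _ (by push_cast; omega)]
      push_cast
      field_simp
    · simp only [monomialCoef]
      rw [h.knotSum_last _ (by push_cast; omega), h.knotSqSum_last _ (by push_cast; omega)]
      push_cast
      field_simp

/-- By linear independence, exactness on a monomial means equality of B-spline coefficients. The two
boundary coefficients agree for any weights, so only interior indices give conditions. -/
theorem exactOnP2_iff_quasiCoef (hn : 1 ≤ n) (ht : StrictMono t) (d : ℕ) (a b c : ℕ → ℝ) :
    ExactOnP2 (d + 2) t a b c ↔ ∀ k < n + d, ∀ r : Fin 3,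
      quasiCoef (d + 2) t a b c (fun x => x ^ (r : ℕ)) (k + 1) =
        monomialCoef (knot t) d (k + 1 : ℕ) r := by
  have h := knot_isKnotSeq hn ht
  constructor
  · intro hE k hk r
    have hp := hE (Polynomial.X ^ (r : ℕ)) (by rw [Polynomial.natDegree_X_pow]; omega)
    simp only [Polynomial.eval_pow, Polynomial.eval_X] at hp
    have := h.bspline_linearIndependent (d + 2)
      (c := fun i => quasiCoef (d + 2) t a b c (fun x => x ^ (r : ℕ)) i -
        monomialCoef (knot t) d i r) ?_ (k + 1) (by omega)
    · exact sub_eq_zero.1 this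
    · intro x hx
      have hx' : x ∈ Icc (knot t 0) (knot t n) := Ioo_subset_Icc_self hx.1
      simp only [sub_mul, Finset.sum_sub_distrib]
      rw [sum_monomialCoef h d hx' r, ← G2_eq_sum]
      rw [knot_zero, knot_last] at hx'
      rw [hp x hx', sub_self]
  · intro hc p hp x hx
    have hall : ∀ i ∈ Finset.range (n + (d + 2)), ∀ r : Fin 3,
        quasiCoef (d + 2) t a b c (fun x => x ^ (r : ℕ)) i = monomialCoef (knot t) d i r := by
      intro i hi r
      rw [Finset.mem_range] at hi
      rcases mu_cases d (show i ≤ n + d + 1 by omega) with h0 | h0 | ⟨k, hk, rfl⟩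
      · exact quasiCoef_boundary hn ht d a b c r (Or.inl h0)
      · exact quasiCoef_boundary hn ht d a b c r (Or.inr h0)
      · exact hc k hk r
    have heval : ∀ y, p.eval y = (p.coeff 0 * y ^ ((0 : Fin 3) : ℕ) +
        p.coeff 1 * y ^ ((1 : Fin 3) : ℕ)) + p.coeff 2 * y ^ ((2 : Fin 3) : ℕ) := by
      intro y
      rw [Polynomial.eval_eq_sum_range' (show p.natDegree < 3 by omega)]
      simp [Finset.sum_range_succ]
    simp only [heval]
    rw [G2_eq_sum]
    have hx' := hx
    rw [← knot_zero t, ← knot_last t] at hx'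
    rw [← sum_monomialCoef h d hx' 0, ← sum_monomialCoef h d hx' 1, ← sum_monomialCoef h d hx' 2,
      Finset.mul_sum, Finset.mul_sum, Finset.mul_sum, ← Finset.sum_add_distrib,
      ← Finset.sum_add_distrib]
    refine Finset.sum_congr rfl fun i hi => ?_
    have hi' : i ≤ n + d + 1 := by
      rw [Finset.mem_range] at hi
      omega
    rw [quasiCoef_add hn ht d a b c hi' (by fun_prop) (by fun_prop),
      quasiCoef_add hn ht d a b c hi' (by fun_prop) (by fun_prop),
      quasiCoef_const_mul hn ht d a b c hi', quasiCoef_const_mul hn ht d a b c hi',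
      quasiCoef_const_mul hn ht d a b c hi', hall i hi, hall i hi, hall i hi]
    ring

/-- The common factor of the outer weights for which the quasi-interpolant is exact. -/
noncomputable def outerWeight (T : ℤ → ℝ) (d : ℕ) (i : ℤ) : ℝ :=
  -((d + 2) * knotSqSum T (d + 2) i - knotSum T (d + 2) i ^ 2) /
    ((d + 2 - 1) * (T (i + 1) - T (i - d - 2)))

theorem IsKnotSeq.window_lt {T : ℤ → ℝ} (h : IsKnotSeq T n) {d : ℕ} {i : ℤ} (h1 : 1 ≤ i)
    (h2 : i ≤ n + d) : T (i - d - 1) < T (i + 1) ∧ T (i - d - 2) < T i ∧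
      T (i - d - 2) < T (i + 1) ∧ T (i - d - 1) < T i :=
  ⟨h.lt (by omega) (by omega) (by omega), h.lt (by omega) (by omega) (by omega),
    h.lt (by omega) (by omega) (by omega), h.lt (by omega) (by omega) (by omega)⟩

theorem exactOnP2_iff_weights (hn : 1 ≤ n) (ht : StrictMono t) (d : ℕ) (a b c : ℕ → ℝ) :
    ExactOnP2 (d + 2) t a b c ↔ ∀ i ∈ Finset.Icc 1 (n + d),
      a i = outerWeight (knot t) d i / (knot t i - knot t (i - d - 2)) ∧
      c i = outerWeight (knot t) d i / (knot t (i + 1) - knot t (i - d - 1)) ∧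
      b i = 1 - a i - c i := by
  have h := knot_isKnotSeq hn ht
  rw [exactOnP2_iff_quasiCoef hn ht]
  have key : ∀ k < n + d, (∀ r : Fin 3,
      quasiCoef (d + 2) t a b c (fun x => x ^ (r : ℕ)) (k + 1) =
        monomialCoef (knot t) d (k + 1 : ℕ) r) ↔
      (a (k + 1) = outerWeight (knot t) d (k + 1 : ℕ) /
          (knot t (k + 1 : ℕ) - knot t ((k + 1 : ℕ) - d - 2)) ∧
        c (k + 1) = outerWeight (knot t) d (k + 1 : ℕ) /
          (knot t ((k + 1 : ℕ) + 1) - knot t ((k + 1 : ℕ) - d - 1)) ∧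
        b (k + 1) = 1 - a (k + 1) - c (k + 1)) := by
    intro k hk
    obtain ⟨w1, w2, w3, -⟩ := h.window_lt (d := d) (i := ((k + 1 : ℕ) : ℤ)) (by push_cast; omega)
      (by push_cast; omega)
    obtain ⟨s1, s2, s3⟩ := knotSum_window (knot t) d ((k + 1 : ℕ) : ℤ)
    obtain ⟨q1, q2⟩ := knotSqSum_window (knot t) d ((k + 1 : ℕ) : ℤ)
    have hm1 : (1 : ℝ) < (d : ℝ) + 2 := by linarith [(Nat.cast_nonneg d : (0 : ℝ) ≤ d)]
    have hw := weights_iff (m := (d : ℝ) + 2) (Z := knotSqSum (knot t) (d + 2) ((k + 1 : ℕ) : ℤ))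
      (a := a (k + 1)) (b := b (k + 1)) (c := c (k + 1)) hm1 s1 w1 w2 w3
    rw [← s2, ← s3, ← q1, ← q2] at hw
    have e1 : ((k + 1 : ℕ) : ℤ) - 1 = (k : ℕ) := by push_cast; ring
    have e2 : ((k + 1 : ℕ) : ℤ) + 1 = (k + 2 : ℕ) := by push_cast; ring
    have e3 : (d : ℝ) + 2 + 1 = d + 3 := by ring
    rw [outerWeight]
    refine Iff.trans ?_ hw
    rw [e1, e2, e3, ← mu_id hn ht d (by omega), ← mu_id hn ht d (by omega),
      ← mu_id hn ht d (by omega), ← mu_sq hn ht d (by omega), ← mu_sq hn ht d (by omega),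
      ← mu_sq hn ht d (by omega)]
    rw [Fin.forall_fin_succ, Fin.forall_fin_succ, Fin.forall_fin_one]
    rw [quasiCoef_succ hk, quasiCoef_succ hk, quasiCoef_succ hk]
    simp only [Fin.val_zero, pow_zero, Fin.succ_zero_eq_one, Fin.val_one, pow_one,
      Fin.succ_one_eq_two, Fin.val_two, monomialCoef]
    rw [mu_one hn ht d (by omega), mu_one hn ht d (by omega), mu_one hn ht d (by omega), mul_one,
      mul_one, mul_one, mu_id hn ht d (show k + 1 ≤ n + d + 1 by omega)]
  constructor
  · intro H i hi
    rw [Finset.mem_Icc] at hi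
    obtain ⟨k, rfl⟩ : ∃ k, i = k + 1 := ⟨i - 1, by omega⟩
    exact (key k (by omega)).1 (H k (by omega))
  · intro H k hk
    exact (key k hk).2 (H (k + 1) (by rw [Finset.mem_Icc]; omega))

end Exactness

/-! ### The norm bound -/

section NormBound

variable {T : ℤ → ℝ} {n : ℕ}

theorem knotSum_sq_le (T : ℤ → ℝ) (d : ℕ) (i : ℤ) : knotSum T d i ^ 2 ≤ d * knotSqSum T d i := by
  simpa [knotSum, knotSqSum] using
    sq_sum_le_card_mul_sum_sq (s := Finset.range d) (f := fun k : ℕ => T (i - k))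

/-- Large variance of the interior knots forces the support to stay away from both end knots. -/
theorem IsKnotSeq.interior_of_lt (h : IsKnotSeq T n) {d k : ℕ} (hk : k < n + d)
    (hQ : (d + 1) * (T (k + 1) - T ((k : ℤ) - d)) ^ 2 <
      (d + 2) * knotSqSum T (d + 2) (k + 1) - knotSum T (d + 2) (k + 1) ^ 2) :
    2 ≤ d ∧ 1 ≤ k ∧ k + 1 < n + d := by
  refine ⟨?_, ?_, ?_⟩
  · by_contra! hd
    interval_cases d
    · rw [knotSqSum, knotSum, Finset.sum_range_succ, Finset.sum_range_one, Finset.sum_range_succ,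
        Finset.sum_range_one] at hQ
      push_cast at hQ
      rw [show (k : ℤ) + 1 - 0 = k + 1 by ring, show (k : ℤ) - 0 = k by ring,
        show (k : ℤ) + 1 - 1 = k by ring] at hQ
      nlinarith
    · rw [knotSqSum, knotSum, Finset.sum_range_succ, Finset.sum_range_succ, Finset.sum_range_one,
        Finset.sum_range_succ, Finset.sum_range_succ, Finset.sum_range_one] at hQ
      push_cast at hQ
      rw [show (k : ℤ) + 1 - 0 = k + 1 by ring, show (k : ℤ) + 1 - 2 = k - 1 by ring,
        show (k : ℤ) + 1 - 1 = k by ring] at hQ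
      have h1 : T ((k : ℤ) - 1) ≤ T k := h.mono (by omega)
      have h2 : T (k : ℤ) ≤ T (k + 1) := h.mono (by omega)
      nlinarith [mul_nonneg (sub_nonneg.2 h1) (sub_nonneg.2 h2)]
  -- Here all interior knots but one coincide with the end point, so `Q` equals `(d + 1) L ^ 2`; the
  -- right end is similar.
  · by_contra! hk0
    obtain rfl : k = 0 := by omega
    rw [knotSum_succ_add_one, knotSqSum_succ_add_one, knotSum_of_nonpos h _ (by simp),
      knotSqSum_of_nonpos h _ (by simp), h.left (((0 : ℕ) : ℤ) - d) (by push_cast; omega)] at hQ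
    push_cast at hQ
    nlinarith
  · by_contra! hk1
    rw [knotSum_succ, knotSqSum_succ, h.knotSum_last _ (by push_cast; omega),
      h.knotSqSum_last _ (by push_cast; omega), h.right ((k : ℤ) + 1) (by omega)] at hQ
    push_cast at hQ
    rw [show (k : ℤ) + 1 - (d + 1) = k - d by ring] at hQ
    nlinarith

/-- The outer weights are nonpositive. If `s` is the sum of their absolute values, the middle one is
`1 + s` and the total is `1 + 2 s`; the bound on `Q` gives `s ≤ 2`. -/
theorem abs_weights_le {α β γ δ e Q : ℝ} (he : 0 < e) (hβ : α ≤ β) (hL : β < γ) (hγ : γ ≤ δ)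
    (hQ0 : 0 ≤ Q) (hQ : Q ≤ e * (γ - β) ^ 2) :
    |-Q / (e * (δ - α)) / (γ - α)| + |1 - -Q / (e * (δ - α)) / (γ - α) -
      -Q / (e * (δ - α)) / (δ - β)| + |-Q / (e * (δ - α)) / (δ - β)| ≤ 5 := by
  have hS : 0 < δ - α := by linarith
  have hv : 0 < γ - α := by linarith
  have hu : 0 < δ - β := by linarith
  have hsum : Q / (e * (δ - α)) / (γ - α) + Q / (e * (δ - α)) / (δ - β) ≤ 2 := by
    have h1 : Q / (e * (δ - α)) / (γ - α) + Q / (e * (δ - α)) / (δ - β) =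
        Q * ((δ - β) + (γ - α)) / (e * (δ - α) * ((γ - α) * (δ - β))) := by
      field_simp
    rw [h1, div_le_iff₀ (by positivity)]
    have h2 : (γ - β) ^ 2 ≤ (γ - α) * (δ - β) := by nlinarith
    have h3 : (δ - β) + (γ - α) ≤ 2 * (δ - α) := by linarith
    calc Q * ((δ - β) + (γ - α)) ≤ (e * (γ - β) ^ 2) * (2 * (δ - α)) := by gcongr
      _ ≤ (e * ((γ - α) * (δ - β))) * (2 * (δ - α)) := by gcongr
      _ = _ := by ring
  have ha : 0 ≤ Q / (e * (δ - α)) / (γ - α) := by positivity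
  have hc : 0 ≤ Q / (e * (δ - α)) / (δ - β) := by positivity
  rw [neg_div, neg_div, neg_div, abs_neg, abs_neg, abs_of_nonneg ha, abs_of_nonneg hc,
    abs_of_nonneg (by linarith)]
  linarith

open MeasureTheory in
theorem IsKnotSeq.integral_psplineDeriv₂_mul (h : IsKnotSeq T n) (d : ℕ) (j : ℤ) {f : ℝ → ℝ}
    (hf : ContinuousOn f (Icc (T 0) (T n))) :
    ∫ x in (T 0)..(T n), psplineDeriv₂ T d j x * f x =
      (d + 2) * (d + 1) / (T (j + d + 3) - T j) *
      (((∫ x in (T 0)..(T n), pspline T d j x * f x) -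
        ∫ x in (T 0)..(T n), pspline T d (j + 1) x * f x) / (T (j + d + 2) - T j) -
       ((∫ x in (T 0)..(T n), pspline T d (j + 1) x * f x) -
        ∫ x in (T 0)..(T n), pspline T d (j + 2) x * f x) / (T (j + d + 3) - T (j + 1))) := by
  have hi : ∀ k, IntervalIntegrable (fun x => pspline T d k x * f x) volume (T 0) (T n) :=
    fun k => IsKnotSeq.intervalIntegrable_of_integrableOn
      ((h.integrableOn_pspline d k).mul_continuousOn hf isCompact_Icc) h.left_mem h.right_mem
  rw [← intervalIntegral.integral_sub (hi _) (hi _), ← intervalIntegral.integral_sub (hi _) (hi _),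
    ← intervalIntegral.integral_div, ← intervalIntegral.integral_div,
    ← intervalIntegral.integral_sub (((hi _).sub (hi _)).div_const _)
      (((hi _).sub (hi _)).div_const _), ← intervalIntegral.integral_const_mul]
  refine intervalIntegral.integral_congr fun x _ => ?_
  simp only [psplineDeriv₂_eq]
  ring

theorem IsKnotSeq.abs_integral_psplineDeriv₂_mul_le (h : IsKnotSeq T n) (d : ℕ) {j : ℤ}
    (h1 : -(d : ℤ) ≤ j) (h2 : j + 2 < n) {M C : ℝ} {f : ℝ → ℝ}
    (hM : ∀ x ∈ Icc (T 0) (T n) \ range T, ∀ y ∈ Icc (T 0) (T n) \ range T,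
      psplineDeriv T (d + 2) j x - psplineDeriv T (d + 2) j y ≤ M)
    (hf : ContinuousOn f (Icc (T 0) (T n))) (hC : ∀ x ∈ Icc (T 0) (T n), |f x| ≤ C) :
    |∫ x in (T 0)..(T n), psplineDeriv₂ T d j x * f x| ≤ 2 * M * C := by
  have hle := h.zero_lt_last.le
  have hC0 : 0 ≤ C := (abs_nonneg _).trans (hC _ h.left_mem)
  have hint := h.integrableOn_psplineDeriv₂ d j
  calc |∫ x in (T 0)..(T n), psplineDeriv₂ T d j x * f x|
      ≤ ∫ x in (T 0)..(T n), |psplineDeriv₂ T d j x * f x| :=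
        intervalIntegral.abs_integral_le_integral_abs hle
    _ ≤ ∫ x in (T 0)..(T n), |psplineDeriv₂ T d j x| * C := by
      apply intervalIntegral.integral_mono_on hle
      · exact (IsKnotSeq.intervalIntegrable_of_integrableOn (hint.mul_continuousOn hf isCompact_Icc)
          h.left_mem h.right_mem).abs
      · exact (IsKnotSeq.intervalIntegrable_of_integrableOn hint
          h.left_mem h.right_mem).abs.mul_const _
      · intro x hx
        rw [abs_mul]
        exact mul_le_mul_of_nonneg_left (hC x hx) (abs_nonneg _)
    _ ≤ 2 * M * C := by
      rw [intervalIntegral.integral_mul_const]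
      exact mul_le_mul_of_nonneg_right (h.integral_abs_psplineDeriv₂_le d h1 h2 hM) hC0

variable {t : Fin (n + 1) → ℝ}

/-- For small variance the weights are summed in absolute value. For large variance the support is
interior, and the three-term combination is read as a smoothed second derivative of `f` subtracted
from one moment. -/
theorem abs_quasiCoef_le (hn : 1 ≤ n) (ht : StrictMono t) (d : ℕ) {a b c : ℕ → ℝ}
    (hE : ExactOnP2 (d + 2) t a b c) {f : ℝ → ℝ} {C : ℝ}
    (hf : ContinuousOn f (Icc (t 0) (t (Fin.last n))))
    (hC : ∀ x ∈ Icc (t 0) (t (Fin.last n)), |f x| ≤ C) {i : ℕ} (hi : i ≤ n + d + 1) :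
    |quasiCoef (d + 2) t a b c f i| ≤ 5 * C := by
  have h := knot_isKnotSeq hn ht
  have hle : t 0 ≤ t (Fin.last n) := ht.monotone (Fin.zero_le _)
  have hC0 : 0 ≤ C := (abs_nonneg _).trans (hC _ (left_mem_Icc.2 hle))
  rcases mu_cases d hi with rfl | h0 | ⟨k, hk, rfl⟩
  · rw [quasiCoef, if_pos rfl]
    linarith [hC _ (left_mem_Icc.2 hle)]
  · rw [quasiCoef, if_neg (by omega), if_pos (by omega)]
    linarith [hC _ (right_mem_Icc.2 hle)]
  rw [quasiCoef_succ hk]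
  obtain ⟨ha, hc, hb⟩ := (exactOnP2_iff_weights hn ht d a b c).1 hE (k + 1)
    (by rw [Finset.mem_Icc]; omega)
  have i1 : ((k + 1 : ℕ) : ℤ) = (k : ℤ) + 1 := by push_cast; ring
  have i2 : (k : ℤ) + 1 - d - 1 = k - d := by ring
  have i3 : (k : ℤ) + 1 - d - 2 = k - 1 - d := by ring
  have i4 : (k : ℤ) + 1 + 1 = k + 2 := by ring
  obtain ⟨w1, w2, w3, w4⟩ := h.window_lt (d := d) (i := (k : ℤ) + 1) (by omega) (by omega)
  rw [outerWeight] at ha hc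
  rw [i1, i2, i3, i4] at hc
  rw [i1, i3, i4] at ha
  rw [i2, i4] at w1
  rw [i3] at w2
  rw [i3, i4] at w3
  rw [i2] at w4
  have hQ0 := knotSum_sq_le (knot t) (d + 2) ((k : ℤ) + 1)
  push_cast at hQ0
  set Q : ℝ := (d + 2) * knotSqSum (knot t) (d + 2) ((k : ℤ) + 1) -
    knotSum (knot t) (d + 2) ((k : ℤ) + 1) ^ 2 with hQdef
  have he : (d : ℝ) + 2 - 1 = d + 1 := by ring
  rw [he] at ha hc
  rcases le_or_gt Q ((d + 1) * (knot t (k + 1) - knot t ((k : ℤ) - d)) ^ 2) with hQ | hQ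
  · have hw := abs_weights_le (e := (d : ℝ) + 1) (by positivity)
      (h.mono (by omega) : knot t ((k : ℤ) - 1 - d) ≤ knot t ((k : ℤ) - d)) w4
      (h.mono (by omega) : knot t ((k : ℤ) + 1) ≤ knot t ((k : ℤ) + 2)) (by linarith) hQ
    rw [← ha, ← hc, ← hb] at hw
    have m0 := abs_mu_le hn ht d (show k ≤ n + d + 1 by omega) hf hC
    have m1 := abs_mu_le hn ht d (show k + 1 ≤ n + d + 1 by omega) hf hC
    have m2 := abs_mu_le hn ht d (show k + 2 ≤ n + d + 1 by omega) hf hC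
    refine (abs_add_three _ _ _).trans ?_
    rw [abs_mul, abs_mul, abs_mul]
    calc _ ≤ |a (k + 1)| * C + |b (k + 1)| * C + |c (k + 1)| * C := by gcongr
      _ = (|a (k + 1)| + |b (k + 1)| + |c (k + 1)|) * C := by ring
      _ ≤ 5 * C := by gcongr
  · obtain ⟨hd, hk1, hk2⟩ := h.interior_of_lt hk hQ
    obtain ⟨k, rfl⟩ : ∃ l, k = l + 1 := ⟨k - 1, by omega⟩
    have m1 := abs_mu_le hn ht d (show k + 1 + 1 ≤ n + d + 1 by omega) hf hC
    rw [mu_eq_splineMoment hn ht hk] at m1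
    rw [mu_eq_splineMoment hn ht (by omega), mu_eq_splineMoment hn ht hk,
      mu_eq_splineMoment hn ht hk2]
    rw [← knot_zero t, ← knot_last t] at hf hC
    have hQpos : 0 < Q := lt_of_le_of_lt (by positivity) hQ
    obtain ⟨j, hj⟩ : ∃ j : ℤ, j = (k : ℤ) - d := ⟨_, rfl⟩
    have c0 : ((k + 1 : ℕ) : ℤ) - 1 - d = j := by rw [hj]; push_cast; ring
    have c1 : ((k + 1 : ℕ) : ℤ) - d = j + 1 := by rw [hj]; push_cast; ring
    have c2 : ((k + 1 + 1 : ℕ) : ℤ) - d = j + 2 := by rw [hj]; push_cast; ring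
    have c3 : ((k + 1 : ℕ) : ℤ) + 1 = j + d + 2 := by rw [hj]; push_cast; ring
    have c4 : ((k + 1 : ℕ) : ℤ) + 2 = j + d + 3 := by rw [hj]; push_cast; ring
    rw [c0, c1, c4] at hc
    rw [c0, c3, c4] at ha
    rw [c1, c4] at w1
    rw [c0, c3] at w2
    rw [c0, c4] at w3
    rw [c1, c3] at w4
    rw [c1, c3] at hQ
    rw [c3] at hQdef
    have hder := fun u hu w hw =>
      h.psplineDeriv_sub_le d j w4 hd (by rw [← hQdef]; exact hQ) (u := u) (w := w) hu hw
    rw [← hQdef] at hder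
    have hbound := h.abs_integral_psplineDeriv₂_mul_le d (by omega) (by omega) hder hf hC
    have hlin := h.integral_psplineDeriv₂_mul d j hf
    rw [hlin] at hbound
    simp only [splineMoment] at m1 ⊢
    rw [c1] at m1 ⊢
    rw [c2, ← hj]
    set I₀ := ∫ x in (knot t 0)..(knot t n), pspline (knot t) d j x * f x
    set I₁ := ∫ x in (knot t 0)..(knot t n), pspline (knot t) d (j + 1) x * f x
    set I₂ := ∫ x in (knot t 0)..(knot t n), pspline (knot t) d (j + 2) x * f x
    have hS := (sub_pos.2 w3).ne'
    have hv := (sub_pos.2 w2).ne'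
    have hu := (sub_pos.2 w1).ne'
    set D := (d + 2) * (d + 1) / (knot t (j + d + 3) - knot t j) *
      ((I₀ - I₁) / (knot t (j + d + 2) - knot t j) -
        (I₁ - I₂) / (knot t (j + d + 3) - knot t (j + 1))) with hD
    -- The weights are those for which the part beyond the middle moment is a multiple of `D`, the
    -- integral of `f` against the second derivative of a B-spline of degree `d + 2`.
    have e : a (k + 1 + 1) * ((d + 1) * I₀) + b (k + 1 + 1) * ((d + 1) * I₁) +
        c (k + 1 + 1) * ((d + 1) * I₂) = (d + 1) * I₁ - Q / ((d + 2) * (d + 1)) * D := by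
      rw [hb, ha, hc, hD]
      field_simp
      ring
    rw [e]
    refine (abs_sub _ _).trans ?_
    have hlast : |Q / ((d + 2) * (d + 1)) * D| ≤ 4 * C := by
      rw [abs_mul, abs_of_pos (by positivity)]
      -- One factor `2` comes from variation against oscillation, the other from the oscillation
      -- bound; `Q` cancels. The middle moment adds the remaining `C`.
      calc _ ≤ Q / ((d + 2) * (d + 1)) * (2 * (2 * ((d + 2) * (d + 1) / Q)) * C) := by gcongr
        _ = 4 * C := by
          field_simp
          ring
    linarith

theorem abs_G2_le (hn : 1 ≤ n) (ht : StrictMono t) (d : ℕ) {a b c : ℕ → ℝ}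
    (hE : ExactOnP2 (d + 2) t a b c) {f : ℝ → ℝ} {C : ℝ}
    (hf : ContinuousOn f (Icc (t 0) (t (Fin.last n))))
    (hC : ∀ x ∈ Icc (t 0) (t (Fin.last n)), |f x| ≤ C) {x : ℝ}
    (hx : x ∈ Icc (t 0) (t (Fin.last n))) : |G2 (d + 2) t a b c f x| ≤ 5 * C := by
  have h := knot_isKnotSeq hn ht
  rw [G2_eq_sum]
  rw [← knot_zero t, ← knot_last t] at hx
  refine (Finset.abs_sum_le_sum_abs _ _).trans ?_
  calc _ ≤ ∑ i ∈ Finset.range (n + (d + 2)),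
        5 * C * bspline (knot t) (d + 2) ((i : ℤ) - (d + 2 : ℕ)) x := by
        refine Finset.sum_le_sum fun i hi => ?_
        rw [Finset.mem_range] at hi
        have h0 := bspline_nonneg h.mono (d + 2) ((i : ℤ) - (d + 2 : ℕ)) x
        rw [abs_mul, abs_of_nonneg h0]
        exact mul_le_mul_of_nonneg_right (abs_quasiCoef_le hn ht d hE hf hC (by omega)) h0
    _ = 5 * C := by rw [← Finset.mul_sum, h.sum_bspline (d + 2) hx, mul_one]

end NormBound

/-! ### Uniqueness of the weights and the operator on `C(I)` -/

theorem theorem2 (m n : ℕ) (hm : 2 ≤ m) (hn : 1 ≤ n)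
    (t : Fin (n + 1) → ℝ) (ht : StrictMono t) :
    -- exactness on polynomials of degree at most 2 determines the weights
    (∃ a b c : ℕ → ℝ, ExactOnP2 m t a b c ∧
      ∀ a' b' c' : ℕ → ℝ, ExactOnP2 m t a' b' c' →
        ∀ i ∈ Finset.Icc 1 (n + m - 2), a' i = a i ∧ b' i = b i ∧ c' i = c i) ∧
    -- the resulting operator on C(I) has norm at most 5
    (∀ a b c : ℕ → ℝ, ExactOnP2 m t a b c →
      ∃ G : C(Icc (t 0) (t (Fin.last n)), ℝ) →L[ℝ] C(Icc (t 0) (t (Fin.last n)), ℝ),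
        (∀ (f : C(Icc (t 0) (t (Fin.last n)), ℝ)) (x : Icc (t 0) (t (Fin.last n))),
          G f x = G2 m t a b c (IccExtend (ht.monotone (Fin.zero_le (Fin.last n))) f) x) ∧
        ‖G‖ ≤ 5) := by
  obtain ⟨d, rfl⟩ : ∃ d, m = d + 2 := ⟨m - 2, by omega⟩
  have h := knot_isKnotSeq hn ht
  have hle : t 0 ≤ t (Fin.last n) := ht.monotone (Fin.zero_le _)
  refine ⟨?_, ?_⟩
  -- The witnesses are the explicit formulas of `exactOnP2_iff_weights`, filled in by unification
  -- with `rfl`.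
  · refine ⟨_, _, _, (exactOnP2_iff_weights hn ht d _ _ _).2
      fun i _ => ⟨rfl, rfl, rfl⟩, fun a' b' c' hE i hi => ?_⟩
    obtain ⟨h1, h2, h3⟩ := (exactOnP2_iff_weights hn ht d a' b' c').1 hE i
      (by rw [Finset.mem_Icc] at hi ⊢; omega)
    exact ⟨h1, by rw [h3, h1, h2], h2⟩
  · intro a b c hE
    have hext : ∀ f : C(Icc (t 0) (t (Fin.last n)), ℝ),
        Continuous (IccExtend hle f) := fun f => f.continuous.Icc_extend'
    have hcont : ∀ f : C(Icc (t 0) (t (Fin.last n)), ℝ),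
        Continuous fun x : Icc (t 0) (t (Fin.last n)) =>
          G2 (d + 2) t a b c (IccExtend hle f) x := by
      intro f
      simp only [G2_eq_sum]
      refine continuous_finsetSum _ fun i _ => continuous_const.mul ?_
      have := h.continuousOn_bspline (d + 1) ((i : ℤ) - (d + 2 : ℕ))
      rw [knot_zero, knot_last] at this
      exact continuousOn_iff_continuous_domRestrict.1 this
    let G₀ : C(Icc (t 0) (t (Fin.last n)), ℝ) →ₗ[ℝ] C(Icc (t 0) (t (Fin.last n)), ℝ) :=
      { toFun := fun f => ⟨_, hcont f⟩
        map_add' := by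
          intro f g
          ext x
          simp only [ContinuousMap.add_apply, ContinuousMap.coe_mk, G2_eq_sum]
          rw [← Finset.sum_add_distrib]
          refine Finset.sum_congr rfl fun i hi => ?_
          rw [Finset.mem_range] at hi
          rw [← add_mul, ← quasiCoef_add hn ht d a b c (by omega) (hext f).continuousOn
            (hext g).continuousOn]
          rfl
        map_smul' := by
          intro r f
          ext x
          simp only [ContinuousMap.smul_apply, ContinuousMap.coe_mk, G2_eq_sum, RingHom.id_apply,
            smul_eq_mul]
          rw [Finset.mul_sum]
          refine Finset.sum_congr rfl fun i hi => ?_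
          rw [Finset.mem_range] at hi
          rw [← mul_assoc, ← quasiCoef_const_mul hn ht d a b c (by omega)]
          rfl }
    have hG : ∀ f, ‖G₀ f‖ ≤ 5 * ‖f‖ := by
      intro f
      rw [ContinuousMap.norm_le _ (by positivity)]
      intro x
      exact abs_G2_le hn ht d hE (hext f).continuousOn (fun y _ => f.norm_coe_le_norm _) x.2
    exact ⟨G₀.mkContinuous 5 hG, fun f x => rfl, G₀.mkContinuous_norm_le (by norm_num) hG⟩
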